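/- Let $d\ge 1$ and let $\Gamma$ be the set of all locally finite subsets $\gamma\subset\mathbb R^d$ (i.e. $|\gamma\cap K|<\infty$ for every compact $K$), with the vague topology (the weakest topology making $\gamma\mapsto\langle f,\gamma\rangle:=\sum_{x\in\gamma}f(x)$ continuous for all $f\in C_0(\mathbb R^d)$, the continuous real functions with compact support) and its Borel $\sigma$-algebra. Let $\phi:\mathbb R^d\to\mathbb R\cup\{+\infty\}$ be a pair potential: Borel measurable with $\phi(-x)=\phi(x)\in\mathbb R$ for $x\neq0$. For $\gamma\in\Gamma$, $x\in\mathbb R^d\setminus\gamma$ let $E(x,\gamma)=\sum_{y\in\gamma}\phi(x-y)$ if $\sum_{y\in\gamma}|\phi(x-y)|<\infty$, and $E(x,\gamma)=+\infty$ otherwise. Let $z>0$ and let $\mu$ be a Gibbs measure, i.e. a probability measure on $\Gamma$ with $$\int_\Gamma\sum_{x\in\gamma}F(\gamma,x)\,\mu(d\gamma)=\int_\Gamma\int_{\mathbb R^d}z\,e^{-E(x,\gamma)}F(\gamma\cup\{x\},x)\,dx\,\mu(d\gamma)$$ for all measurable $F:\Gamma\times\mathbb R^d\to[0,\infty]$.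 For $r\in\mathbb Z^d$ let $Q_r=\{x: r^i-\frac12\le x^i<r^i+\frac12\ \forall i\}$, $\gamma_r=\gamma\cap Q_r$, let $\|\cdot\|$ be the maximum norm, and for $N\ge1$ let $\Lambda_N$ be the cube of side length $2N-1$ centred at $0$, the union of the $Q_r$ with $\|r\|\le N-1$. Suppose that one of the following holds: (a) $\phi$ satisfies * (I) $\int_{\mathbb R^d}|1-e^{-\phi(x)}|\,dx<\infty$; * (SS) there are $A>0$, $B\ge0$ such that $\sum_{\{x,y\}\subset\gamma}\phi(x-y)\ge\sum_r(A|\gamma_r|^2-B|\gamma_r|)$ whenever $\gamma\subset\Lambda_N$ for some $N\ge1$; * (LR) there is a decreasing positive function $a$ on $\{0,1,2,\dots\}$ with $\sum_{r\in\mathbb Z^d}a(\|r\|)<\infty$ such that, for all disjoint finite unions $\Lambda',\Lambda''$ of cubes $Q_r$ and all configurations $\gamma'\subset\Lambda'$, $\gamma''\subset\Lambda''$, $\sum_{x\in\gamma',y\in\gamma''}\phi(x-y)\ge-\sum_{r',r''}a(\|r'-r''\|)|\gamma'_{r'}||\gamma''_{r''}|$; and $\mu$ is tempered: for $\mu$-a.e.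 $\gamma$ there is an integer $n\ge1$ such that $\sum_{r\in\Lambda_N\cap\mathbb Z^d}|\gamma_r|^2\le n^2|\Lambda_N\cap\mathbb Z^d|$ for all $N\ge1$; or (b) $\phi$ satisfies (I) and (P): $\phi\ge0$. Let $\mathcal F$ be the set of cylinder functions $F(\gamma)=g(\langle f_1,\gamma\rangle,\dots,\langle f_N,\gamma\rangle)$ with $N\ge1$, $f_i\in C_0(\mathbb R^d)$ and $g\in C^\infty(\mathbb R^N)$ bounded together with all its derivatives. Put $D^-_xF(\gamma)=F(\gamma\setminus\{x\})-F(\gamma)$, $D^+_xF(\gamma)=F(\gamma)-F(\gamma\cup\{x\})$, and $$\mathcal E(F,G)=\int_\Gamma\sum_{x\in\gamma}D^-_xF(\gamma)\,D^-_xG(\gamma)\,\mu(d\gamma),\qquad F,G\in\mathcal F.$$ Then the following hold. 1. For all $F,G\in\mathcal F$ the integral defining $\mathcal E(F,G)$ converges absolutely and $$\mathcal E(F,G)=\int_\Gamma HF(\gamma)\,G(\gamma)\,\mu(d\gamma),\qquad HF(\gamma)=\int_{\mathbb R^d}z\,e^{-E(x,\gamma)}D^+_xF(\gamma)\,dx-\sum_{x\in\gamma}D^-_xF(\gamma),$$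 where the integral over $x$ converges absolutely for $\mu$-a.e. $\gamma$, and $HF\in L^2(\Gamma,\mu)$. 2. $\mathcal E$ and $H$ depend only on $\mu$-classes, so that they define a bilinear form and an operator in the real space $L^2(\Gamma,\mu)$ with domain the set of $\mu$-classes of functions in $\mathcal F$. The form is closable: if $\mathcal E(F_n-F_m,F_n-F_m)\to0$ and $F_n\to0$ in $L^2(\Gamma,\mu)$, then $\mathcal E(F_n,F_n)\to0$. 3. Its closure $(\mathcal E,D(\mathcal E))$ (the smallest closed symmetric nonnegative extension) is a Dirichlet form on $L^2(\Gamma,\mu)$: it is densely defined, symmetric, nonnegative, closed, and for every $F\in D(\mathcal E)$ one has $(0\vee F)\wedge1\in D(\mathcal E)$ and $\mathcal E((0\vee F)\wedge1,(0\vee F)\wedge1)\le\mathcal E(F,F)$. 4. The operator $(H,\mathcal F)$ is densely defined in $L^2(\Gamma,\mu)$ and has a Friedrichs extension, i.e. a self-adjoint extension which is the operator associated with the closure of the form $(F,G)\mapsto(HF,G)_{L^2(\mu)}$ on $\mathcal F$. -/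

import Mathlib

open MeasureTheory Filter Topology
open scoped ENNReal ContDiff

noncomputable section

namespace Glauber

/-! ### Symmetric forms on a dense or non-dense subspace of a real Hilbert space -/

/-- A bilinear form defined on a linear subspace of `V`. -/
structure PartialForm (V : Type*) [AddCommGroup V] [Module ℝ V] where
  domain : Submodule ℝ V
  form : domain →ₗ[ℝ] domain →ₗ[ℝ] ℝ

namespace PartialForm

section Basic

variable {V : Type*} [NormedAddCommGroup V] [InnerProductSpace ℝ V]

/-- `E(u_n - u_m, u_n - u_m) → 0` as `n, m → ∞`. -/
def IsFormCauchy (E : PartialForm V) (u : ℕ → E.domain) : Prop :=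
  Tendsto (fun p : ℕ × ℕ => E.form (u p.1 - u p.2) (u p.1 - u p.2)) atTop (𝓝 0)

/-- Closability: every `E`-Cauchy sequence converging to `0` in `V` satisfies `E(u_n, u_n) → 0`. -/
def IsClosable (E : PartialForm V) : Prop :=
  ∀ u : ℕ → E.domain, E.IsFormCauchy u → Tendsto (fun n => (u n : V)) atTop (𝓝 0) →
    Tendsto (fun n => E.form (u n) (u n)) atTop (𝓝 0)

/-- A symmetric closed form: symmetric, nonnegative, and with domain complete for the norm
`(‖u‖² + E(u, u))^{1/2}`. -/
structure IsSymmClosed (E : PartialForm V) : Prop where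
  symm : ∀ u v : E.domain, E.form u v = E.form v u
  nonneg : ∀ u : E.domain, 0 ≤ E.form u u
  complete : ∀ u : ℕ → E.domain, E.IsFormCauchy u → CauchySeq (fun n => (u n : V)) →
    ∃ x : E.domain, Tendsto (fun n => (u n : V)) atTop (𝓝 (x : V)) ∧
      Tendsto (fun n => E.form (u n - x) (u n - x)) atTop (𝓝 0)

/-- `E'` extends `E`. -/
def Extends (E' E : PartialForm V) : Prop :=
  ∃ h : E.domain ≤ E'.domain, ∀ u v : E.domain,
    E'.form (Submodule.inclusion h u) (Submodule.inclusion h v) = E.form u v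

/-- `E'` is the closure of `E`: a symmetric closed form extending `E`, in whose domain the domain
of `E` is dense for the norm `(‖u‖² + E'(u, u))^{1/2}`. This determines `E'`, and `E'` is then the
smallest symmetric closed form extending `E`. -/
structure IsClosureOf (E' E : PartialForm V) : Prop where
  isSymmClosed : E'.IsSymmClosed
  extends_form : E'.Extends E
  core : ∀ x : E'.domain, ∃ u : ℕ → E'.domain, (∀ n, (u n : V) ∈ E.domain) ∧
    Tendsto (fun n => (u n : V)) atTop (𝓝 (x : V)) ∧
    Tendsto (fun n => E'.form (u n - x) (u n - x)) atTop (𝓝 0)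

/-- `B` is the operator associated with `E`: `u ∈ D(B)` and `B u = w` if and only if `u ∈ D(E)` and
`E(u, v) = ⟪w, v⟫` for all `v ∈ D(E)`. -/
def IsAssociatedOperator (E : PartialForm V) (B : V →ₗ.[ℝ] V) : Prop :=
  ∀ u w : V, (u, w) ∈ B.graph ↔
    ∃ hu : u ∈ E.domain, ∀ v : E.domain, E.form ⟨u, hu⟩ v = inner ℝ w (v : V)

/-- The form `(u, v) ↦ ⟪A u, v⟫` on the domain of `A`. -/
def ofOperator (A : V →ₗ.[ℝ] V) : PartialForm V where
  domain := A.domain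
  form := LinearMap.mk₂ ℝ (fun u v => inner ℝ (A u) (v : V))
    (fun u u' v => by simp [LinearPMap.map_add, inner_add_left])
    (fun c u v => by simp [LinearPMap.map_smul, inner_smul_left])
    (fun u v v' => by simp [inner_add_right])
    (fun c u v => by simp [inner_smul_right])

end Basic

/-- `B` is the Friedrichs extension of the densely defined operator `A`: a self-adjoint extension
of `A`, which is the operator associated with the closure of `(u, v) ↦ ⟪A u, v⟫`. -/
def IsFriedrichsExtension {V : Type*} [NormedAddCommGroup V] [InnerProductSpace ℝ V]
    [CompleteSpace V] (B A : V →ₗ.[ℝ] V) : Prop :=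
  Dense (A.domain : Set V) ∧ A ≤ B ∧ IsSelfAdjoint B ∧
    ∃ q : PartialForm V, q.IsClosureOf (ofOperator A) ∧ q.IsAssociatedOperator B

/-- Symmetric Dirichlet form on `L²(μ)`: a densely defined symmetric closed form such that for all
`u ∈ D(E)` one has `(0 ∨ u) ∧ 1 ∈ D(E)` and `E((0 ∨ u) ∧ 1) ≤ E(u)`. -/
structure IsDirichletForm {X : Type*} [MeasurableSpace X] {μ : Measure X}
    (E : PartialForm (Lp ℝ 2 μ)) : Prop where
  dense : Dense (E.domain : Set (Lp ℝ 2 μ))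
  isSymmClosed : E.IsSymmClosed
  unit_contraction : ∀ u : E.domain, ∃ v : E.domain,
    ((v : Lp ℝ 2 μ) : X → ℝ) =ᵐ[μ] (fun x => min (max 0 ((u : Lp ℝ 2 μ) x)) 1) ∧
      E.form v v ≤ E.form u u

end PartialForm

/-! ### Configuration space -/

/-- `ℝ^d`. -/
abbrev Space (d : ℕ) : Type := EuclideanSpace ℝ (Fin d)

/-- Locally finite subsets of `ℝ^d`. -/
def Config (d : ℕ) : Type :=
  {γ : Set (Space d) // ∀ K : Set (Space d), IsCompact K → (γ ∩ K).Finite}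

namespace Config

variable {d : ℕ}

/-- The points of a configuration. -/
def pts (γ : Config d) : Set (Space d) := γ.1

/-- `γ ∪ {x}`. -/
def add (γ : Config d) (x : Space d) : Config d :=
  ⟨insert x γ.1, fun K hK => ((γ.2 K hK).insert x).subset (by
    rintro y ⟨rfl | hy, hyK⟩
    · exact Set.mem_insert _ _
    · exact Set.mem_insert_of_mem _ ⟨hy, hyK⟩)⟩

/-- `γ \ {x}`. -/
def remove (γ : Config d) (x : Space d) : Config d :=
  ⟨γ.1 \ {x}, fun K hK => (γ.2 K hK).subset fun _ hy => ⟨hy.1.1, hy.2⟩⟩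

/-- `⟨f, γ⟩ = ∑_{x ∈ γ} f x`; a finite sum if `f` has compact support. -/
def pairing (f : Space d → ℝ) (γ : Config d) : ℝ := ∑' x : γ.pts, f x

/-- The vague topology: the weakest one making `γ ↦ ⟨f, γ⟩` continuous for every continuous `f` with
compact support. -/
instance : TopologicalSpace (Config d) :=
  ⨅ f : CompactlySupportedContinuousMap (Space d) ℝ,
    TopologicalSpace.induced (fun γ : Config d => pairing f γ) inferInstance

instance : MeasurableSpace (Config d) := borel (Config d)

instance : BorelSpace (Config d) := ⟨rfl⟩

end Config

/-! ### Pair potentials and Gibbs measures -/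

section Potential

variable {d : ℕ}

/-- A Borel function `φ : ℝ^d → ℝ ∪ {+∞}` with `φ(-x) = φ(x) ∈ ℝ` for `x ≠ 0`. -/
structure IsPairPotential (φ : Space d → EReal) : Prop where
  measurable : Measurable φ
  ne_bot : ∀ x, φ x ≠ ⊥
  even : ∀ x, x ≠ 0 → φ (-x) = φ x
  ne_top : ∀ x, x ≠ 0 → φ x ≠ ⊤

open Classical in
/-- The relative energy of interaction of a particle at `x ∉ γ` with `γ` (the numbers `φ (x - y)`,
`y ∈ γ`, are then real). -/
def relEnergy (φ : Space d → EReal) (x : Space d) (γ : Config d) : EReal :=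
  if Summable (fun y : γ.pts => |(φ (x - y)).toReal|) then
    ((∑' y : γ.pts, (φ (x - y)).toReal : ℝ) : EReal)
  else ⊤

/-- `exp(-E(x, γ))`; equal to `0` if `E(x, γ) = +∞`. -/
def boltzmann (φ : Space d → EReal) (x : Space d) (γ : Config d) : ℝ≥0∞ :=
  EReal.exp (-relEnergy φ x γ)

/-- Grand canonical Gibbs measures of activity `z`, through the Georgii–Nguyen–Zessin identity. -/
def IsGibbs (φ : Space d → EReal) (z : ℝ) (μ : Measure (Config d)) : Prop :=
  IsProbabilityMeasure μ ∧
    ∀ F : Config d → Space d → ℝ≥0∞, Measurable (Function.uncurry F) →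
      ∫⁻ γ, (∑' x : γ.pts, F γ x) ∂μ =
        ∫⁻ γ, (∫⁻ x : Space d, ENNReal.ofReal z * boltzmann φ x γ * F (γ.add x) x) ∂μ

/-- The half-open unit cube centred at `r ∈ ℤ^d`. -/
def cube (r : Fin d → ℤ) : Set (Space d) :=
  {x | ∀ i, (r i : ℝ) - 1 / 2 ≤ x i ∧ x i < (r i : ℝ) + 1 / 2}

/-- The number of points of a set in the cube `Q_r`. -/
def cubeCount (γ : Set (Space d)) (r : Fin d → ℤ) : ℕ := (γ ∩ cube r).ncard

/-- The lattice points of the cube `Λ_N` of side length `2N - 1` centred at the origin. -/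
def gridBox (d N : ℕ) : Finset (Fin d → ℤ) :=
  Finset.Icc (fun _ => 1 - (N : ℤ)) (fun _ => (N : ℤ) - 1)

/-- The cube `Λ_N` of side length `2N - 1` centred at the origin, a union of unit cubes. -/
def bigCube (d N : ℕ) : Set (Space d) := ⋃ r ∈ gridBox d N, cube r

/-- The maximum norm on `ℤ^d`. -/
def maxNorm (r : Fin d → ℤ) : ℕ := Finset.univ.sup fun i => (r i).natAbs

open Classical in
/-- Superstability. A configuration contained in a bounded set is a finite set; the sum over
unordered pairs is half the sum over ordered pairs of distinct points. -/
def Superstable (φ : Space d → EReal) : Prop :=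
  ∃ A B : ℝ, 0 < A ∧ 0 ≤ B ∧ ∀ N : ℕ, 1 ≤ N → ∀ γ : Finset (Space d),
    (γ : Set (Space d)) ⊆ bigCube d N →
      ∑ r ∈ gridBox d N, (A * (cubeCount (γ : Set (Space d)) r : ℝ) ^ 2
          - B * (cubeCount (γ : Set (Space d)) r : ℝ))
        ≤ (1 / 2) * ∑ p ∈ γ.offDiag, (φ (p.1 - p.2)).toReal

/-- Lower regularity, for disjoint finite unions `Λ'`, `Λ''` of unit cubes, indexed by `R'`, `R''`. -/
def LowerRegular (φ : Space d → EReal) : Prop :=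
  ∃ a : ℕ → ℝ, Antitone a ∧ (∀ n, 0 < a n) ∧ Summable (fun r : Fin d → ℤ => a (maxNorm r)) ∧
    ∀ R' R'' : Finset (Fin d → ℤ), Disjoint R' R'' → ∀ γ' γ'' : Finset (Space d),
      (γ' : Set (Space d)) ⊆ (⋃ r ∈ R', cube r) → (γ'' : Set (Space d)) ⊆ (⋃ r ∈ R'', cube r) →
        -(∑ r' ∈ R', ∑ r'' ∈ R'', a (maxNorm (r' - r'')) *
            (cubeCount (γ' : Set (Space d)) r' : ℝ) * (cubeCount (γ'' : Set (Space d)) r'' : ℝ))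
          ≤ ∑ x ∈ γ', ∑ y ∈ γ'', (φ (x - y)).toReal

/-- Integrability of `1 - exp(-φ)` over `ℝ^d` (`φ` is real away from the origin). -/
def PotentialIntegrable (φ : Space d → EReal) : Prop :=
  Integrable (fun x : Space d => 1 - Real.exp (-(φ x).toReal))

/-- Positivity. -/
def PotentialPositive (φ : Space d → EReal) : Prop := ∀ x, 0 ≤ φ x

/-- Tempered measures: supported by the union over `n ≥ 1` of the sets `S_n` of all `γ` with
`∑_{r ∈ Λ_N ∩ ℤ^d} |γ_r|² ≤ n² |Λ_N ∩ ℤ^d|` for all `N ≥ 1`. -/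
def IsTempered (μ : Measure (Config d)) : Prop :=
  ∀ᵐ γ ∂μ, ∃ n : ℕ, 1 ≤ n ∧ ∀ N : ℕ, 1 ≤ N →
    ∑ r ∈ gridBox d N, cubeCount γ.pts r ^ 2 ≤ n ^ 2 * (gridBox d N).card

end Potential

/-! ### Cylinder functions, the form and the generator -/

section Form

variable {d : ℕ}

/-- `C_b^∞(ℝ^N)`: smooth functions bounded together with all their derivatives. -/
def IsSmoothBounded {N : ℕ} (g : EuclideanSpace ℝ (Fin N) → ℝ) : Prop :=
  ContDiff ℝ ∞ g ∧ ∀ k : ℕ, ∃ C : ℝ, ∀ x, ‖iteratedFDeriv ℝ k g x‖ ≤ C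

/-- The smooth bounded cylinder functions `γ ↦ g(⟨f_1, γ⟩, …, ⟨f_N, γ⟩)`. -/
def cylinderFunctions (d : ℕ) : Set (Config d → ℝ) :=
  {F | ∃ (N : ℕ) (f : Fin N → CompactlySupportedContinuousMap (Space d) ℝ)
      (g : EuclideanSpace ℝ (Fin N) → ℝ), 1 ≤ N ∧ IsSmoothBounded g ∧
      ∀ γ, F γ = g (WithLp.toLp 2 fun i => Config.pairing (f i) γ)}

/-- `D⁻_x F(γ) = F(γ \ x) - F(γ)`. -/
def dMinus (F : Config d → ℝ) (γ : Config d) (x : Space d) : ℝ := F (γ.remove x) - F γ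

/-- `D⁺_x F(γ) = F(γ) - F(γ ∪ x)`. -/
def dPlus (F : Config d → ℝ) (γ : Config d) (x : Space d) : ℝ := F γ - F (γ.add x)

/-- `(D⁻F(γ), D⁻G(γ))` in `L²(ℝ^d, γ)`. -/
def carre (F G : Config d → ℝ) (γ : Config d) : ℝ :=
  ∑' x : γ.pts, dMinus F γ x * dMinus G γ x

/-- `ℰ(F, G) = ∫ ∑_{x ∈ γ} D⁻_x F(γ) D⁻_x G(γ) μ(dγ)`. -/
def energy (μ : Measure (Config d)) (F G : Config d → ℝ) : ℝ := ∫ γ, carre F G γ ∂μ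

/-- The integrand `z exp(-E(x, γ)) D⁺_x F(γ)` of the birth part of the generator. -/
def birthIntegrand (φ : Space d → EReal) (z : ℝ) (F : Config d → ℝ) (γ : Config d)
    (x : Space d) : ℝ :=
  z * (boltzmann φ x γ).toReal * dPlus F γ x

/-- `HF(γ) = ∫ z exp(-E(x, γ)) D⁺_x F(γ) dx - ∑_{x ∈ γ} D⁻_x F(γ)`. -/
def generator (φ : Space d → EReal) (z : ℝ) (F : Config d → ℝ) (γ : Config d) : ℝ :=
  (∫ x, birthIntegrand φ z F γ x) - ∑' x : γ.pts, dMinus F γ x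

/-- `E₀` is the form `ℰ` on the `μ`-classes of cylinder functions. -/
def IsCylinderForm (μ : Measure (Config d)) (E₀ : PartialForm (Lp ℝ 2 μ)) : Prop :=
  (∀ u : Lp ℝ 2 μ, u ∈ E₀.domain ↔ ∃ F ∈ cylinderFunctions d, (u : Config d → ℝ) =ᵐ[μ] F) ∧
    ∀ u v : E₀.domain, ∀ F ∈ cylinderFunctions d, ∀ G ∈ cylinderFunctions d,
      ((u : Lp ℝ 2 μ) : Config d → ℝ) =ᵐ[μ] F → ((v : Lp ℝ 2 μ) : Config d → ℝ) =ᵐ[μ] G →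
        E₀.form u v = energy μ F G

/-- `H₀` is the operator `H` on the `μ`-classes of cylinder functions. -/
def IsCylinderOperator (φ : Space d → EReal) (z : ℝ) (μ : Measure (Config d))
    (H₀ : Lp ℝ 2 μ →ₗ.[ℝ] Lp ℝ 2 μ) : Prop :=
  (∀ u : Lp ℝ 2 μ, u ∈ H₀.domain ↔ ∃ F ∈ cylinderFunctions d, (u : Config d → ℝ) =ᵐ[μ] F) ∧
    ∀ u : H₀.domain, ∀ F ∈ cylinderFunctions d, ((u : Lp ℝ 2 μ) : Config d → ℝ) =ᵐ[μ] F →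
      (H₀ u : Config d → ℝ) =ᵐ[μ] generator φ z F

end Form

end Glauber

end

noncomputable section

namespace Glauber

namespace PartialForm

/-! ### Closed forms given by a Hilbert space continuously embedded in `V` -/

section Embedding

variable {V K : Type*} [NormedAddCommGroup V] [InnerProductSpace ℝ V]
  [NormedAddCommGroup K] [InnerProductSpace ℝ K]

/-! The Georgii–Nguyen–Zessin identity for the kernel `D⁺_xF(γ) G(γ)` is an integration by parts: it
gives `ℰ(F, G) = ∫ HF · G dμ` (`energy_eq_integral_generator`). Once `HF` lies in `L²`, `H` is a
symmetric nonnegative operator on the classes of cylinder functions, which are dense, and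
closability and the Friedrichs extension become Hilbert space theory. The completion of the domain
for `⟪u, v⟫ + ⟪A u, v⟫` embeds injectively in the ambient space by a map `j`; the closed form is
read off from `j`, and its operator is `(j j*)⁻¹ - 1`.

The analytic core is `HasMomentBounds`: the squared number of points in a cube and the squared
Boltzmann factor, uniformly over the cube, have a common integrable majorant. For `φ ≥ 0` the
Boltzmann factor is at most `1`, and the identity used twice bounds the second moment of the count.

For superstable, lower regular `φ` the argument is in the spirit of Ruelle's estimates. Compare the
sum of squared occupation numbers of the box `‖r‖ ≤ n` with its volume. By temperedness these ratios
are bounded, so either all of them with `n ≥ n₀` are at most `t`, or some box has ratio at least `t`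
and almost maximal among larger boxes (`exists_mem_denseEvent`). In the first case everything is
bounded by constants. In the second, summation by parts in the decay function `a` shows that the
exterior has little influence on the box (`exists_sum_outer_le`), so superstability beats the
interaction with the exterior and the density of the particles in the box is at most `exp(-(A/4) ∑
|γ_r|² + const · volume)` (`listWeight_le`). Extracting the particles one at a time with the
identity (`setLIntegral_countEvent_le`) then bounds the expectation of `exp((A/8) ∑ |γ_r|²)` on the
event by `e⁻ⁿ`, which is summable in `n`.

The Dirichlet property holds because a contraction of `ℝ` shrinks every difference `D⁻_xF`. The unit
clamp is not smooth, so it is mollified (`exists_smooth_contraction`), and the limits are taken by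
lower semicontinuity of the closed form (`ofEmbedding_lsc`). -/

/-- The inverse of an injective map, on its range. -/
def rangeInv (j : K →L[ℝ] V) (hj : Function.Injective j) :
    LinearMap.range (j : K →ₗ[ℝ] V) →ₗ[ℝ] K :=
  (LinearEquiv.ofInjective (j : K →ₗ[ℝ] V) hj).symm.toLinearMap

theorem rangeInv_apply {j : K →L[ℝ] V} (hj : Function.Injective j) {v : V}
    (hv : v ∈ LinearMap.range (j : K →ₗ[ℝ] V)) {k : K} (hk : j k = v) :
    rangeInv j hj ⟨v, hv⟩ = k := by
  subst hk
  exact (LinearEquiv.ofInjective (j : K →ₗ[ℝ] V) hj).symm_apply_apply k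

theorem apply_rangeInv {j : K →L[ℝ] V} (hj : Function.Injective j)
    (v : LinearMap.range (j : K →ₗ[ℝ] V)) : j (rangeInv j hj v) = v :=
  congrArg Subtype.val ((LinearEquiv.ofInjective (j : K →ₗ[ℝ] V) hj).apply_symm_apply v)

/-- The form `(j k, j k') ↦ ⟪k, k'⟫ - ⟪j k, j k'⟫` on the range of `j`. -/
def ofEmbedding (j : K →L[ℝ] V) (hj : Function.Injective j) : PartialForm V where
  domain := LinearMap.range (j : K →ₗ[ℝ] V)
  form := LinearMap.mk₂ ℝ
    (fun u v => inner ℝ (rangeInv j hj u) (rangeInv j hj v) - inner ℝ (u : V) (v : V))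
    (fun u u' v => by simp only [map_add, inner_add_left, Submodule.coe_add]; ring)
    (fun c u v => by
      simp only [map_smul, real_inner_smul_left, Submodule.coe_smul, smul_eq_mul]; ring)
    (fun u v v' => by simp only [map_add, inner_add_right, Submodule.coe_add]; ring)
    (fun c u v => by
      simp only [map_smul, real_inner_smul_right, Submodule.coe_smul, smul_eq_mul]; ring)

variable {j : K →L[ℝ] V} (hj : Function.Injective j)

theorem mem_ofEmbedding {k : K} {v : V} (h : j k = v) : v ∈ (ofEmbedding j hj).domain := ⟨k, h⟩

/-- The element `k` with `j k = u`. -/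
def preimage : (ofEmbedding j hj).domain →ₗ[ℝ] K := rangeInv j hj

theorem preimage_eq {k : K} {u : (ofEmbedding j hj).domain} (h : j k = u) :
    preimage hj u = k :=
  rangeInv_apply hj u.2 h

theorem apply_preimage (u : (ofEmbedding j hj).domain) : j (preimage hj u) = u :=
  apply_rangeInv hj u

theorem ofEmbedding_form (u v : (ofEmbedding j hj).domain) :
    (ofEmbedding j hj).form u v =
      inner ℝ (preimage hj u) (preimage hj v) - inner ℝ (u : V) (v : V) := rfl

theorem ofEmbedding_form_self (u : (ofEmbedding j hj).domain) :
    (ofEmbedding j hj).form u u = ‖preimage hj u‖ ^ 2 - ‖(u : V)‖ ^ 2 := by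
  rw [ofEmbedding_form, real_inner_self_eq_norm_sq, real_inner_self_eq_norm_sq]

theorem isSymmClosed_ofEmbedding [CompleteSpace K] (hn : ∀ k, ‖j k‖ ≤ ‖k‖) :
    (ofEmbedding j hj).IsSymmClosed where
  symm u v := by
    rw [ofEmbedding_form, ofEmbedding_form, real_inner_comm, real_inner_comm (v : V)]
  nonneg u := by
    rw [ofEmbedding_form_self, sub_nonneg]
    have := hn (preimage hj u)
    rw [apply_preimage] at this
    gcongr
  complete u hu hc := by
    -- The squared norm of `K` is the form plus the squared norm of `V`, so the two Cauchy
    -- conditions together say that the preimages are Cauchy in `K`.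
    have hc' : CauchySeq (fun n => preimage hj (u n)) := by
      rw [cauchySeq_iff_tendsto_dist_atTop_0] at hc ⊢
      have h1 := hu.add (hc.pow 2)
      simp only [ofEmbedding_form_self] at h1
      have h2 : Tendsto (fun p : ℕ × ℕ => ‖preimage hj (u p.1) - preimage hj (u p.2)‖ ^ 2)
          atTop (𝓝 0) := by
        convert h1 using 2 with p
        · rw [map_sub, dist_eq_norm, Submodule.coe_sub]; ring
        · simp
      have h3 := h2.sqrt
      simpa [dist_eq_norm] using h3
    obtain ⟨k, hk⟩ := cauchySeq_tendsto_of_complete hc'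
    have hlim : Tendsto (fun n => (u n : V)) atTop (𝓝 (j k)) := by
      have := (j.continuous.tendsto k).comp hk
      refine this.congr fun n => ?_
      simp [apply_preimage]
    refine ⟨⟨j k, mem_ofEmbedding hj rfl⟩, hlim, ?_⟩
    have h1 : Tendsto (fun n => ‖preimage hj (u n) - k‖ ^ 2 - ‖(u n : V) - j k‖ ^ 2) atTop
        (𝓝 (0 ^ 2 - 0 ^ 2)) :=
      ((tendsto_iff_norm_sub_tendsto_zero.1 hk).pow 2).sub
        ((tendsto_iff_norm_sub_tendsto_zero.1 hlim).pow 2)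
    rw [sub_self] at h1
    refine h1.congr fun n => ?_
    rw [ofEmbedding_form_self, map_sub,
      preimage_eq hj (k := k) (u := ⟨j k, mem_ofEmbedding hj rfl⟩) rfl, Submodule.coe_sub]

/-- Lower semicontinuity of a closed form. -/
theorem ofEmbedding_lsc [CompleteSpace K] [CompleteSpace V]
    {v : ℕ → (ofEmbedding j hj).domain} {w : V} {c : ℕ → ℝ} {c₀ : ℝ}
    (hv : Tendsto (fun n => (v n : V)) atTop (𝓝 w))
    (hc : ∀ n, (ofEmbedding j hj).form (v n) (v n) ≤ c n) (hc₀ : Tendsto c atTop (𝓝 c₀)) :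
    ∃ hw : w ∈ (ofEmbedding j hj).domain, (ofEmbedding j hj).form ⟨w, hw⟩ ⟨w, hw⟩ ≤ c₀ := by
  set k : ℕ → K := fun n => preimage hj (v n) with hk
  have hjk : ∀ n, j (k n) = v n := fun n => apply_preimage hj (v n)
  have hle : ∀ n, ‖k n‖ ^ 2 ≤ c n + ‖(v n : V)‖ ^ 2 := fun n => by
    have := hc n
    rw [ofEmbedding_form_self] at this
    linarith
  have hlim : Tendsto (fun n => c n + ‖(v n : V)‖ ^ 2) atTop (𝓝 (c₀ + ‖w‖ ^ 2)) :=
    hc₀.add (hv.norm.pow 2)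
  obtain ⟨C, hC⟩ := hlim.bddAbove_range
  have hkC : ∀ n, ‖k n‖ ≤ Real.sqrt C := fun n =>
    Real.le_sqrt_of_sq_le ((hle n).trans (hC ⟨n, rfl⟩))
  -- The preimages are bounded in `K`, so by Banach–Alaoglu they converge weakly along a
  -- nonprincipal ultrafilter. This avoids extracting a subsequence.
  let U : Ultrafilter ℕ := hyperfilter ℕ
  have hU : (U : Filter ℕ) ≤ atTop := Nat.hyperfilter_le_atTop
  let T : ℕ → WeakDual ℝ K := fun n => StrongDual.toWeakDual (InnerProductSpace.toDual ℝ K (k n))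
  have hcomp := WeakDual.isCompact_closedBall (𝕜 := ℝ) (E := K) 0 (Real.sqrt C)
  obtain ⟨ℓ, -, hℓ⟩ := hcomp.ultrafilter_le_nhds (U.map T) (by
    rw [le_principal_iff]
    refine Filter.mem_map.2 (Filter.univ_mem' fun n => ?_)
    simp only [Set.mem_preimage, T, Metric.mem_closedBall, dist_zero_right]
    change ‖InnerProductSpace.toDual ℝ K (k n)‖ ≤ _
    simpa using hkC n)
  have hpt : ∀ x : K, Tendsto (fun n => inner ℝ (k n) x) U (𝓝 (ℓ x)) := fun x =>
    ((WeakDual.eval_continuous x).tendsto ℓ).comp hℓ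
  set p : K := (InnerProductSpace.toDual ℝ K).symm (WeakDual.toStrongDual ℓ) with hp
  have hpℓ : ∀ x, inner ℝ p x = ℓ x := fun x => by
    rw [hp, InnerProductSpace.toDual_symm_apply]; rfl
  -- Testing with `j.adjoint f` shows that `j` carries the weak limit `p` to the strong limit `w`.
  have hpw : j p = w := by
    refine ext_inner_right ℝ fun f => ?_
    have h1 : Tendsto (fun n => inner ℝ (v n : V) f) U (𝓝 (inner ℝ w f)) :=
      (hv.inner tendsto_const_nhds).mono_left hU
    have h2 := hpt (j.adjoint f)
    rw [← hpℓ, ContinuousLinearMap.adjoint_inner_right] at h2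
    refine tendsto_nhds_unique h2 (h1.congr fun n => ?_)
    rw [ContinuousLinearMap.adjoint_inner_right, hjk]
  -- Weak lower semicontinuity of the norm, from `⟪k n, p⟫ ≤ (‖k n‖² + ‖p‖²) / 2`.
  have hpn : ‖p‖ ^ 2 ≤ c₀ + ‖w‖ ^ 2 := by
    have h1 : Tendsto (fun n => inner ℝ (k n) p) U (𝓝 (‖p‖ ^ 2)) := by
      have := hpt p
      rwa [← hpℓ, real_inner_self_eq_norm_sq] at this
    have h2 : Tendsto (fun n => (c n + ‖(v n : V)‖ ^ 2 + ‖p‖ ^ 2) / 2) U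
        (𝓝 ((c₀ + ‖w‖ ^ 2 + ‖p‖ ^ 2) / 2)) :=
      ((hlim.add_const _).div_const 2).mono_left hU
    have h3 := le_of_tendsto_of_tendsto' h1 h2 fun n => by
      have a1 := real_inner_le_norm (k n) p
      have a2 := hle n
      nlinarith [sq_nonneg (‖k n‖ - ‖p‖)]
    linarith
  refine ⟨mem_ofEmbedding hj hpw, ?_⟩
  rw [ofEmbedding_form_self, preimage_eq hj (k := p) hpw]
  linarith

/-! ### The self-adjoint operator of a form given by an embedding -/

section Operator

variable [CompleteSpace K] [CompleteSpace V]

-- The kernel of `j.adjoint` is the orthogonal complement of the range of `j`, hence trivial when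
-- that range is dense.
include hj in
theorem injective_comp_adjoint (hd : DenseRange j) :
    Function.Injective (j ∘L j.adjoint) := by
  rw [injective_iff_map_eq_zero]
  intro f hf
  have h1 : j.adjoint f = 0 := hj (by simpa using hf)
  refine hd.eq_zero_of_inner_left ℝ fun k => ?_
  rw [← ContinuousLinearMap.adjoint_inner_left, h1, inner_zero_left]

/-- The operator `(j j*)⁻¹ - 1`. -/
def embeddingOperator (j : K →L[ℝ] V) (hj : Function.Injective j) (hd : DenseRange j) :
    V →ₗ.[ℝ] V where
  domain := LinearMap.range ((j ∘L j.adjoint : V →L[ℝ] V) : V →ₗ[ℝ] V)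
  toFun := rangeInv (j ∘L j.adjoint) (injective_comp_adjoint hj hd) - Submodule.subtype _

theorem mem_embeddingOperator (hd : DenseRange j) (f : V) :
    j (j.adjoint f) ∈ (embeddingOperator j hj hd).domain := ⟨f, rfl⟩

theorem exists_of_mem_embeddingOperator (hd : DenseRange j)
    (u : (embeddingOperator j hj hd).domain) :
    ∃ f, u = ⟨j (j.adjoint f), mem_embeddingOperator hj hd f⟩ := by
  obtain ⟨u, f, rfl⟩ := u
  exact ⟨f, rfl⟩

theorem embeddingOperator_apply (hd : DenseRange j) (f : V)
    (h : j (j.adjoint f) ∈ (embeddingOperator j hj hd).domain) :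
    embeddingOperator j hj hd ⟨j (j.adjoint f), h⟩ = f - j (j.adjoint f) := by
  have := rangeInv_apply (injective_comp_adjoint hj hd) (k := f) (v := j (j.adjoint f))
    ⟨f, rfl⟩ rfl
  exact congrArg (· - j (j.adjoint f)) this

theorem comp_adjoint_inner_comm (j : K →L[ℝ] V) (f g : V) :
    inner ℝ (j (j.adjoint f)) g = inner ℝ f (j (j.adjoint g)) := by
  rw [← ContinuousLinearMap.adjoint_inner_right, ContinuousLinearMap.adjoint_inner_left]

/-- If `u = j j* f`, its image is `w = f - u`, so `f` can only be `u + w`. The unbounded graph is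
thus one equation for a bounded operator. -/
theorem embeddingOperator_mem_graph (hd : DenseRange j) {u w : V} :
    (u, w) ∈ (embeddingOperator j hj hd).graph ↔ j (j.adjoint (u + w)) = u := by
  rw [LinearPMap.mem_graph_iff]
  constructor
  · rintro ⟨y, h1, h2⟩
    obtain ⟨f, rfl⟩ := exists_of_mem_embeddingOperator hj hd y
    rw [embeddingOperator_apply] at h2
    simp only at h1 h2
    rw [← h2, ← h1, add_sub_cancel]
  · intro h
    refine ⟨⟨j (j.adjoint (u + w)), mem_embeddingOperator hj hd _⟩, h, ?_⟩
    rw [embeddingOperator_apply, h, add_sub_cancel_left]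

theorem dense_embeddingOperator (hd : DenseRange j) :
    Dense ((embeddingOperator j hj hd).domain : Set V) := by
  rw [Submodule.dense_iff_topologicalClosure_eq_top,
    Submodule.topologicalClosure_eq_top_iff, Submodule.eq_bot_iff]
  intro x hx
  refine (injective_iff_map_eq_zero _).1 (injective_comp_adjoint hj hd) x ?_
  refine ext_inner_right ℝ fun f => ?_
  change inner ℝ (j (j.adjoint x)) f = _
  rw [comp_adjoint_inner_comm, inner_zero_left, real_inner_comm]
  exact hx _ (mem_embeddingOperator hj hd f)

/-- Adding the identity gives the inverse of the everywhere defined symmetric operator `j j*`, which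
leaves no room for a larger adjoint: if the adjoint sends `y` to `w`, testing against all `j j* g`
forces `j j* (y + w) = y`. -/
theorem isSelfAdjoint_embeddingOperator (hd : DenseRange j) :
    IsSelfAdjoint (embeddingOperator j hj hd) := by
  have hdense := dense_embeddingOperator hj hd
  have hle : embeddingOperator j hj hd ≤ (embeddingOperator j hj hd).adjoint := by
    refine LinearPMap.IsFormalAdjoint.le_adjoint hdense fun u v => ?_
    obtain ⟨f, rfl⟩ := exists_of_mem_embeddingOperator hj hd u
    obtain ⟨g, rfl⟩ := exists_of_mem_embeddingOperator hj hd v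
    rw [embeddingOperator_apply, embeddingOperator_apply, inner_sub_left, inner_sub_right,
      comp_adjoint_inner_comm]
    simp only [comp_adjoint_inner_comm]
  rw [LinearPMap.isSelfAdjoint_def]
  refine (LinearPMap.eq_of_le_of_domain_eq hle (le_antisymm hle.1 ?_)).symm
  intro y hy
  set w := (embeddingOperator j hj hd).adjoint ⟨y, hy⟩ with hw
  suffices j (j.adjoint (y + w)) = y by
    rw [← this]; exact mem_embeddingOperator hj hd _
  refine ext_inner_left ℝ fun g => ?_
  have h1 := LinearPMap.adjoint_isFormalAdjoint hdense ⟨y, hy⟩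
    ⟨j (j.adjoint g), mem_embeddingOperator hj hd g⟩
  rw [embeddingOperator_apply, inner_sub_right, ← hw] at h1
  simp only at h1
  rw [← comp_adjoint_inner_comm, inner_add_right, real_inner_comm w, h1, real_inner_comm g y,
    real_inner_comm (j (j.adjoint g)) y]
  ring

/-- If `k` is the preimage of `u`, the relation `E(u, j k') = ⟪w, j k'⟫` reads `⟪k, k'⟫ = ⟪u + w, j
k'⟫`. Holding for all `k'`, it means `k = j* (u + w)`. -/
theorem isAssociatedOperator_embeddingOperator (hd : DenseRange j) :
    (ofEmbedding j hj).IsAssociatedOperator (embeddingOperator j hj hd) := by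
  intro u w
  rw [embeddingOperator_mem_graph]
  constructor
  · intro h
    refine ⟨mem_ofEmbedding hj h, fun v => ?_⟩
    rw [ofEmbedding_form, preimage_eq hj (k := j.adjoint (u + w)) h,
      ContinuousLinearMap.adjoint_inner_left, inner_add_left, apply_preimage,
      add_sub_cancel_left]
  · rintro ⟨hu, h⟩
    refine Eq.trans (congrArg j ?_) (apply_preimage hj ⟨u, hu⟩)
    refine ext_inner_right ℝ fun k => ?_
    have h1 := h ⟨j k, mem_ofEmbedding hj rfl⟩
    rw [ofEmbedding_form,
      preimage_eq hj (k := k) (u := ⟨j k, mem_ofEmbedding hj rfl⟩) rfl] at h1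
    rw [ContinuousLinearMap.adjoint_inner_left, inner_add_left]
    simp only at h1
    linarith

end Operator

end Embedding

/-! ### The Friedrichs extension -/

section Friedrichs

variable {V : Type*} [NormedAddCommGroup V] [InnerProductSpace ℝ V]

/-- Symmetric nonnegative operators. -/
structure IsNonnegSymm (A : V →ₗ.[ℝ] V) : Prop where
  symm : ∀ u v : A.domain, inner ℝ (A u) (v : V) = inner ℝ (u : V) (A v)
  nonneg : ∀ u : A.domain, 0 ≤ inner ℝ (A u) (u : V)

/-- The domain of `A`, with the inner product `⟪u, v⟫ + ⟪A u, v⟫`. -/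
def FormDomain (A : V →ₗ.[ℝ] V) (_ : IsNonnegSymm A) : Type _ := A.domain

namespace FormDomain

variable {A : V →ₗ.[ℝ] V} (h : IsNonnegSymm A)

instance : AddCommGroup (FormDomain A h) := inferInstanceAs (AddCommGroup A.domain)

instance : Module ℝ (FormDomain A h) := inferInstanceAs (Module ℝ A.domain)

/-- The inner product `⟪u, v⟫ + ⟪A u, v⟫`. -/
@[reducible]
def core : InnerProductSpace.Core ℝ (FormDomain A h) where
  inner u v := inner ℝ (A.domain.subtype u) (A.domain.subtype v) +
    inner ℝ (A.toFun u) (A.domain.subtype v)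
  conj_inner_symm u v := by
    change inner ℝ (A.domain.subtype v) (A.domain.subtype u) + _ = _
    have := h.symm v u
    change inner ℝ (A.toFun v) (A.domain.subtype u) = inner ℝ (A.domain.subtype v) (A.toFun u)
      at this
    rw [real_inner_comm, this, real_inner_comm (A.toFun u)]
  re_inner_nonneg u := add_nonneg real_inner_self_nonneg (h.nonneg u)
  add_left u v w := by
    have h1 : A.domain.subtype (u + v) = A.domain.subtype u + A.domain.subtype v := map_add _ _ _
    have h2 : A.toFun (u + v) = A.toFun u + A.toFun v := map_add _ _ _
    rw [h1, h2, inner_add_left, inner_add_left]; ring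
  smul_left u v c := by
    have h1 : A.domain.subtype (c • u) = c • A.domain.subtype u := map_smul _ _ _
    have h2 : A.toFun (c • u) = c • A.toFun u := map_smul _ _ _
    rw [h1, h2, real_inner_smul_left, real_inner_smul_left]
    simp only [conj_trivial]; ring
  definite u hu := by
    have h1 : 0 ≤ inner ℝ (A.domain.subtype u) (A.domain.subtype u) := real_inner_self_nonneg
    have h2 : 0 ≤ inner ℝ (A.toFun u) (A.domain.subtype u) := h.nonneg u
    have h3 : inner ℝ (A.domain.subtype u) (A.domain.subtype u) = 0 :=
      le_antisymm (by linarith [hu.le]) h1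
    exact Subtype.ext (inner_self_eq_zero.1 h3)

instance : NormedAddCommGroup (FormDomain A h) := (core h).toNormedAddCommGroup

instance : InnerProductSpace ℝ (FormDomain A h) := InnerProductSpace.ofCore (core h).toCore

/-- The inclusion in `V`. -/
def val : FormDomain A h →ₗ[ℝ] V := A.domain.subtype

/-- An element of the domain of `A`. -/
def of (u : A.domain) : FormDomain A h := u

theorem inner_def (u v : FormDomain A h) :
    inner ℝ u v = inner ℝ (val h u) (val h v) + inner ℝ (A.toFun u) (val h v) := rfl

theorem norm_sq (u : FormDomain A h) :
    ‖u‖ ^ 2 = ‖val h u‖ ^ 2 + inner ℝ (A.toFun u) (val h u) := by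
  rw [← real_inner_self_eq_norm_sq, ← real_inner_self_eq_norm_sq]; rfl

theorem norm_val_le (u : FormDomain A h) : ‖val h u‖ ≤ ‖u‖ := by
  refine abs_le_of_sq_le_sq' ?_ (norm_nonneg _) |>.2
  rw [norm_sq]
  have : 0 ≤ inner ℝ (A.toFun u) (val h u) := h.nonneg u
  linarith

/-- The inclusion in `V` as a continuous map. -/
def valL : FormDomain A h →L[ℝ] V :=
  (val h).mkContinuous 1 fun u => by rw [one_mul]; exact norm_val_le h u

variable [CompleteSpace V]

/-- The extension of the inclusion to the completion. -/
def embed : UniformSpace.Completion (FormDomain A h) →L[ℝ] V :=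
  (valL h).extend UniformSpace.Completion.toComplL

theorem embed_coe (u : FormDomain A h) : embed h (u : UniformSpace.Completion _) = val h u :=
  ContinuousLinearMap.extend_eq _ UniformSpace.Completion.denseRange_coe
    (UniformSpace.Completion.isUniformInducing_coe _) u

theorem norm_embed_le (w : UniformSpace.Completion (FormDomain A h)) : ‖embed h w‖ ≤ ‖w‖ := by
  refine UniformSpace.Completion.induction_on w (isClosed_le (by fun_prop) (by fun_prop)) fun u => ?_
  rw [embed_coe, UniformSpace.Completion.norm_coe]
  exact norm_val_le h u

/-- Symmetry of `A` on its domain, extended by continuity. Pairings of the completion with the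
original domain thus depend only on the image in `V`. -/
theorem inner_coe_right (w : UniformSpace.Completion (FormDomain A h)) (u : FormDomain A h) :
    inner ℝ w (u : UniformSpace.Completion _) = inner ℝ (embed h w) (val h u + A.toFun u) := by
  refine UniformSpace.Completion.induction_on w (isClosed_eq (by fun_prop) (by fun_prop))
    fun v => ?_
  rw [UniformSpace.Completion.inner_coe, embed_coe, inner_def, inner_add_right]
  congr 1
  exact h.symm v u

/-- This is where it matters that the form comes from an operator: by `inner_coe_right`, an element
with image `0` is orthogonal to the dense subspace `FormDomain A h`. -/
theorem embed_injective : Function.Injective (embed h) := by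
  rw [injective_iff_map_eq_zero]
  intro w hw
  have hd : DenseRange ((↑) : FormDomain A h → UniformSpace.Completion (FormDomain A h)) :=
    UniformSpace.Completion.denseRange_coe
  refine hd.eq_zero_of_inner_left ℝ fun u => ?_
  rw [inner_coe_right, hw, inner_zero_left]

theorem denseRange_embed (hd : Dense (A.domain : Set V)) : DenseRange (embed h) := by
  refine hd.mono ?_
  intro u hu
  exact ⟨(of h ⟨u, hu⟩ : FormDomain A h), embed_coe h _⟩

theorem adjoint_embed (u : FormDomain A h) :
    (embed h).adjoint (val h u + A.toFun u) = (u : UniformSpace.Completion _) := by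
  refine ext_inner_left ℝ fun w => ?_
  rw [ContinuousLinearMap.adjoint_inner_right, inner_coe_right]

end FormDomain

variable [CompleteSpace V] {A : V →ₗ.[ℝ] V} (h : IsNonnegSymm A)

theorem ofEmbedding_embed_form (u v : A.domain)
    (hu : (u : V) ∈ (ofEmbedding _ (FormDomain.embed_injective h)).domain)
    (hv : (v : V) ∈ (ofEmbedding _ (FormDomain.embed_injective h)).domain) :
    (ofEmbedding _ (FormDomain.embed_injective h)).form ⟨u, hu⟩ ⟨v, hv⟩ =
      (ofOperator A).form u v := by
  rw [ofEmbedding_form, preimage_eq _ (FormDomain.embed_coe h (FormDomain.of h u)),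
    preimage_eq _ (FormDomain.embed_coe h (FormDomain.of h v)), UniformSpace.Completion.inner_coe,
    FormDomain.inner_def]
  exact add_sub_cancel_left _ _

theorem isClosureOf_embed : (ofEmbedding _ (FormDomain.embed_injective h)).IsClosureOf
    (ofOperator A) where
  isSymmClosed := isSymmClosed_ofEmbedding _ (FormDomain.norm_embed_le h)
  extends_form := ⟨fun u hu => mem_ofEmbedding _ (FormDomain.embed_coe h (FormDomain.of h ⟨u, hu⟩)),
    fun u v => ofEmbedding_embed_form h u v _ _⟩
  core := by
    intro y
    set w := preimage _ y with hw
    have hy : FormDomain.embed h w = y := apply_preimage _ y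
    obtain ⟨x, hx, hxw⟩ := mem_closure_iff_seq_limit.1
      ((UniformSpace.Completion.denseRange_coe (α := FormDomain A h)) w)
    choose u hu using hx
    have hlim : Tendsto (fun n => FormDomain.embed h (x n)) atTop (𝓝 (FormDomain.embed h w)) :=
      ((FormDomain.embed h).continuous.tendsto w).comp hxw
    rw [hy] at hlim
    refine ⟨fun n => ⟨FormDomain.embed h (x n), mem_ofEmbedding _ rfl⟩, fun n => ?_, hlim, ?_⟩
    · simp only [← hu, FormDomain.embed_coe]
      exact (u n).2
    · have h1 : Tendsto (fun n => ‖x n - w‖ ^ 2 -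
          ‖FormDomain.embed h (x n) - y‖ ^ 2) atTop (𝓝 (0 ^ 2 - 0 ^ 2)) :=
        ((tendsto_iff_norm_sub_tendsto_zero.1 hxw).pow 2).sub
          ((tendsto_iff_norm_sub_tendsto_zero.1 hlim).pow 2)
      rw [sub_self] at h1
      refine h1.congr fun n => ?_
      rw [ofEmbedding_form_self, map_sub, preimage_eq _ (k := x n) rfl]
      rfl

/-- A form-Cauchy sequence has a limit in the domain of the closed extension. If the sequence tends
to `0` in `V`, that limit is `0`, and convergence in the form is the claim. -/
theorem isClosable_ofOperator (h : IsNonnegSymm A) : (ofOperator A).IsClosable := by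
  intro u hu h0
  have hn : ∀ v : A.domain, (ofOperator A).form v v =
      ‖(show FormDomain A h from v)‖ ^ 2 - ‖(v : V)‖ ^ 2 := fun v => by
    rw [FormDomain.norm_sq]
    exact (add_sub_cancel_left _ _).symm
  obtain ⟨x, hx, hx'⟩ := (isSymmClosed_ofEmbedding (FormDomain.embed_injective h)
    (FormDomain.norm_embed_le h)).complete
    (fun n => ⟨(u n : V), _, FormDomain.embed_coe h (u n)⟩) (by
      refine hu.congr fun p => ?_
      exact (ofEmbedding_embed_form h (u p.1 - u p.2) (u p.1 - u p.2) _ _).symm) h0.cauchySeq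
  have hx0 : x = 0 := Subtype.ext (tendsto_nhds_unique hx h0)
  subst hx0
  refine hx'.congr fun n => ?_
  rw [sub_zero]
  exact ofEmbedding_embed_form h (u n) (u n) _ _

/-- A densely defined symmetric nonnegative operator has a Friedrichs extension. -/
theorem isFriedrichsExtension_embed (hd : Dense (A.domain : Set V)) :
    IsFriedrichsExtension (embeddingOperator _ (FormDomain.embed_injective h)
      (FormDomain.denseRange_embed h hd)) A := by
  refine ⟨hd, ?_, isSelfAdjoint_embeddingOperator _ _, _, isClosureOf_embed h,
    isAssociatedOperator_embeddingOperator _ _⟩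
  refine LinearPMap.le_of_le_graph ?_
  rintro ⟨u, w⟩ huw
  rw [embeddingOperator_mem_graph]
  obtain ⟨u, rfl, rfl⟩ := LinearPMap.mem_graph_iff _ |>.1 huw
  have := FormDomain.adjoint_embed h (FormDomain.of h u)
  exact (congrArg _ this).trans (FormDomain.embed_coe h (FormDomain.of h u))

end Friedrichs

end PartialForm

namespace Config

variable {d : ℕ}

/-! ### Pairings -/

theorem finite_inter_of_isBounded (γ : Config d) {B : Set (Space d)} (hB : Bornology.IsBounded B) :
    (γ.pts ∩ B).Finite :=
  (γ.2 _ hB.isCompact_closure).subset (Set.inter_subset_inter_right _ subset_closure)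

theorem countable_pts (γ : Config d) : γ.pts.Countable := by
  have : γ.pts = ⋃ n : ℕ, γ.pts ∩ Metric.closedBall 0 n := by
    rw [← Set.inter_iUnion, Metric.iUnion_closedBall_nat, Set.inter_univ]
  rw [this]
  exact Set.countable_iUnion fun n =>
    (γ.finite_inter_of_isBounded Metric.isBounded_closedBall).countable

theorem finite_support (γ : Config d) {f : Space d → ℝ} (hf : HasCompactSupport f) :
    (Function.support fun x : γ.pts => f x).Finite := by
  refine Set.Finite.of_finite_image ((γ.2 _ hf).subset ?_) Subtype.val_injective.injOn
  rintro _ ⟨x, hx, rfl⟩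
  exact ⟨x.2, subset_tsupport _ hx⟩

theorem summable_of_hasCompactSupport (γ : Config d) {f : Space d → ℝ}
    (hf : HasCompactSupport f) : Summable fun x : γ.pts => f x :=
  summable_of_hasFiniteSupport (γ.finite_support hf)

theorem abs_pairing_sub_le (γ : Config d) {f g h : Space d → ℝ} {δ : ℝ}
    (hf : HasCompactSupport f) (hg : HasCompactSupport g) (hh : HasCompactSupport h)
    (hle : ∀ x, |f x - g x| ≤ δ * h x) :
    |pairing f γ - pairing g γ| ≤ δ * pairing h γ := by
  have sf := γ.summable_of_hasCompactSupport hf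
  have sg := γ.summable_of_hasCompactSupport hg
  have sh := γ.summable_of_hasCompactSupport hh
  rw [pairing, pairing, pairing, ← sf.tsum_sub sg, ← tsum_mul_left]
  have s := (sf.sub sg).norm
  exact (norm_tsum_le_tsum_norm s).trans (s.tsum_le_tsum (fun x => hle x) (sh.mul_left δ))

theorem continuous_pairing (f : CompactlySupportedContinuousMap (Space d) ℝ) :
    Continuous (pairing f : Config d → ℝ) :=
  continuous_iff_le_induced.2 (iInf_le _ f)

theorem measurable_pairing (f : CompactlySupportedContinuousMap (Space d) ℝ) :
    Measurable (pairing f : Config d → ℝ) :=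
  (continuous_pairing f).measurable

/-- A cutoff function, equal to `1` on the ball of radius `n`. -/
def cutoff (d n : ℕ) : CompactlySupportedContinuousMap (Space d) ℝ where
  toFun x := max 0 (min 1 ((n : ℝ) + 1 - ‖x‖))
  continuous_toFun := by fun_prop
  hasCompactSupport' := by
    refine HasCompactSupport.intro (isCompact_closedBall (0 : Space d) (n + 1)) fun x hx => ?_
    rw [mem_closedBall_zero_iff, not_le] at hx
    exact max_eq_left ((min_le_right _ _).trans (by linarith))

theorem cutoff_nonneg (n : ℕ) (x : Space d) : 0 ≤ cutoff d n x := le_max_left _ _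

theorem cutoff_eq_one {n : ℕ} {x : Space d} (hx : ‖x‖ ≤ n) : cutoff d n x = 1 := by
  change max 0 (min 1 ((n : ℝ) + 1 - ‖x‖)) = 1
  rw [min_eq_left (by linarith), max_eq_right zero_le_one]

theorem cutoff_eq_zero {n : ℕ} {x : Space d} (hx : (n : ℝ) + 1 < ‖x‖) : cutoff d n x = 0 := by
  change max 0 (min 1 ((n : ℝ) + 1 - ‖x‖)) = 0
  exact max_eq_left ((min_le_right _ _).trans (by linarith))

/-- A continuous function times a cutoff. -/
def cutoffMul (n : ℕ) (g : C(Space d, ℝ)) : CompactlySupportedContinuousMap (Space d) ℝ where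
  toFun x := cutoff d n x * g x
  continuous_toFun := (cutoff d n).continuous.mul g.continuous
  hasCompactSupport' := (cutoff d n).hasCompactSupport.mul_right

/-- A countable family of test functions which determines the vague topology. -/
def testFn (d : ℕ) (i : ℕ × Option ℕ) : CompactlySupportedContinuousMap (Space d) ℝ :=
  i.2.elim (cutoff d i.1) fun k => cutoffMul i.1 (TopologicalSpace.denseSeq C(Space d, ℝ) k)

/-- A test function vanishing outside the ball of radius `n` is uniformly close to a member of a
countable dense family times the cutoff. The error in the pairing is at most `δ` times the pairing
with the cutoff, which belongs to the family and is therefore locally bounded. -/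
theorem continuous_pairing_comp {X : Type*} [TopologicalSpace X] {T : X → Config d}
    (hT : ∀ i, Continuous fun x => pairing (testFn d i) (T x))
    (f : CompactlySupportedContinuousMap (Space d) ℝ) : Continuous fun x => pairing f (T x) := by
  obtain ⟨R, hR⟩ := f.hasCompactSupport.isCompact.isBounded.subset_closedBall 0
  obtain ⟨n, hn⟩ := exists_nat_ge R
  have hfn : ∀ x, (n : ℝ) < ‖x‖ → f x = 0 := fun x hx => by
    by_contra h
    have := hR (subset_tsupport _ h)
    rw [mem_closedBall_zero_iff] at this
    linarith
  rw [continuous_iff_continuousAt]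
  intro x₀
  rw [ContinuousAt, Metric.tendsto_nhds]
  intro ε hε
  have hc : Continuous fun x => pairing (cutoff d n) (T x) := hT (n, none)
  have ha : ∀ x, 0 ≤ pairing (cutoff d n) (T x) := fun x => tsum_nonneg fun y => cutoff_nonneg _ _
  set a := pairing (cutoff d n) (T x₀) with hadef
  have ha0 : 0 ≤ a := ha x₀
  -- Near `x₀` the cutoff pairing stays below `a + 1`, so both approximation errors are at most `ε /
  -- 4`.
  set δ := ε / (4 * (a + 1)) with hδ
  have hδ0 : 0 < δ := by positivity
  have hδa : δ * (a + 1) = ε / 4 := by rw [hδ]; field_simp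
  obtain ⟨k, hk⟩ : ∃ k, ∀ x ∈ Metric.closedBall (0 : Space d) (n + 1),
      |f x - TopologicalSpace.denseSeq C(Space d, ℝ) k x| < δ := by
    have hdense := TopologicalSpace.denseRange_denseSeq C(Space d, ℝ)
    have hev := (ContinuousMap.tendsto_iff_forall_isCompact_tendstoUniformlyOn
      (f := (f : C(Space d, ℝ)))).1 (tendsto_id (x := 𝓝 (f : C(Space d, ℝ))))
      (Metric.closedBall 0 (n + 1)) (isCompact_closedBall _ _)
    rw [Metric.tendstoUniformlyOn_iff] at hev
    obtain ⟨k, hk⟩ := hdense.exists_mem_open isOpen_interior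
      ⟨_, mem_interior_iff_mem_nhds.2 (hev δ hδ0)⟩
    exact ⟨k, fun x hx => interior_subset hk x hx⟩
  have hg : Continuous fun x => pairing (testFn d (n, some k)) (T x) := hT (n, some k)
  have hle : ∀ x, |pairing f (T x) - pairing (testFn d (n, some k)) (T x)| ≤
      δ * pairing (cutoff d n) (T x) := fun x => by
    refine abs_pairing_sub_le _ f.hasCompactSupport (testFn d (n, some k)).hasCompactSupport
      (cutoff d n).hasCompactSupport fun y => ?_
    change |f y - cutoff d n y * _| ≤ _
    have h1 : f y = cutoff d n y * f y := by
      rcases le_or_gt ‖y‖ n with h | h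
      · rw [cutoff_eq_one h, one_mul]
      · rw [hfn y h, mul_zero]
    rw [h1, ← mul_sub, abs_mul, abs_of_nonneg (cutoff_nonneg n y), mul_comm δ]
    rcases le_or_gt ‖y‖ (n + 1) with h | h
    · exact mul_le_mul_of_nonneg_left (hk y (mem_closedBall_zero_iff.2 h)).le (cutoff_nonneg n y)
    · rw [cutoff_eq_zero h, zero_mul, zero_mul]
  have e1 := Metric.tendsto_nhds.1 (hg.tendsto x₀) (ε / 4) (by positivity)
  have e2 : ∀ᶠ x in 𝓝 x₀, pairing (cutoff d n) (T x) < a + 1 :=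
    (hc.tendsto x₀).eventually_lt_const (by linarith)
  filter_upwards [e1, e2] with x h1 h2
  rw [Real.dist_eq] at h1 ⊢
  have b1 := abs_le.1 (hle x)
  have b2 := abs_le.1 (hle x₀)
  have b3 := abs_lt.1 h1
  have b4 : δ * pairing (cutoff d n) (T x) ≤ ε / 4 := by
    rw [← hδa]; exact mul_le_mul_of_nonneg_left h2.le hδ0.le
  have b5 : δ * a ≤ ε / 4 := by
    rw [← hδa]; exact mul_le_mul_of_nonneg_left (by linarith) hδ0.le
  rw [← hadef] at b2
  rw [abs_lt]
  constructor <;> linarith [b1.1, b1.2, b2.1, b2.2, b3.1, b3.2]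

/-- The values of the pairings with the countable family of test functions. -/
def coords (γ : Config d) (i : ℕ × Option ℕ) : ℝ := pairing (testFn d i) γ

theorem topology_eq_induced :
    (inferInstance : TopologicalSpace (Config d)) = TopologicalSpace.induced coords inferInstance := by
  apply le_antisymm
  · rw [← continuous_iff_le_induced]
    exact continuous_pi fun i => continuous_pairing _
  · refine le_iInf fun f => ?_
    rw [← continuous_iff_le_induced]
    let _ : TopologicalSpace (Config d) := TopologicalSpace.induced coords inferInstance
    have h : Continuous (coords : Config d → _) := continuous_induced_dom
    exact continuous_pairing_comp (T := id) (fun i => (continuous_apply i).comp h) f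

/-- Countability of the index set is essential: it makes the Borel σ-algebra of the product the
product σ-algebra, so measurability into `Config d` can be tested on pairings. -/
theorem measurableSpace_eq_comap :
    (inferInstance : MeasurableSpace (Config d)) = MeasurableSpace.comap coords inferInstance := by
  change borel (Config d) = _
  rw [show (inferInstance : MeasurableSpace (ℕ × Option ℕ → ℝ)) = borel _ from
    BorelSpace.measurable_eq, ← borel_comap, ← topology_eq_induced]

theorem measurable_of_pairing {α : Type*} [MeasurableSpace α] {T : α → Config d}
    (hT : ∀ f : CompactlySupportedContinuousMap (Space d) ℝ, Measurable fun a => pairing f (T a)) :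
    Measurable T := by
  have h : Measurable (coords ∘ T) := measurable_pi_lambda _ fun i => hT _
  intro s hs
  have hs' : MeasurableSet[MeasurableSpace.comap coords inferInstance] s := by
    rw [← measurableSpace_eq_comap]; exact hs
  obtain ⟨t, ht, rfl⟩ := hs'
  exact h ht

end Config

open ProbabilityTheory in
/-- A kernel all of whose measures are finite is s-finite. -/
theorem isSFiniteKernel_of_isFiniteMeasure {α β : Type*} [MeasurableSpace α] [MeasurableSpace β]
    (κ : Kernel α β) [∀ a, IsFiniteMeasure (κ a)] : IsSFiniteKernel κ := by
  classical
  -- The parameter space is cut according to the integer part of the total mass; on each piece the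
  -- mass is bounded.
  set S : ℕ → Set α := fun m => {a | κ a Set.univ ∈ Set.Ico (m : ℝ≥0∞) (m + 1)} with hS
  have hSm : ∀ m, MeasurableSet (S m) := fun m =>
    (κ.measurable_coe MeasurableSet.univ) measurableSet_Ico
  have hfin : ∀ m, IsFiniteKernel (Kernel.piecewise (hSm m) κ 0) := fun m => by
    refine ⟨⟨m + 1, by finiteness, fun a => ?_⟩⟩
    rw [Kernel.piecewise_apply]
    split_ifs with h
    · exact h.2.le
    · simp
  have hsum : Kernel.sum (fun m => Kernel.piecewise (hSm m) κ 0) = κ := by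
    refine Kernel.ext fun a => ?_
    rw [Kernel.sum_apply]
    have hne : κ a Set.univ ≠ ⊤ := measure_ne_top _ _
    set m₀ := ⌊(κ a Set.univ).toReal⌋₊ with hm₀
    have hmem : ∀ m, a ∈ S m ↔ m = m₀ := fun m => by
      have h1 : κ a Set.univ = ENNReal.ofReal (κ a Set.univ).toReal :=
        (ENNReal.ofReal_toReal hne).symm
      have h0 : 0 ≤ (κ a Set.univ).toReal := ENNReal.toReal_nonneg
      rw [eq_comm, hm₀, Nat.floor_eq_iff h0]
      change (m : ℝ≥0∞) ≤ _ ∧ _ < (m : ℝ≥0∞) + 1 ↔ _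
      rw [← ENNReal.toReal_le_toReal (by finiteness) hne,
        ← ENNReal.toReal_lt_toReal hne (by finiteness), ENNReal.toReal_add (by finiteness)
        (by finiteness)]
      simp
    ext s hs
    rw [Measure.sum_apply _ hs, tsum_eq_single m₀]
    · rw [Kernel.piecewise_apply, if_pos ((hmem m₀).2 rfl)]
    · intro m hm
      rw [Kernel.piecewise_apply, if_neg (fun h => hm ((hmem m).1 h))]
      simp
  rw [← hsum]
  infer_instance

namespace Config

variable {d : ℕ}

/-! ### Configurations as point measures -/

/-- The counting measure of a configuration. -/
def pointMeasure (γ : Config d) : Measure (Space d) :=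
  Measure.sum fun x : γ.pts => Measure.dirac (x : Space d)

theorem lintegral_pointMeasure (γ : Config d) (f : Space d → ℝ≥0∞) :
    ∫⁻ x, f x ∂γ.pointMeasure = ∑' x : γ.pts, f x := by
  rw [pointMeasure, lintegral_sum_measure]
  simp

theorem pointMeasure_apply (γ : Config d) {B : Set (Space d)} (hB : MeasurableSet B) :
    γ.pointMeasure B = (γ.pts ∩ B).encard := by
  rw [← lintegral_indicator_one hB, lintegral_pointMeasure,
    tsum_subtype γ.pts (B.indicator 1), ← ENNReal.tsum_set_one,
    tsum_subtype (γ.pts ∩ B) (fun _ => 1)]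
  congr 1
  exact Set.indicator_indicator _ _ _

theorem pointMeasure_eq_ncard (γ : Config d) {B : Set (Space d)} (hB : MeasurableSet B)
    (hb : Bornology.IsBounded B) : γ.pointMeasure B = (γ.pts ∩ B).ncard := by
  rw [pointMeasure_apply _ hB, ← (γ.finite_inter_of_isBounded hb).cast_ncard_eq]
  rfl

theorem pointMeasure_lt_top (γ : Config d) {B : Set (Space d)} (hb : Bornology.IsBounded B) :
    γ.pointMeasure B < ⊤ := by
  refine (measure_mono subset_closure).trans_lt ?_
  rw [pointMeasure_eq_ncard _ isClosed_closure.measurableSet hb.closure]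
  exact ENNReal.natCast_lt_top _

/-- Continuous functions increasing to the indicator of a bounded open set. -/
def openApprox (U : Set (Space d)) (hU : Bornology.IsBounded U) (k : ℕ) :
    CompactlySupportedContinuousMap (Space d) ℝ where
  toFun x := (min 1 ((k : ℝ≥0∞) * Metric.infEDist x Uᶜ)).toReal
  continuous_toFun := by
    refine ENNReal.continuousOn_toReal.comp_continuous
      (continuous_const.min ((ENNReal.continuous_const_mul (ENNReal.natCast_ne_top k)).comp
        Metric.continuous_infEDist)) fun x => ?_
    exact ((min_le_left _ _).trans_lt ENNReal.one_lt_top).ne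
  hasCompactSupport' := by
    refine HasCompactSupport.intro hU.isCompact_closure fun x hx => ?_
    rw [Metric.infEDist_zero_of_mem (show x ∈ Uᶜ from fun h => hx (subset_closure h))]
    simp

theorem ofReal_openApprox (U : Set (Space d)) (hU : Bornology.IsBounded U) (k : ℕ) (x : Space d) :
    ENNReal.ofReal (openApprox U hU k x) = min 1 ((k : ℝ≥0∞) * Metric.infEDist x Uᶜ) :=
  ENNReal.ofReal_toReal ((min_le_left _ _).trans_lt ENNReal.one_lt_top).ne

theorem iSup_openApprox {U : Set (Space d)} (hU : Bornology.IsBounded U) (ho : IsOpen U)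
    (x : Space d) : ⨆ k, ENNReal.ofReal (openApprox U hU k x) = U.indicator 1 x := by
  simp only [ofReal_openApprox]
  by_cases hx : x ∈ U
  · rw [Set.indicator_of_mem hx, Pi.one_apply]
    have hpos : Metric.infEDist x Uᶜ ≠ 0 := fun h =>
      ((Metric.mem_iff_infEDist_zero_of_closed ho.isClosed_compl).2 h) hx
    refine le_antisymm (iSup_le fun k => min_le_left _ _) ?_
    obtain ⟨k, hk⟩ := ENNReal.exists_nat_mul_gt hpos ENNReal.one_ne_top
    exact le_iSup_of_le k (le_min le_rfl hk.le)
  · rw [Set.indicator_of_notMem hx, Metric.infEDist_zero_of_mem hx]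
    simp

theorem measurable_pointMeasure_open {U : Set (Space d)} (hU : Bornology.IsBounded U)
    (ho : IsOpen U) : Measurable fun γ : Config d => γ.pointMeasure U := by
  have h : ∀ γ : Config d, γ.pointMeasure U =
      ⨆ k, ENNReal.ofReal (pairing (openApprox U hU k) γ) := fun γ => by
    rw [← lintegral_indicator_one ho.measurableSet]
    simp_rw [← iSup_openApprox hU ho]
    rw [lintegral_iSup (fun k => by fun_prop)]
    · refine iSup_congr fun k => ?_
      rw [lintegral_pointMeasure, pairing, ENNReal.ofReal_tsum_of_nonneg
        (f := fun x : γ.pts => openApprox U hU k x) (fun x => ENNReal.toReal_nonneg)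
        (γ.summable_of_hasCompactSupport (openApprox U hU k).hasCompactSupport)]
    · intro k l hkl x
      simp only [ofReal_openApprox]
      gcongr
  simp_rw [h]
  exact .iSup fun k => (measurable_pairing _).ennreal_ofReal

/-- Restriction to a ball makes the measures finite, as needed to pass from open sets to all Borel
sets by a π-λ argument. -/
theorem measurable_pointMeasure_restrict (n : ℕ) :
    Measurable fun γ : Config d => γ.pointMeasure.restrict (Metric.ball 0 n) := by
  have : ∀ γ : Config d, IsFiniteMeasure (γ.pointMeasure.restrict (Metric.ball 0 n)) := fun γ =>
    ⟨by rw [Measure.restrict_apply_univ]; exact γ.pointMeasure_lt_top Metric.isBounded_ball⟩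
  refine Measurable.measure_of_isPiSystem (S := {s : Set (Space d) | IsOpen s})
    (BorelSpace.measurable_eq) isPiSystem_isOpen ?_ ?_
  · intro s hs
    have hs' : IsOpen s := hs
    simp_rw [Measure.restrict_apply hs'.measurableSet]
    exact measurable_pointMeasure_open (Metric.isBounded_ball.subset Set.inter_subset_right)
      (hs'.inter Metric.isOpen_ball)
  · simp_rw [Measure.restrict_apply_univ]
    exact measurable_pointMeasure_open Metric.isBounded_ball Metric.isOpen_ball

theorem measurable_pointMeasure : Measurable (pointMeasure : Config d → _) := by
  refine Measure.measurable_of_measurable_coe _ fun s hs => ?_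
  have h : ∀ γ : Config d, γ.pointMeasure s =
      ⨆ n : ℕ, γ.pointMeasure.restrict (Metric.ball 0 n) s := fun γ => by
    simp_rw [Measure.restrict_apply hs]
    rw [← Directed.measure_iUnion, ← Set.inter_iUnion, Metric.iUnion_ball_nat, Set.inter_univ]
    exact directed_of_isDirected_le fun a b hab => by
      refine Set.inter_subset_inter_right _ (Metric.ball_subset_ball ?_)
      exact_mod_cast hab
  simp_rw [h]
  exact .iSup fun n => (Measure.measurable_coe hs).comp (measurable_pointMeasure_restrict n)

open ProbabilityTheory in
/-- The point measure as a kernel. -/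
def pointKernel (d : ℕ) : Kernel (Config d) (Space d) where
  toFun := pointMeasure
  measurable' := measurable_pointMeasure

open ProbabilityTheory in
instance : IsSFiniteKernel (pointKernel d) := by
  set A : ℕ → Set (Space d) := disjointed fun n : ℕ => Metric.ball 0 n with hA
  have hm : ∀ n, MeasurableSet (A n) := fun n =>
    MeasurableSet.disjointed (fun n => measurableSet_ball) n
  have hsum : Kernel.sum (fun n => (pointKernel d).restrict (hm n)) = pointKernel d := by
    refine Kernel.ext fun γ => ?_
    rw [Kernel.sum_apply]
    simp_rw [Kernel.restrict_apply]
    rw [← Measure.restrict_iUnion (disjoint_disjointed _) hm, iUnion_disjointed,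
      Metric.iUnion_ball_nat, Measure.restrict_univ]
  rw [← hsum]
  have hs : ∀ n, IsSFiniteKernel ((pointKernel d).restrict (hm n)) := fun n => by
    have : ∀ γ, IsFiniteMeasure ((pointKernel d).restrict (hm n) γ) := fun γ => ⟨by
      rw [Kernel.restrict_apply, Measure.restrict_apply_univ]
      exact γ.pointMeasure_lt_top (Metric.isBounded_ball.subset (disjointed_subset _ n))⟩
    exact isSFiniteKernel_of_isFiniteMeasure _
  infer_instance

/-! ### Measurability of sums over configurations -/

theorem measurable_tsum {α : Type*} [MeasurableSpace α] {T : α → Config d} (hT : Measurable T)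
    {f : α → Space d → ℝ≥0∞} (hf : Measurable (Function.uncurry f)) :
    Measurable fun a => ∑' x : (T a).pts, f a x := by
  simp_rw [← lintegral_pointMeasure]
  exact Measurable.lintegral_kernel_prod_right (κ := (pointKernel d).comap T hT) hf

/-- A real `tsum` is `0` when it does not converge, so it is positive part minus negative part only
where the sum of absolute values is finite; that set is measurable by the `ℝ≥0∞` version. -/
theorem measurable_tsum_real {α : Type*} [MeasurableSpace α] {T : α → Config d}
    (hT : Measurable T) {f : α → Space d → ℝ} (hf : Measurable (Function.uncurry f)) :
    Measurable fun a => ∑' x : (T a).pts, f a x := by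
  classical
  have hpos := measurable_tsum hT (f := fun a x => ENNReal.ofReal (f a x)) hf.ennreal_ofReal
  have hneg := measurable_tsum hT (f := fun a x => ENNReal.ofReal (-f a x)) hf.neg.ennreal_ofReal
  have habs := measurable_tsum hT (f := fun a x => ENNReal.ofReal |f a x|)
    (by exact (continuous_abs.measurable.comp hf).ennreal_ofReal)
  have key : ∀ a, ∑' x : (T a).pts, f a x =
      if ∑' x : (T a).pts, ENNReal.ofReal |f a x| = ⊤ then 0 else
        (∑' x : (T a).pts, ENNReal.ofReal (f a x)).toReal -
          (∑' x : (T a).pts, ENNReal.ofReal (-f a x)).toReal := fun a => by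
    split_ifs with h
    · refine tsum_eq_zero_of_not_summable fun hs => ?_
      exact hs.abs.tsum_ofReal_ne_top h
    · have hs : Summable fun x : (T a).pts => |f a x| := by
        have := ENNReal.summable_toReal h
        simpa [ENNReal.toReal_ofReal (abs_nonneg _)] using this
      have e1 : Summable fun x : (T a).pts => max (f a x) 0 :=
        hs.of_nonneg_of_le (fun x => le_max_right _ _)
          fun x => max_le (le_abs_self _) (abs_nonneg _)
      have e2 : Summable fun x : (T a).pts => max (-f a x) 0 :=
        hs.of_nonneg_of_le (fun x => le_max_right _ _)
          fun x => max_le (neg_le_abs _) (abs_nonneg _)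
      rw [ENNReal.tsum_toReal_eq fun _ => ENNReal.ofReal_ne_top,
        ENNReal.tsum_toReal_eq fun _ => ENNReal.ofReal_ne_top]
      simp_rw [ENNReal.toReal_ofReal']
      rw [← e1.tsum_sub e2]
      exact tsum_congr fun x => by
        rcases le_total 0 (f a x) with h | h <;> simp [h]
  simp_rw [key]
  exact Measurable.ite (habs (measurableSet_singleton ⊤)) measurable_const
    (hpos.ennreal_toReal.sub hneg.ennreal_toReal)

theorem measurableSet_mem {α : Type*} [MeasurableSpace α] {T : α → Config d} (hT : Measurable T)
    {X : α → Space d} (hX : Measurable X) : MeasurableSet {a | X a ∈ (T a).pts} := by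
  classical
  have h := measurable_tsum hT (f := fun a y => if y = X a then 1 else 0)
    (Measurable.ite (measurableSet_eq_fun measurable_snd (hX.comp measurable_fst))
      measurable_const measurable_const)
  have : {a | X a ∈ (T a).pts} =
      (fun a => ∑' x : (T a).pts, if (x : Space d) = X a then (1 : ℝ≥0∞) else 0) ⁻¹' {0}ᶜ := by
    ext a
    simp [ENNReal.tsum_eq_zero]
  rw [this]
  exact h (measurableSet_singleton 0).compl

/-! ### Adding and removing a point -/

open Classical in
theorem pairing_add (γ : Config d) (x : Space d) {f : Space d → ℝ} (hf : HasCompactSupport f) :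
    pairing f (γ.add x) = pairing f γ + if x ∈ γ.pts then 0 else f x := by
  split_ifs with h
  · rw [add_zero]
    congr 1
    exact Subtype.ext (Set.insert_eq_of_mem h)
  · have h1 : (γ.add x).pts = {x} ∪ γ.pts := rfl
    rw [pairing, h1, Summable.tsum_union_disjoint (Set.disjoint_singleton_left.2 h)
      (Summable.of_finite (f := fun y : ({x} : Set (Space d)) => f y))
      (γ.summable_of_hasCompactSupport hf), tsum_singleton x f, add_comm]
    rfl

theorem remove_of_notMem {γ : Config d} {x : Space d} (h : x ∉ γ.pts) : γ.remove x = γ :=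
  Subtype.ext (Set.sdiff_singleton_eq_self h)

theorem add_remove {γ : Config d} {x : Space d} (h : x ∈ γ.pts) : (γ.remove x).add x = γ :=
  Subtype.ext (Set.insert_sdiff_self_of_mem h)

theorem remove_add {γ : Config d} {x : Space d} (h : x ∉ γ.pts) : (γ.add x).remove x = γ :=
  Subtype.ext (Set.insert_sdiff_self_of_notMem h)

theorem notMem_remove (γ : Config d) (x : Space d) : x ∉ (γ.remove x).pts :=
  fun h => h.2 rfl

open Classical in
theorem pairing_remove (γ : Config d) (x : Space d) {f : Space d → ℝ} (hf : HasCompactSupport f) :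
    pairing f (γ.remove x) = pairing f γ - if x ∈ γ.pts then f x else 0 := by
  split_ifs with h
  · have := pairing_add (γ.remove x) x hf
    rw [add_remove h, if_neg (notMem_remove γ x)] at this
    linarith
  · rw [remove_of_notMem h, sub_zero]

theorem measurable_add {α : Type*} [MeasurableSpace α] {T : α → Config d} (hT : Measurable T)
    {X : α → Space d} (hX : Measurable X) : Measurable fun a => (T a).add (X a) := by
  classical
  refine measurable_of_pairing fun f => ?_
  simp_rw [pairing_add _ _ f.hasCompactSupport]
  exact ((measurable_pairing f).comp hT).add (Measurable.ite (measurableSet_mem hT hX)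
    measurable_const (f.continuous.measurable.comp hX))

theorem measurable_remove {α : Type*} [MeasurableSpace α] {T : α → Config d} (hT : Measurable T)
    {X : α → Space d} (hX : Measurable X) : Measurable fun a => (T a).remove (X a) := by
  classical
  refine measurable_of_pairing fun f => ?_
  simp_rw [pairing_remove _ _ f.hasCompactSupport]
  exact ((measurable_pairing f).comp hT).sub (Measurable.ite (measurableSet_mem hT hX)
    (f.continuous.measurable.comp hX) measurable_const)

end Config

/-! ### Measurability of the relative energy and the Boltzmann factor -/

theorem measurable_relEnergy {d : ℕ} {φ : Space d → EReal} (hφ : Measurable φ) :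
    Measurable fun p : Config d × Space d => relEnergy φ p.2 p.1 := by
  classical
  have hm : Measurable (Function.uncurry fun (p : Config d × Space d) (y : Space d) =>
      (φ (p.2 - y)).toReal) :=
    (measurable_ereal_toReal.comp hφ).comp (measurable_fst.snd.sub measurable_snd)
  have habs := Config.measurable_tsum (measurable_fst (α := Config d) (β := Space d))
    (f := fun p y => ENNReal.ofReal |(φ (p.2 - y)).toReal|)
    (by exact (continuous_abs.measurable.comp hm).ennreal_ofReal)
  have hs : ∀ p : Config d × Space d, Summable (fun y : p.1.pts => |(φ (p.2 - y)).toReal|) ↔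
      ∑' y : p.1.pts, ENNReal.ofReal |(φ (p.2 - y)).toReal| ≠ ⊤ := fun p => by
    refine ⟨fun h => h.tsum_ofReal_ne_top, fun h => ?_⟩
    have := ENNReal.summable_toReal h
    simpa [ENNReal.toReal_ofReal (abs_nonneg _)] using this
  unfold relEnergy
  simp_rw [hs]
  refine Measurable.ite (habs (measurableSet_singleton ⊤).compl) ?_ measurable_const
  exact measurable_coe_real_ereal.comp (Config.measurable_tsum_real measurable_fst hm)

theorem measurable_boltzmann {d : ℕ} {φ : Space d → EReal} (hφ : Measurable φ) :
    Measurable fun p : Config d × Space d => boltzmann φ p.2 p.1 :=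
  EReal.measurable_exp.comp (continuous_neg.measurable.comp (measurable_relEnergy hφ))

/-! ### Functions with bounded derivatives -/

/-- Smooth functions bounded together with all their derivatives. -/
def HasBoundedDerivs {E F : Type*} [NormedAddCommGroup E] [NormedSpace ℝ E]
    [NormedAddCommGroup F] [NormedSpace ℝ F] (g : E → F) : Prop :=
  ContDiff ℝ ∞ g ∧ ∀ k : ℕ, ∃ C : ℝ, ∀ x, ‖iteratedFDeriv ℝ k g x‖ ≤ C

namespace HasBoundedDerivs

variable {E F G : Type*} [NormedAddCommGroup E] [NormedSpace ℝ E]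
  [NormedAddCommGroup F] [NormedSpace ℝ F] [NormedAddCommGroup G] [NormedSpace ℝ G]

theorem bounded {g : E → F} (hg : HasBoundedDerivs g) : ∃ C, ∀ x, ‖g x‖ ≤ C := by
  obtain ⟨C, hC⟩ := hg.2 0
  exact ⟨C, fun x => by simpa using hC x⟩

theorem of_hasCompactSupport {g : E → F} (hg : ContDiff ℝ ∞ g) (hc : HasCompactSupport g) :
    HasBoundedDerivs g :=
  ⟨hg, fun k => (hc.iteratedFDeriv (𝕜 := ℝ) k).exists_bound_of_continuous
    (hg.continuous_iteratedFDeriv (by exact_mod_cast le_top))⟩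

theorem comp_clm {g : E → F} (hg : HasBoundedDerivs g) (L : G →L[ℝ] E) :
    HasBoundedDerivs (g ∘ L) := by
  refine ⟨hg.1.comp L.contDiff, fun k => ?_⟩
  obtain ⟨C, hC⟩ := hg.2 k
  refine ⟨C * ∏ _i : Fin k, ‖L‖, fun x => ?_⟩
  rw [L.iteratedFDeriv_comp_right hg.1 x (by exact_mod_cast le_top)]
  refine (ContinuousMultilinearMap.norm_compContinuousLinearMap_le _ _).trans ?_
  gcongr
  exact hC _

theorem prodMk {f : E → F} {g : E → G} (hf : HasBoundedDerivs f) (hg : HasBoundedDerivs g) :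
    HasBoundedDerivs fun x => (f x, g x) := by
  refine ⟨hf.1.prodMk hg.1, fun k => ?_⟩
  obtain ⟨C, hC⟩ := hf.2 k
  obtain ⟨D, hD⟩ := hg.2 k
  refine ⟨max C D, fun x => ?_⟩
  rw [iteratedFDeriv_prodMk hf.1.contDiffAt hg.1.contDiffAt (by exact_mod_cast le_top),
    ContinuousMultilinearMap.opNorm_prod]
  exact max_le_max (hC x) (hD x)

/-- The values of `f` stay in a compact ball, on which each derivative of `h` is bounded, so `h`
needs no global bounds. Hence cylinder functions are stable under sums, products and smooth
contractions. -/
theorem comp [ProperSpace F] {h : F → G} {f : E → F} (hh : ContDiff ℝ ∞ h)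
    (hf : HasBoundedDerivs f) : HasBoundedDerivs (h ∘ f) := by
  refine ⟨hh.comp hf.1, fun k => ?_⟩
  obtain ⟨R, hR⟩ := hf.bounded
  have hb : ∀ i, ∃ C, ∀ y ∈ Metric.closedBall (0 : F) R, ‖iteratedFDeriv ℝ i h y‖ ≤ C := fun i =>
    (isCompact_closedBall (0 : F) R).exists_bound_of_continuousOn
      (hh.continuous_iteratedFDeriv (by exact_mod_cast le_top)).continuousOn
  choose C hC using hb
  choose D hD using hf.2
  set C' := ∑ i ∈ Finset.range (k + 1), |C i| with hC'
  -- The summand `1` ensures `D' ≤ D' ^ i` for `i ≥ 1`; the bound for derivatives of a composition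
  -- needs powers of one constant.
  set D' := 1 + ∑ i ∈ Finset.range (k + 1), |D i| with hD'
  have hD1 : 1 ≤ D' := by
    have : 0 ≤ ∑ i ∈ Finset.range (k + 1), |D i| := Finset.sum_nonneg fun i _ => abs_nonneg _
    linarith
  refine ⟨k.factorial * C' * D' ^ k, fun x => ?_⟩
  refine norm_iteratedFDeriv_comp_le hh hf.1 (by exact_mod_cast le_top) x (fun i hi => ?_)
    fun i hi hik => ?_
  · refine (hC i _ (mem_closedBall_zero_iff.2 (hR x))).trans ((le_abs_self _).trans ?_)
    exact Finset.single_le_sum (f := fun i => |C i|) (fun i _ => abs_nonneg _)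
      (Finset.mem_range.2 (by omega))
  · have h1 : |D i| ≤ ∑ i ∈ Finset.range (k + 1), |D i| :=
      Finset.single_le_sum (f := fun i => |D i|) (fun i _ => abs_nonneg _)
        (Finset.mem_range.2 (by omega))
    calc ‖iteratedFDeriv ℝ i f x‖ ≤ D' := by linarith [hD i x, le_abs_self (D i)]
      _ ≤ D' ^ i := le_self_pow₀ hD1 (by omega)

end HasBoundedDerivs

/-! ### Unit cubes -/

section Cubes

variable {d : ℕ}

/-- The index of the unit cube containing a point. -/
def cubeIndex (x : Space d) (i : Fin d) : ℤ := ⌊x i + 1 / 2⌋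

theorem mem_cube_iff {x : Space d} {r : Fin d → ℤ} : x ∈ cube r ↔ cubeIndex x = r := by
  rw [funext_iff]
  refine forall_congr' fun i => ?_
  rw [cubeIndex, Int.floor_eq_iff]
  constructor <;> rintro ⟨h1, h2⟩ <;> constructor <;> linarith

theorem mem_cube_cubeIndex (x : Space d) : x ∈ cube (cubeIndex x) := mem_cube_iff.2 rfl

theorem mem_biUnion_cube {x : Space d} {R : Finset (Fin d → ℤ)} :
    x ∈ ⋃ r ∈ R, cube r ↔ cubeIndex x ∈ R := by
  simp only [Set.mem_iUnion, mem_cube_iff, exists_prop, exists_eq_right']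

theorem mem_bigCube {x : Space d} {N : ℕ} : x ∈ bigCube d N ↔ cubeIndex x ∈ gridBox d N :=
  mem_biUnion_cube

theorem measurableSet_cube (r : Fin d → ℤ) : MeasurableSet (cube r : Set (Space d)) := by
  have : (cube r : Set (Space d)) = ⋂ i, {x | (r i : ℝ) - 1 / 2 ≤ x i} ∩ {x | x i < (r i : ℝ) + 1 / 2} := by
    ext x; simp [cube]
  rw [this]
  exact MeasurableSet.iInter fun i =>
    (measurableSet_le measurable_const (by fun_prop)).inter
      (measurableSet_lt (by fun_prop) measurable_const)

theorem measurableSet_bigCube (N : ℕ) : MeasurableSet (bigCube d N) :=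
  Finset.measurableSet_biUnion _ fun r _ => measurableSet_cube r

theorem volume_cube (r : Fin d → ℤ) : volume (cube r : Set (Space d)) = 1 := by
  have h : (cube r : Set (Space d)) = WithLp.ofLp ⁻¹'
      (Set.pi Set.univ fun i => Set.Ico ((r i : ℝ) - 1 / 2) ((r i : ℝ) + 1 / 2)) := by
    ext x; simp [cube, Set.mem_pi]
  rw [h, (PiLp.volume_preserving_ofLp (Fin d)).measure_preimage
    (MeasurableSet.univ_pi fun i => measurableSet_Ico).nullMeasurableSet, Real.volume_pi_Ico]
  simp only [add_sub_sub_cancel]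
  norm_num

theorem isBounded_cube (r : Fin d → ℤ) : Bornology.IsBounded (cube r : Set (Space d)) := by
  have h : (cube r : Set (Space d)) ⊆ WithLp.ofLp ⁻¹'
      (Set.pi Set.univ fun i => Set.Icc ((r i : ℝ) - 1 / 2) ((r i : ℝ) + 1 / 2)) := by
    intro x hx i _
    exact ⟨(hx i).1, (hx i).2.le⟩
  refine Bornology.IsBounded.subset ?_ h
  exact (PiLp.antilipschitzWith_ofLp 2 (fun _ : Fin d => ℝ)).isBounded_preimage
    (Bornology.IsBounded.pi fun i => Metric.isBounded_Icc _ _)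

theorem isBounded_bigCube (N : ℕ) : Bornology.IsBounded (bigCube d N) :=
  (Bornology.isBounded_biUnion_finset _).2 fun r _ => isBounded_cube r

theorem disjoint_cube {r s : Fin d → ℤ} (h : r ≠ s) :
    Disjoint (cube r : Set (Space d)) (cube s) := by
  rw [Set.disjoint_left]
  intro x hr hs
  exact h ((mem_cube_iff.1 hr).symm.trans (mem_cube_iff.1 hs))

theorem volume_bigCube (N : ℕ) : volume (bigCube d N) = (gridBox d N).card := by
  rw [bigCube, measure_biUnion_finset (fun r _ s _ h => disjoint_cube h)
    fun r _ => measurableSet_cube r]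
  simp [volume_cube]

theorem mem_gridBox {N : ℕ} {r : Fin d → ℤ} :
    r ∈ gridBox d N ↔ ∀ i, 1 - (N : ℤ) ≤ r i ∧ r i ≤ (N : ℤ) - 1 := by
  rw [gridBox, Finset.mem_Icc, Pi.le_def, Pi.le_def, ← forall_and]

theorem mem_bigCube_of_norm_le {N : ℕ} {x : Space d} (h : ‖x‖ ≤ (N : ℝ) - 1) :
    x ∈ bigCube d N := by
  rw [mem_bigCube, mem_gridBox]
  intro i
  have h1 : |x i| ≤ ‖x‖ := PiLp.norm_apply_le x i
  have h2 := abs_le.1 (h1.trans h)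
  constructor
  · rw [cubeIndex, Int.le_floor]; push_cast; linarith [h2.1]
  · rw [cubeIndex, Int.le_sub_one_iff, Int.floor_lt]; push_cast; linarith [h2.2]

end Cubes

/-! ### Cylinder functions -/

section Cylinder

variable {d : ℕ}

/-- Selection of coordinates. -/
def selectCoords {N M : ℕ} (e : Fin N → Fin M) :
    EuclideanSpace ℝ (Fin M) →L[ℝ] EuclideanSpace ℝ (Fin N) :=
  (EuclideanSpace.equiv (Fin N) ℝ).symm.toContinuousLinearMap ∘L
    ContinuousLinearMap.pi fun i => EuclideanSpace.proj (e i)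

theorem selectCoords_apply {N M : ℕ} (e : Fin N → Fin M) (x : EuclideanSpace ℝ (Fin M)) :
    selectCoords e x = WithLp.toLp 2 fun i => x (e i) := rfl

theorem cylinder_comp₂ {F G : Config d → ℝ} (hF : F ∈ cylinderFunctions d)
    (hG : G ∈ cylinderFunctions d) {h : ℝ × ℝ → ℝ} (hh : ContDiff ℝ ∞ h) :
    (fun γ => h (F γ, G γ)) ∈ cylinderFunctions d := by
  obtain ⟨N, f, g, hN, hg, hFg⟩ := hF
  obtain ⟨M, f', g', hM, hg', hGg⟩ := hG
  refine ⟨N + M, Fin.append f f', h ∘ fun x => ((g ∘ selectCoords (Fin.castAdd M)) x,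
    (g' ∘ selectCoords (Fin.natAdd N)) x), by omega,
    HasBoundedDerivs.comp hh ((HasBoundedDerivs.comp_clm hg _).prodMk
      (HasBoundedDerivs.comp_clm hg' _)), fun γ => ?_⟩
  simp [hFg, hGg, selectCoords_apply]

theorem cylinder_comp {F : Config d → ℝ} (hF : F ∈ cylinderFunctions d) {h : ℝ → ℝ}
    (hh : ContDiff ℝ ∞ h) : (fun γ => h (F γ)) ∈ cylinderFunctions d :=
  cylinder_comp₂ hF hF (h := fun p => h p.1) (hh.comp contDiff_fst)

theorem cylinder_of_pairing (f : CompactlySupportedContinuousMap (Space d) ℝ) {h : ℝ → ℝ}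
    (hh : HasBoundedDerivs h) : (fun γ => h (Config.pairing f γ)) ∈ cylinderFunctions d :=
  ⟨1, fun _ => f, h ∘ EuclideanSpace.proj (0 : Fin 1), le_rfl,
    HasBoundedDerivs.comp_clm hh _, fun _ => rfl⟩

theorem cylinder_const (c : ℝ) : (fun _ => c) ∈ cylinderFunctions d :=
  ⟨1, fun _ => 0, fun _ => c, le_rfl, ⟨contDiff_const, fun k => by
    rcases Nat.eq_zero_or_pos k with rfl | hk
    · exact ⟨‖c‖, fun x => by simp⟩
    · exact ⟨0, fun x => by rw [iteratedFDeriv_const_of_ne (by omega)]; simp⟩⟩, fun _ => rfl⟩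

theorem cylinder_measurable {F : Config d → ℝ} (hF : F ∈ cylinderFunctions d) :
    Measurable F := by
  obtain ⟨N, f, g, hN, hg, hFg⟩ := hF
  have : F = fun γ => g (WithLp.toLp 2 fun i => Config.pairing (f i) γ) := funext hFg
  rw [this]
  refine hg.1.continuous.measurable.comp ?_
  exact (MeasurableEquiv.toLp 2 (Fin N → ℝ)).measurable.comp
    (measurable_pi_lambda _ fun i => Config.measurable_pairing _)

theorem cylinder_bounded {F : Config d → ℝ} (hF : F ∈ cylinderFunctions d) :
    ∃ C, 0 ≤ C ∧ ∀ γ, |F γ| ≤ C := by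
  obtain ⟨N, f, g, hN, hg, hFg⟩ := hF
  obtain ⟨C, hC⟩ := HasBoundedDerivs.bounded hg
  exact ⟨C, (norm_nonneg _).trans (hC 0), fun γ => by rw [hFg]; exact hC _⟩

/-- Cylinder functions are local. -/
theorem cylinder_local {F : Config d → ℝ} (hF : F ∈ cylinderFunctions d) :
    ∃ N, ∀ γ x, x ∉ bigCube d N → F (γ.remove x) = F γ ∧ F (γ.add x) = F γ := by
  obtain ⟨N, f, g, hN, hg, hFg⟩ := hF
  have hb : Bornology.IsBounded (⋃ i, tsupport (f i)) :=
    Bornology.isBounded_iUnion.2 fun i => (f i).hasCompactSupport.isCompact.isBounded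
  obtain ⟨R, hR⟩ := hb.subset_closedBall 0
  obtain ⟨n, hn⟩ := exists_nat_ge (R + 1)
  have h0 : ∀ x, x ∉ bigCube d n → ∀ i, f i x = 0 := fun x hx i => by
    by_contra h
    have := hR (Set.mem_iUnion.2 ⟨i, subset_tsupport _ h⟩)
    rw [mem_closedBall_zero_iff] at this
    exact hx (mem_bigCube_of_norm_le (by linarith))
  refine ⟨n, fun γ x hx => ⟨?_, ?_⟩⟩
  · rw [hFg, hFg]
    congr 2
    ext i
    rw [Config.pairing_remove _ _ (f i).hasCompactSupport, h0 x hx i, ite_self, sub_zero]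
  · rw [hFg, hFg]
    congr 2
    ext i
    rw [Config.pairing_add _ _ (f i).hasCompactSupport, h0 x hx i, ite_self, add_zero]

theorem bigCube_mono {N M : ℕ} (h : N ≤ M) : bigCube d N ⊆ bigCube d M := by
  intro x hx
  rw [mem_bigCube, mem_gridBox] at hx ⊢
  intro i
  have := hx i
  omega

end Cylinder

variable {d : ℕ}

/-! ### Density of cylinder functions -/

/-- Sets whose indicator is a bounded pointwise limit of cylinder functions. -/
def IsCylinderLimit (S : Set (Config d)) : Prop :=
  ∃ F : ℕ → Config d → ℝ, (∀ n, F n ∈ cylinderFunctions d) ∧ (∀ n γ, |F n γ| ≤ 1) ∧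
    ∀ γ, Tendsto (fun n => F n γ) atTop (𝓝 (S.indicator 1 γ))

theorem IsCylinderLimit.measurableSet {S : Set (Config d)} (hS : IsCylinderLimit S) :
    MeasurableSet S := by
  obtain ⟨F, hF, -, hlim⟩ := hS
  have h : Measurable (S.indicator (1 : Config d → ℝ)) :=
    measurable_of_tendsto_metrizable (fun n => cylinder_measurable (hF n)) (tendsto_pi_nhds.2 hlim)
  exact (measurable_indicator_const_iff (1 : ℝ)).1 h

theorem isPiSystem_isCylinderLimit : IsPiSystem {S : Set (Config d) | IsCylinderLimit S} := by
  rintro S ⟨F, hF, hF1, hFS⟩ T ⟨G, hG, hG1, hGT⟩ -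
  refine ⟨fun n γ => F n γ * G n γ, fun n => cylinder_comp₂ (hF n) (hG n)
    (h := fun p => p.1 * p.2) contDiff_mul, fun n γ => ?_, fun γ => ?_⟩
  · rw [abs_mul]
    exact mul_le_one₀ (hF1 n γ) (abs_nonneg _) (hG1 n γ)
  · rw [Set.inter_indicator_one]
    exact (hFS γ).mul (hGT γ)

/-- If `0 ≤ ψ ≤ 1` is smooth and nonzero exactly on the interval, the functions `1 - (1 - ψ)ⁿ`
converge pointwise to its indicator. -/
theorem isCylinderLimit_pairing (f : CompactlySupportedContinuousMap (Space d) ℝ) (a b : ℝ) :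
    IsCylinderLimit {γ : Config d | Config.pairing f γ ∈ Set.Ioo a b} := by
  obtain ⟨ψ, hψ, hψs, hψr⟩ := (isOpen_Ioo (a := a) (b := b)).exists_contDiff_support_eq (n := ⊤)
  have hc : HasCompactSupport ψ := by
    refine HasCompactSupport.intro (isCompact_Icc (a := a) (b := b)) fun x hx => ?_
    by_contra h
    have : x ∈ Function.support ψ := h
    rw [hψ] at this
    exact hx (Set.Ioo_subset_Icc_self this)
  have h01 : ∀ x, 0 ≤ ψ x ∧ ψ x ≤ 1 := fun x => hψr ⟨x, rfl⟩
  have hb : HasBoundedDerivs ψ := HasBoundedDerivs.of_hasCompactSupport hψs hc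
  refine ⟨fun n γ => 1 - (1 - ψ (Config.pairing f γ)) ^ n, fun n => ?_, fun n γ => ?_, fun γ => ?_⟩
  · exact cylinder_of_pairing f (h := (fun y : ℝ => 1 - (1 - y) ^ n) ∘ ψ)
      (HasBoundedDerivs.comp (by fun_prop) hb)
  · have h := h01 (Config.pairing f γ)
    have h1 : 0 ≤ (1 - ψ (Config.pairing f γ)) ^ n := pow_nonneg (by linarith) _
    have h2 : (1 - ψ (Config.pairing f γ)) ^ n ≤ 1 := pow_le_one₀ (by linarith) (by linarith)
    rw [abs_le]; constructor <;> linarith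
  · have h := h01 (Config.pairing f γ)
    by_cases hm : Config.pairing f γ ∈ Set.Ioo a b
    · have hne : ψ (Config.pairing f γ) ≠ 0 := by
        rw [← hψ] at hm; exact hm
      have hpos : 0 < ψ (Config.pairing f γ) := lt_of_le_of_ne h.1 hne.symm
      rw [Set.indicator_of_mem (by exact hm), Pi.one_apply]
      have := (tendsto_pow_atTop_nhds_zero_of_lt_one (r := 1 - ψ (Config.pairing f γ))
        (by linarith) (by linarith)).const_sub 1
      rwa [sub_zero] at this
    · have hz : ψ (Config.pairing f γ) = 0 := by
        by_contra h'
        exact hm (hψ ▸ h')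
      rw [Set.indicator_of_notMem (by exact hm)]
      simp [hz]

theorem measurableSpace_eq_generateFrom : (inferInstance : MeasurableSpace (Config d)) =
    MeasurableSpace.generateFrom {S | IsCylinderLimit S} := by
  apply le_antisymm
  · rw [Config.measurableSpace_eq_comap, ← measurable_iff_comap_le]
    refine @measurable_pi_lambda _ _ _ (MeasurableSpace.generateFrom _) _ _ fun i => ?_
    rw [show Real.measurableSpace = _ from
      BorelSpace.measurable_eq.trans Real.borel_eq_generateFrom_Ioo_rat]
    refine @measurable_generateFrom _ _ (MeasurableSpace.generateFrom _) _ _ fun s hs => ?_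
    simp only [Set.mem_iUnion, Set.mem_singleton_iff] at hs
    obtain ⟨a, b, -, rfl⟩ := hs
    exact MeasurableSpace.measurableSet_generateFrom (isCylinderLimit_pairing _ _ _)
  · exact MeasurableSpace.generateFrom_le fun S hS => IsCylinderLimit.measurableSet hS

/-- A function orthogonal to all cylinder functions vanishes almost everywhere. -/
theorem ae_eq_zero_of_forall_cylinder {μ : Measure (Config d)} [IsFiniteMeasure μ]
    {u : Config d → ℝ} (hu : Integrable u μ)
    (h : ∀ F ∈ cylinderFunctions d, ∫ γ, u γ * F γ ∂μ = 0) : u =ᵐ[μ] 0 := by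
  refine hu.ae_eq_zero_of_forall_setIntegral_eq_zero fun S hS _ => ?_
  -- Constants are cylinder functions; this is what handles complements in the induction below.
  have hu0 : ∫ γ, u γ ∂μ = 0 := by simpa using h _ (cylinder_const 1)
  induction S, hS using MeasurableSpace.induction_on_inter measurableSpace_eq_generateFrom
    isPiSystem_isCylinderLimit with
  | empty => simp
  | basic S hS =>
    have hSm := IsCylinderLimit.measurableSet hS
    obtain ⟨F, hF, hF1, hFS⟩ := hS
    have hlim : Tendsto (fun n => ∫ γ, u γ * F n γ ∂μ) atTop
        (𝓝 (∫ γ, u γ * S.indicator 1 γ ∂μ)) := by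
      refine tendsto_integral_of_dominated_convergence (fun γ => |u γ|)
        (fun n => hu.1.mul (cylinder_measurable (hF n)).aestronglyMeasurable) hu.abs
        (fun n => ae_of_all _ fun γ => ?_) (ae_of_all _ fun γ => (hFS γ).const_mul _)
      rw [norm_mul]
      exact mul_le_of_le_one_right (abs_nonneg _) (hF1 n γ)
    simp_rw [h _ (hF _)] at hlim
    rw [← integral_indicator hSm, tendsto_nhds_unique tendsto_const_nhds hlim]
    congr 1
    ext γ
    by_cases hγ : γ ∈ S <;> simp [hγ]
  | compl S hS ih =>
    have := integral_add_compl hS hu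
    rw [ih (measure_lt_top _ _), hu0, zero_add] at this
    exact this
  | iUnion S hd hS ih =>
    rw [integral_iUnion hS hd hu.integrableOn]
    simp [ih _ (measure_lt_top _ _)]

/-- The `μ`-classes of cylinder functions. -/
def cylinderSubmodule (μ : Measure (Config d)) : Submodule ℝ (Lp ℝ 2 μ) where
  carrier := {u | ∃ F ∈ cylinderFunctions d, (u : Config d → ℝ) =ᵐ[μ] F}
  add_mem' := by
    rintro u v ⟨F, hF, hu⟩ ⟨G, hG, hv⟩
    refine ⟨fun γ => F γ + G γ, cylinder_comp₂ hF hG (h := fun p => p.1 + p.2) contDiff_add, ?_⟩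
    exact (Lp.coeFn_add u v).trans (hu.add hv)
  zero_mem' := ⟨_, cylinder_const 0, Lp.coeFn_zero _ _ _⟩
  smul_mem' := by
    rintro c u ⟨F, hF, hu⟩
    refine ⟨fun γ => c * F γ, cylinder_comp hF (h := fun y => c * y) (by fun_prop), ?_⟩
    exact (Lp.coeFn_smul c u).trans (hu.const_smul c)

theorem cylinder_memLp {μ : Measure (Config d)} [IsFiniteMeasure μ] {F : Config d → ℝ}
    (hF : F ∈ cylinderFunctions d) (p : ℝ≥0∞) : MemLp F p μ := by
  obtain ⟨C, -, hC⟩ := cylinder_bounded hF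
  exact MemLp.of_bound (cylinder_measurable hF).aestronglyMeasurable C (ae_of_all _ hC)

theorem inner_eq_of_ae {μ : Measure (Config d)} {u v : Lp ℝ 2 μ} {f g : Config d → ℝ}
    (hf : (u : Config d → ℝ) =ᵐ[μ] f) (hg : (v : Config d → ℝ) =ᵐ[μ] g) :
    inner ℝ u v = ∫ γ, f γ * g γ ∂μ := by
  rw [L2.inner_def]
  refine integral_congr_ae ?_
  filter_upwards [hf, hg] with γ h1 h2
  rw [h1, h2]
  exact mul_comm _ _

theorem dense_cylinderSubmodule (μ : Measure (Config d)) [IsFiniteMeasure μ] :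
    Dense (cylinderSubmodule μ : Set (Lp ℝ 2 μ)) := by
  rw [Submodule.dense_iff_topologicalClosure_eq_top,
    Submodule.topologicalClosure_eq_top_iff, Submodule.eq_bot_iff]
  intro u hu
  refine (Lp.eq_zero_iff_ae_eq_zero).2 ?_
  refine ae_eq_zero_of_forall_cylinder ((Lp.memLp u).integrable one_le_two) fun F hF => ?_
  have hF2 := cylinder_memLp (μ := μ) hF 2
  rw [← inner_eq_of_ae (u := u) (v := hF2.toLp) (ae_eq_refl _) hF2.coeFn_toLp, real_inner_comm]
  exact hu _ ⟨F, hF, hF2.coeFn_toLp⟩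

/-! ### Sums over configurations of functions supported in a cube -/

/-- The number of points in the cube `Λ_N`. -/
def boxCount (γ : Config d) (N : ℕ) : ℝ := ((γ.pts ∩ bigCube d N).ncard : ℝ)

theorem boxCount_nonneg (γ : Config d) (N : ℕ) : 0 ≤ boxCount γ N := Nat.cast_nonneg _

theorem pointMeasure_bigCube (γ : Config d) (N : ℕ) :
    γ.pointMeasure (bigCube d N) = ENNReal.ofReal (boxCount γ N) := by
  rw [γ.pointMeasure_eq_ncard (measurableSet_bigCube N) (isBounded_bigCube N), boxCount,
    ENNReal.ofReal_natCast]

theorem measurable_boxCount (N : ℕ) : Measurable fun γ : Config d => boxCount γ N := by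
  have h : ∀ γ : Config d, boxCount γ N = (γ.pointMeasure (bigCube d N)).toReal := fun γ => by
    rw [pointMeasure_bigCube, ENNReal.toReal_ofReal (boxCount_nonneg _ _)]
  simp_rw [h]
  exact ((Measure.measurable_coe (measurableSet_bigCube N)).comp
    Config.measurable_pointMeasure).ennreal_toReal

theorem finite_support_of_bigCube (γ : Config d) {f : Space d → ℝ} {N : ℕ}
    (h0 : ∀ x, x ∉ bigCube d N → f x = 0) : (Function.support fun x : γ.pts => f x).Finite := by
  refine Set.Finite.of_finite_image
    ((γ.finite_inter_of_isBounded (isBounded_bigCube N)).subset ?_) Subtype.val_injective.injOn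
  rintro _ ⟨x, hx, rfl⟩
  exact ⟨x.2, by_contra fun h => hx (h0 x h)⟩

theorem summable_of_bigCube (γ : Config d) {f : Space d → ℝ} {N : ℕ}
    (h0 : ∀ x, x ∉ bigCube d N → f x = 0) : Summable fun x : γ.pts => f x :=
  summable_of_hasFiniteSupport (finite_support_of_bigCube γ h0)

theorem abs_tsum_le_boxCount (γ : Config d) {f : Space d → ℝ} {N : ℕ} {c : ℝ}
    (h0 : ∀ x, x ∉ bigCube d N → f x = 0) (hc : ∀ x, |f x| ≤ c) :
    |∑' x : γ.pts, f x| ≤ c * boxCount γ N := by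
  have hfin := γ.finite_inter_of_isBounded (isBounded_bigCube N)
  rw [tsum_subtype γ.pts f, tsum_eq_sum (s := hfin.toFinset)]
  · refine (Finset.abs_sum_le_sum_abs _ _).trans ((Finset.sum_le_card_nsmul _ _ c ?_).trans_eq ?_)
    · intro x hx
      rw [Set.Finite.mem_toFinset] at hx
      rw [Set.indicator_of_mem hx.1]
      exact hc x
    · rw [nsmul_eq_mul, mul_comm, boxCount, Set.ncard_eq_toFinset_card _ hfin]
  · intro x hx
    rw [Set.Finite.mem_toFinset] at hx
    by_cases h : x ∈ γ.pts
    · rw [Set.indicator_of_mem h, h0 x fun h' => hx ⟨h, h'⟩]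
    · rw [Set.indicator_of_notMem h]

/-! ### The Georgii–Nguyen–Zessin identity -/

/-- Points are null sets because `d ≥ 1`. Hence the point inserted in the Gibbs identity is almost
surely new, and removing it restores `γ`. -/
theorem volume_pts [Nonempty (Fin d)] (γ : Config d) : volume γ.pts = 0 :=
  γ.countable_pts.measure_zero _

theorem ae_notMem_pts [Nonempty (Fin d)] (γ : Config d) : ∀ᵐ x : Space d, x ∉ γ.pts :=
  measure_eq_zero_iff_ae_notMem.1 (volume_pts γ)

/-- The Campbell measure of `μ`. -/
def campbell (μ : Measure (Config d)) : Measure (Config d × Space d) :=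
  μ.compProd (Config.pointKernel d)

theorem lintegral_campbell (μ : Measure (Config d)) [SFinite μ] {F : Config d × Space d → ℝ≥0∞}
    (hF : Measurable F) : ∫⁻ p, F p ∂campbell μ = ∫⁻ γ, ∑' x : γ.pts, F (γ, x) ∂μ := by
  rw [campbell, Measure.lintegral_compProd hF]
  exact lintegral_congr fun γ => Config.lintegral_pointMeasure γ _

theorem integral_campbell (μ : Measure (Config d)) [SFinite μ] {F : Config d × Space d → ℝ}
    (hF : Integrable F (campbell μ)) :
    ∫ p, F p ∂campbell μ = ∫ γ, ∑' x : γ.pts, F (γ, x) ∂μ := by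
  rw [campbell, Measure.integral_compProd hF]
  have h := (Measure.integrable_compProd_iff hF.1).1 hF
  refine integral_congr_ae ?_
  filter_upwards [h.1] with γ hγ
  change Integrable _ (Measure.sum _) at hγ
  change ∫ x, F (γ, x) ∂(Measure.sum _) = _
  rw [integral_sum_measure hγ]
  simp

variable {φ : Space d → EReal} {z : ℝ} {μ : Measure (Config d)}

theorem lintegral_gnz [Nonempty (Fin d)] (hμ : IsGibbs φ z μ) {F : Config d → Space d → ℝ≥0∞}
    (hF : Measurable (Function.uncurry F)) :
    ∫⁻ γ, ∑' x : γ.pts, F (γ.remove x) x ∂μ =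
      ∫⁻ γ, ∫⁻ x, ENNReal.ofReal z * boltzmann φ x γ * F γ x ∂volume ∂μ := by
  rw [hμ.2 (fun γ x => F (γ.remove x) x)
    (hF.comp ((Config.measurable_remove measurable_fst measurable_snd).prodMk measurable_snd))]
  refine lintegral_congr fun γ => lintegral_congr_ae ?_
  filter_upwards [ae_notMem_pts γ] with x hx
  rw [Config.remove_add hx]

/-- The intensity of births. -/
def birthDensity (φ : Space d → EReal) (z : ℝ) (p : Config d × Space d) : ℝ≥0∞ :=
  ENNReal.ofReal z * boltzmann φ p.2 p.1

theorem measurable_birthDensity (hφ : Measurable φ) : Measurable (birthDensity φ z) :=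
  (measurable_boltzmann hφ).const_mul _

/-- With the Gibbs identity stated as an equality of measures, its version for signed integrands is
a change of variables in Bochner integrals. -/
theorem map_campbell [Nonempty (Fin d)] (hφ : Measurable φ) (hμ : IsGibbs φ z μ) :
    (campbell μ).map (fun p => (p.1.remove p.2, p.2)) =
      (μ.prod volume).withDensity (birthDensity φ z) := by
  have := hμ.1
  have hm : Measurable fun p : Config d × Space d => (p.1.remove p.2, p.2) :=
    (Config.measurable_remove measurable_fst measurable_snd).prodMk measurable_snd
  refine Measure.ext_of_lintegral _ fun f hf => ?_
  rw [lintegral_map hf hm,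
    lintegral_campbell μ (F := fun p => f (p.1.remove p.2, p.2)) (hf.comp hm),
    lintegral_withDensity_eq_lintegral_mul _ (measurable_birthDensity hφ) hf,
    lintegral_prod _ ((measurable_birthDensity hφ).mul hf).aemeasurable]
  exact lintegral_gnz hμ (F := fun γ x => f (γ, x)) hf

/-- Square integrability of the number of points in cubes and of the Boltzmann factor,
uniformly on cubes. -/
def HasMomentBounds (φ : Space d → EReal) (μ : Measure (Config d)) : Prop :=
  ∀ N : ℕ, ∃ M : Config d → ℝ≥0∞, Measurable M ∧ ∫⁻ γ, M γ ∂μ ≠ ⊤ ∧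
    ∀ᵐ γ ∂μ, (∀ x ∈ bigCube d N, x ∉ γ.pts → boltzmann φ x γ ^ 2 ≤ M γ) ∧
      ENNReal.ofReal (boxCount γ N) ^ 2 ≤ M γ

namespace HasMomentBounds

/-- The moment bounds in terms of a real function. -/
theorem exists_real (h : HasMomentBounds φ μ) (N : ℕ) : ∃ T : Config d → ℝ, Integrable T μ ∧
    ∀ᵐ γ ∂μ, 0 ≤ T γ ∧ (∀ x ∈ bigCube d N, x ∉ γ.pts → boltzmann φ x γ ≠ ⊤ ∧
      (boltzmann φ x γ).toReal ^ 2 ≤ T γ) ∧ boxCount γ N ^ 2 ≤ T γ := by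
  obtain ⟨M, hM, hMi, hb⟩ := h N
  refine ⟨fun γ => (M γ).toReal, integrable_toReal_of_lintegral_ne_top hM.aemeasurable hMi, ?_⟩
  filter_upwards [hb, ae_lt_top hM hMi] with γ h1 h2
  refine ⟨ENNReal.toReal_nonneg, fun x hx hxγ => ?_, ?_⟩
  · have h3 := h1.1 x hx hxγ
    refine ⟨fun h => ?_, ?_⟩
    · rw [h] at h3
      simp [h2.ne] at h3
    · rw [← ENNReal.toReal_pow]
      exact ENNReal.toReal_mono h2.ne h3
  · have h3 := ENNReal.toReal_mono h2.ne h1.2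
    rwa [ENNReal.toReal_pow, ENNReal.toReal_ofReal (boxCount_nonneg _ _)] at h3

/-- A real integral against `withDensity` is an integral weighted by `toReal` only where the density
is finite. -/
theorem birthDensity_lt_top [Nonempty (Fin d)] [SFinite μ] (h : HasMomentBounds φ μ)
    (hφ : Measurable φ) : ∀ᵐ p ∂(μ.prod volume), birthDensity φ z p < ⊤ := by
  refine (Measure.ae_prod_iff_ae_ae (p := fun p => birthDensity φ z p < ⊤)
    (measurable_birthDensity hφ measurableSet_Iio)).2 ?_
  have hall : ∀ᵐ γ ∂μ, ∀ N, ∀ x ∈ bigCube d N, x ∉ γ.pts → boltzmann φ x γ ≠ ⊤ := by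
    rw [ae_all_iff]
    intro N
    obtain ⟨T, -, hT⟩ := h.exists_real N
    filter_upwards [hT] with γ hγ x hx hxγ
    exact (hγ.2.1 x hx hxγ).1
  filter_upwards [hall] with γ hγ
  filter_upwards [ae_notMem_pts γ] with x hx
  obtain ⟨N, hN⟩ := exists_nat_ge (‖x‖ + 1)
  have := hγ N x (mem_bigCube_of_norm_le (by linarith)) hx
  exact ENNReal.mul_lt_top ENNReal.ofReal_lt_top (lt_top_iff_ne_top.2 this)

end HasMomentBounds

theorem integrable_boxCount [IsFiniteMeasure μ] (h : HasMomentBounds φ μ) (N : ℕ) :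
    Integrable (fun γ => boxCount γ N) μ := by
  obtain ⟨T, hTi, hT⟩ := h.exists_real N
  refine ((integrable_const 1).add hTi).mono' (measurable_boxCount N).aestronglyMeasurable ?_
  filter_upwards [hT] with γ hγ
  rw [Real.norm_of_nonneg (boxCount_nonneg _ _)]
  simp only [Pi.add_apply]
  nlinarith [hγ.2.2, sq_nonneg (boxCount γ N - 1)]

/-- Bounded functions supported in a cube are integrable for the Campbell measure. -/
theorem integrable_campbell [IsFiniteMeasure μ] (h : HasMomentBounds φ μ)
    {F : Config d × Space d → ℝ} (hF : Measurable F) {N : ℕ} {c : ℝ}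
    (h0 : ∀ γ x, x ∉ bigCube d N → F (γ, x) = 0) (hc : ∀ p, |F p| ≤ c) :
    Integrable F (campbell μ) := by
  refine ⟨hF.aestronglyMeasurable, ?_⟩
  rw [hasFiniteIntegral_iff_enorm, lintegral_campbell μ hF.enorm]
  have hle : ∀ γ : Config d, ∑' x : γ.pts, ‖F (γ, x)‖ₑ ≤ ENNReal.ofReal (c * boxCount γ N) :=
    fun γ => by
    have h1 := abs_tsum_le_boxCount γ (f := fun x => |F (γ, x)|) (N := N) (c := c)
      (fun x hx => by simp [h0 γ x hx]) (fun x => by simpa using hc (γ, x))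
    have hs := summable_of_bigCube γ (f := fun x => |F (γ, x)|) (N := N)
      (fun x hx => by simp [h0 γ x hx])
    calc ∑' x : γ.pts, ‖F (γ, x)‖ₑ = ENNReal.ofReal (∑' x : γ.pts, |F (γ, x)|) := by
          rw [ENNReal.ofReal_tsum_of_nonneg (fun x => abs_nonneg _) hs]
          exact tsum_congr fun x => Real.enorm_eq_ofReal_abs _
      _ ≤ _ := ENNReal.ofReal_le_ofReal ((le_abs_self _).trans h1)
  refine (lintegral_mono hle).trans_lt ?_
  exact ((integrable_boxCount h N).const_mul c).lintegral_lt_top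

/-- The signed Georgii–Nguyen–Zessin identity. -/
theorem integral_gnz [Nonempty (Fin d)] (hz : 0 < z) (hφ : Measurable φ) (hμ : IsGibbs φ z μ)
    (h : HasMomentBounds φ μ) {K : Config d × Space d → ℝ} (hK : Measurable K) {N : ℕ} {c : ℝ}
    (h0 : ∀ γ x, x ∉ bigCube d N → K (γ, x) = 0) (hc : ∀ p, |K p| ≤ c) :
    ∫ γ, ∑' x : γ.pts, K (γ.remove x, x) ∂μ =
      ∫ γ, ∫ x, z * (boltzmann φ x γ).toReal * K (γ, x) ∂volume ∂μ := by
  have := hμ.1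
  have hm : Measurable fun p : Config d × Space d => (p.1.remove p.2, p.2) :=
    (Config.measurable_remove measurable_fst measurable_snd).prodMk measurable_snd
  have hint : Integrable (fun p : Config d × Space d => K (p.1.remove p.2, p.2)) (campbell μ) :=
    integrable_campbell h (hK.comp hm) (fun γ x hx => h0 _ x hx) fun p => hc _
  have hint' : Integrable K ((μ.prod volume).withDensity (birthDensity φ z)) := by
    rw [← map_campbell hφ hμ, integrable_map_measure hK.aestronglyMeasurable hm.aemeasurable]
    exact hint
  rw [← integral_campbell μ hint,
    ← integral_map (f := K) hm.aemeasurable hK.aestronglyMeasurable, map_campbell hφ hμ,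
    integral_withDensity_eq_integral_toReal_smul (measurable_birthDensity hφ)
      (h.birthDensity_lt_top hφ),
    integral_prod _ ((integrable_withDensity_iff_integrable_smul' (measurable_birthDensity hφ)
      (h.birthDensity_lt_top hφ)).1 hint')]
  simp only [birthDensity, ENNReal.toReal_mul, ENNReal.toReal_ofReal hz.le, smul_eq_mul]

/-! ### The generator -/

theorem dMinus_measurable {F : Config d → ℝ} (hF : F ∈ cylinderFunctions d) :
    Measurable fun p : Config d × Space d => dMinus F p.1 p.2 :=
  ((cylinder_measurable hF).comp (Config.measurable_remove measurable_fst measurable_snd)).sub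
    ((cylinder_measurable hF).comp measurable_fst)

theorem dPlus_measurable {F : Config d → ℝ} (hF : F ∈ cylinderFunctions d) :
    Measurable fun p : Config d × Space d => dPlus F p.1 p.2 :=
  ((cylinder_measurable hF).comp measurable_fst).sub
    ((cylinder_measurable hF).comp (Config.measurable_add measurable_fst measurable_snd))

/-- Uniform bounds for the difference operators on a cylinder function. -/
theorem exists_difference_bounds {F : Config d → ℝ} (hF : F ∈ cylinderFunctions d) :
    ∃ (N : ℕ) (c : ℝ), 0 ≤ c ∧ (∀ γ, |F γ| ≤ c) ∧ ∀ γ x, |dMinus F γ x| ≤ c ∧ |dPlus F γ x| ≤ c ∧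
      (x ∉ bigCube d N → dMinus F γ x = 0 ∧ dPlus F γ x = 0) := by
  obtain ⟨N, hN⟩ := cylinder_local hF
  obtain ⟨C, hC0, hC⟩ := cylinder_bounded hF
  refine ⟨N, C + C, by linarith, fun γ => (hC γ).trans (by linarith),
    fun γ x => ⟨?_, ?_, fun hx => ?_⟩⟩
  · exact (abs_sub _ _).trans (add_le_add (hC _) (hC _))
  · exact (abs_sub _ _).trans (add_le_add (hC _) (hC _))
  · have := hN γ x hx
    exact ⟨sub_eq_zero.2 this.1, sub_eq_zero.2 this.2.symm⟩

theorem measurable_birthIntegrand (hφ : Measurable φ) {F : Config d → ℝ}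
    (hF : F ∈ cylinderFunctions d) :
    Measurable (Function.uncurry (birthIntegrand φ z F)) :=
  ((measurable_boltzmann hφ).ennreal_toReal.const_mul z).mul (dPlus_measurable hF)

theorem measurable_generator (hφ : Measurable φ) {F : Config d → ℝ}
    (hF : F ∈ cylinderFunctions d) : Measurable (generator φ z F) := by
  refine Measurable.sub ?_ ?_
  · exact ((measurable_birthIntegrand hφ hF).stronglyMeasurable.integral_prod_right).measurable
  · exact Config.measurable_tsum_real measurable_id (f := fun γ x => dMinus F γ x)
      (dMinus_measurable hF)

theorem volume_bigCube_lt_top (N : ℕ) : volume (bigCube d N) < ⊤ := by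
  rw [volume_bigCube]; exact ENNReal.natCast_lt_top _

/-- The differences of `F` are bounded by `c` and vanish outside a cube of volume `v`. So the birth
part is at most `z c v` times the square root of the majorant, and the death part at most `c` times
the number of points. -/
theorem birthIntegrand_bound [Nonempty (Fin d)] (hz : 0 < z) (hφ : Measurable φ)
    (h : HasMomentBounds φ μ) {F : Config d → ℝ} (hF : F ∈ cylinderFunctions d) :
    ∃ T : Config d → ℝ, Integrable T μ ∧ ∀ᵐ γ ∂μ, 0 ≤ T γ ∧
      Integrable (birthIntegrand φ z F γ) ∧ (∫ x, birthIntegrand φ z F γ x) ^ 2 ≤ T γ ∧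
      (∑' x : γ.pts, dMinus F γ x) ^ 2 ≤ T γ := by
  obtain ⟨N, c, hc0, hFc, hb⟩ := exists_difference_bounds hF
  obtain ⟨T, hTi, hT⟩ := h.exists_real N
  set v : ℝ := (volume (bigCube d N)).toReal with hv
  have hv0 : 0 ≤ v := ENNReal.toReal_nonneg
  refine ⟨fun γ => (c ^ 2 + (z * c * v) ^ 2) * T γ, hTi.const_mul _, ?_⟩
  filter_upwards [hT] with γ hγ
  obtain ⟨hT0, hbz, hcount⟩ := hγ
  have hbd : ∀ᵐ x : Space d, ‖birthIntegrand φ z F γ x‖ ≤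
      (bigCube d N).indicator (fun _ => z * Real.sqrt (T γ) * c) x := by
    filter_upwards [ae_notMem_pts γ] with x hx
    by_cases hxN : x ∈ bigCube d N
    · rw [Set.indicator_of_mem hxN, birthIntegrand, norm_mul, norm_mul, Real.norm_of_nonneg hz.le,
        Real.norm_of_nonneg ENNReal.toReal_nonneg]
      gcongr
      · exact Real.le_sqrt_of_sq_le (hbz x hxN hx).2
      · exact (hb γ x).2.1
    · rw [Set.indicator_of_notMem hxN, birthIntegrand, ((hb γ x).2.2 hxN).2]
      simp
  have hind : Integrable ((bigCube d N).indicator fun _ : Space d => z * Real.sqrt (T γ) * c) :=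
    (integrable_indicator_iff (measurableSet_bigCube N)).2
      (integrableOn_const (volume_bigCube_lt_top N).ne)
  refine ⟨by positivity, ?_, ?_, ?_⟩
  · exact hind.mono' ((measurable_birthIntegrand hφ hF).of_uncurry_left.aestronglyMeasurable) hbd
  · have h1 : |∫ x, birthIntegrand φ z F γ x| ≤ z * c * v * Real.sqrt (T γ) := by
      refine (norm_integral_le_of_norm_le hind hbd).trans_eq ?_
      rw [integral_indicator (measurableSet_bigCube N), setIntegral_const, smul_eq_mul,
        Measure.real]
      ring
    have h2 := sq_le_sq' (by linarith [(abs_le.1 h1).1]) (abs_le.1 h1).2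
    rw [mul_pow, Real.sq_sqrt hT0] at h2
    nlinarith [mul_nonneg (sq_nonneg c) hT0]
  · have h1 := abs_tsum_le_boxCount γ (f := fun x => dMinus F γ x) (N := N) (c := c)
      (fun x hx => ((hb γ x).2.2 hx).1) (fun x => (hb γ x).1)
    have h2 := sq_le_sq' (by linarith [(abs_le.1 h1).1]) (abs_le.1 h1).2
    rw [mul_pow] at h2
    have h3 : c ^ 2 * boxCount γ N ^ 2 ≤ c ^ 2 * T γ := by gcongr
    nlinarith [mul_nonneg (sq_nonneg (z * c * v)) hT0]

theorem generator_memLp [Nonempty (Fin d)] (hz : 0 < z) (hφ : Measurable φ)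
    (h : HasMomentBounds φ μ) {F : Config d → ℝ} (hF : F ∈ cylinderFunctions d) :
    MemLp (generator φ z F) 2 μ := by
  obtain ⟨T, hTi, hT⟩ := birthIntegrand_bound hz hφ h hF
  have hm := (measurable_generator (z := z) hφ hF)
  rw [memLp_two_iff_integrable_sq hm.aestronglyMeasurable]
  refine (hTi.const_mul 4).mono' (hm.pow_const 2).aestronglyMeasurable ?_
  filter_upwards [hT] with γ hγ
  rw [Real.norm_of_nonneg (sq_nonneg _), generator]
  nlinarith [hγ.2.2.1, hγ.2.2.2,
    sq_nonneg ((∫ x, birthIntegrand φ z F γ x) + ∑' x : γ.pts, dMinus F γ x)]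

theorem integrable_carre [IsFiniteMeasure μ] (h : HasMomentBounds φ μ) {F G : Config d → ℝ}
    (hF : F ∈ cylinderFunctions d) (hG : G ∈ cylinderFunctions d) : Integrable (carre F G) μ := by
  obtain ⟨N, c, hc0, hFc, hb⟩ := exists_difference_bounds hF
  obtain ⟨N', c', hc0', hGc, hb'⟩ := exists_difference_bounds hG
  have hm : Measurable (carre F G) := Config.measurable_tsum_real measurable_id
    (f := fun γ x => dMinus F γ x * dMinus G γ x) ((dMinus_measurable hF).mul (dMinus_measurable hG))
  refine ((integrable_boxCount h N).const_mul (c * c')).mono' hm.aestronglyMeasurable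
    (ae_of_all _ fun γ => ?_)
  refine abs_tsum_le_boxCount γ (f := fun x => dMinus F γ x * dMinus G γ x) (fun x hx => ?_)
    fun x => ?_
  · rw [((hb γ x).2.2 hx).1, zero_mul]
  · rw [abs_mul]
    exact mul_le_mul (hb γ x).1 (hb' γ x).1 (abs_nonneg _) hc0

/-- Integration by parts. -/
theorem energy_eq_integral_generator [Nonempty (Fin d)] (hz : 0 < z) (hφ : Measurable φ)
    (hμ : IsGibbs φ z μ) (h : HasMomentBounds φ μ) {F G : Config d → ℝ}
    (hF : F ∈ cylinderFunctions d) (hG : G ∈ cylinderFunctions d) :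
    energy μ F G = ∫ γ, generator φ z F γ * G γ ∂μ := by
  have := hμ.1
  obtain ⟨N, c, hc0, hFc, hb⟩ := exists_difference_bounds hF
  obtain ⟨N', c', hc0', hGc, hb'⟩ := exists_difference_bounds hG
  obtain ⟨T, hTi, hT⟩ := birthIntegrand_bound hz hφ h hF
  -- The kernel for the Gibbs identity: its birth side is the first term of `HF` times `G`.
  have hK : Measurable fun p : Config d × Space d => dPlus F p.1 p.2 * G p.1 :=
    (dPlus_measurable hF).mul ((cylinder_measurable hG).comp measurable_fst)
  have h1 := integral_gnz hz hφ hμ h hK (N := N) (c := c * c')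
    (fun γ x hx => by rw [((hb γ x).2.2 hx).2, zero_mul])
    (fun p => by
      rw [abs_mul]; exact mul_le_mul (hb p.1 p.2).2.1 (hGc _) (abs_nonneg _) hc0)
  -- For `x ∈ γ`, `D⁺_xF(γ \ x) = D⁻_xF(γ)` and `G(γ \ x) = D⁻_xG(γ) + G(γ)`.
  have h2 : ∀ γ : Config d, ∑' x : γ.pts, dPlus F (γ.remove x) x * G (γ.remove x) =
      carre F G γ + (∑' x : γ.pts, dMinus F γ x) * G γ := fun γ => by
    rw [carre, ← tsum_mul_right, ← Summable.tsum_add]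
    · refine tsum_congr fun x => ?_
      rw [dPlus, Config.add_remove x.2, dMinus, dMinus]
      ring
    · exact summable_of_bigCube γ (f := fun x => dMinus F γ x * dMinus G γ x) (N := N)
        fun x hx => by rw [((hb γ x).2.2 hx).1, zero_mul]
    · exact summable_of_bigCube γ (f := fun x => dMinus F γ x * G γ) (N := N)
        fun x hx => by rw [((hb γ x).2.2 hx).1, zero_mul]
  have h3 : ∀ γ : Config d, ∫ x, z * (boltzmann φ x γ).toReal * (dPlus F γ x * G γ) =
      (∫ x, birthIntegrand φ z F γ x) * G γ := fun γ => by
    rw [← integral_mul_const]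
    exact integral_congr_ae (ae_of_all _ fun x => (mul_assoc _ _ _).symm)
  have hsum : Integrable (fun γ : Config d => (∑' x : γ.pts, dMinus F γ x) * G γ) μ := by
    refine ((integrable_boxCount h N).const_mul (c * c')).mono'
      ((Config.measurable_tsum_real measurable_id (f := fun γ x => dMinus F γ x)
        (dMinus_measurable hF)).mul (cylinder_measurable hG)).aestronglyMeasurable
      (ae_of_all _ fun γ => ?_)
    have h4 := abs_tsum_le_boxCount γ (f := fun x => dMinus F γ x) (N := N) (c := c)
      (fun x hx => ((hb γ x).2.2 hx).1) (fun x => (hb γ x).1)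
    rw [norm_mul]
    calc _ ≤ c * boxCount γ N * c' :=
          mul_le_mul h4 (hGc γ) (abs_nonneg _) (mul_nonneg hc0 (boxCount_nonneg _ _))
      _ = _ := by ring
  simp only [h2, h3] at h1
  rw [integral_add (integrable_carre h hF hG) hsum] at h1
  have hbirth : Integrable (fun γ : Config d => (∫ x, birthIntegrand φ z F γ x) * G γ) μ := by
    have h5 : Integrable (fun γ => generator φ z F γ * G γ) μ :=
      (generator_memLp hz hφ h hF).integrable_mul (cylinder_memLp hG 2)
    refine (h5.add hsum).congr (ae_of_all _ fun γ => ?_)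
    simp only [Pi.add_apply, generator]
    ring
  have h6 : ∫ γ, generator φ z F γ * G γ ∂μ = (∫ γ, (∫ x, birthIntegrand φ z F γ x) * G γ ∂μ) -
      ∫ γ, (∑' x : γ.pts, dMinus F γ x) * G γ ∂μ := by
    rw [← integral_sub hbirth hsum]
    refine integral_congr_ae (ae_of_all _ fun γ => ?_)
    simp only [generator]
    ring
  rw [h6, energy]
  linarith

/-- Moment bounds for nonnegative potentials. -/
theorem hasMomentBounds_of_nonneg [Nonempty (Fin d)] (hμ : IsGibbs φ z μ)
    (hpos : PotentialPositive φ) : HasMomentBounds φ μ := by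
  have := hμ.1
  have hb1 : ∀ x γ, boltzmann φ x γ ≤ 1 := fun x γ => by
    have h0 : 0 ≤ relEnergy φ x γ := by
      unfold relEnergy
      split_ifs
      · exact_mod_cast tsum_nonneg fun y => EReal.toReal_nonneg (hpos _)
      · exact le_top
    rw [boltzmann, ← EReal.exp_zero, EReal.exp_le_exp_iff, EReal.neg_le, neg_zero]
    exact h0
  intro N
  set B := bigCube d N with hB
  have hBm : MeasurableSet B := measurableSet_bigCube N
  have hcount : Measurable fun γ : Config d => γ.pointMeasure B :=
    (Measure.measurable_coe hBm).comp Config.measurable_pointMeasure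
  -- The Gibbs identity with the Boltzmann factor replaced by `1`. Taking `g = 1` bounds the first
  -- moment of the count; `g = 1 + count` then bounds the second.
  have hstep : ∀ g : Config d → ℝ≥0∞, Measurable g →
      ∫⁻ γ, ∑' x : γ.pts, B.indicator 1 (x : Space d) * g (γ.remove x) ∂μ ≤
        ENNReal.ofReal z * volume B * ∫⁻ γ, g γ ∂μ := fun g hg => by
    rw [lintegral_gnz hμ (F := fun γ x => B.indicator 1 x * g γ)
      (((measurable_one.indicator hBm).comp measurable_snd).mul (hg.comp measurable_fst))]
    rw [← lintegral_const_mul _ hg]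
    refine lintegral_mono fun γ => ?_
    calc ∫⁻ x, ENNReal.ofReal z * boltzmann φ x γ * (B.indicator 1 x * g γ)
        ≤ ∫⁻ x, ENNReal.ofReal z * g γ * B.indicator 1 x := by
          refine lintegral_mono fun x => ?_
          calc _ ≤ ENNReal.ofReal z * 1 * (B.indicator 1 x * g γ) := by gcongr; exact hb1 x γ
            _ = _ := by ring
      _ = _ := by
          rw [lintegral_const_mul _ (measurable_one.indicator hBm), lintegral_indicator_one hBm]
          ring
  have hcount_eq : ∀ γ : Config d, γ.pointMeasure B = ∑' x : γ.pts, B.indicator 1 (x : Space d) :=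
    fun γ => by rw [← Config.lintegral_pointMeasure, lintegral_indicator_one hBm]
  have hV : ENNReal.ofReal z * volume B ≠ ⊤ :=
    ENNReal.mul_ne_top ENNReal.ofReal_ne_top (volume_bigCube_lt_top N).ne
  have h1 : ∫⁻ γ, γ.pointMeasure B ∂μ ≠ ⊤ := by
    have := hstep 1 measurable_one
    simp only [Pi.one_apply, mul_one, ← hcount_eq, lintegral_one, measure_univ] at this
    exact (this.trans_lt hV.lt_top).ne
  have h2 : ∫⁻ γ, γ.pointMeasure B ^ 2 ∂μ ≠ ⊤ := by
    have hle : ∀ γ : Config d, γ.pointMeasure B ^ 2 ≤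
        ∑' x : γ.pts, B.indicator 1 (x : Space d) * (1 + (γ.remove x).pointMeasure B) :=
      fun γ => by
      have hr : ∀ x : Space d, γ.pointMeasure B ≤ 1 + (γ.remove x).pointMeasure B := fun x => by
        rw [Config.pointMeasure_apply _ hBm, Config.pointMeasure_apply _ hBm]
        have hsub : γ.pts ∩ B ⊆ insert x ((γ.remove x).pts ∩ B) := by
          rintro y ⟨hy, hyB⟩
          by_cases hyx : y = x
          · exact Or.inl hyx
          · exact Or.inr ⟨⟨hy, hyx⟩, hyB⟩
        have h3 := (Set.encard_le_encard hsub).trans (Set.encard_insert_le _ _)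
        rw [add_comm]
        exact_mod_cast h3
      calc γ.pointMeasure B ^ 2 = (∑' x : γ.pts, B.indicator 1 (x : Space d)) * γ.pointMeasure B := by
            rw [← hcount_eq, sq]
        _ = ∑' x : γ.pts, B.indicator 1 (x : Space d) * γ.pointMeasure B :=
            ENNReal.tsum_mul_right.symm
        _ ≤ _ := ENNReal.tsum_le_tsum fun x => by gcongr; exact hr x
    refine ((lintegral_mono hle).trans (hstep (fun γ => 1 + γ.pointMeasure B)
      (measurable_const.add hcount))).trans_lt ?_ |>.ne
    refine ENNReal.mul_lt_top hV.lt_top ?_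
    rw [lintegral_add_left measurable_const]
    simp [h1.lt_top]
  refine ⟨fun γ => 1 + γ.pointMeasure B ^ 2, measurable_const.add (hcount.pow_const 2), ?_,
    ae_of_all _ fun γ => ⟨fun x _ _ => ?_, ?_⟩⟩
  · rw [lintegral_add_left measurable_const]
    simp [h2]
  · exact (pow_le_one₀ zero_le (hb1 x γ)).trans le_self_add
  · rw [← pointMeasure_bigCube]
    exact le_add_self

/-! ### Lattice sums -/

section Lattice

/-- The lattice cube of all `r` with `‖r‖ ≤ n`. -/
def latticeBox (d n : ℕ) : Finset (Fin d → ℤ) := gridBox d (n + 1)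

theorem maxNorm_le_iff {r : Fin d → ℤ} {n : ℕ} : maxNorm r ≤ n ↔ ∀ i, (r i).natAbs ≤ n := by
  simp [maxNorm]

theorem mem_latticeBox {r : Fin d → ℤ} {n : ℕ} : r ∈ latticeBox d n ↔ maxNorm r ≤ n := by
  rw [latticeBox, mem_gridBox, maxNorm_le_iff]
  refine forall_congr' fun i => ?_
  push_cast
  omega

theorem latticeBox_mono {n m : ℕ} (h : n ≤ m) : latticeBox d n ⊆ latticeBox d m := fun r hr => by
  rw [mem_latticeBox] at hr ⊢
  exact hr.trans h

theorem maxNorm_neg (r : Fin d → ℤ) : maxNorm (-r) = maxNorm r := by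
  simp [maxNorm]

theorem maxNorm_add_le (r s : Fin d → ℤ) : maxNorm (r + s) ≤ maxNorm r + maxNorm s := by
  rw [maxNorm_le_iff]
  intro i
  have h1 := maxNorm_le_iff.1 (le_refl (maxNorm r)) i
  have h2 := maxNorm_le_iff.1 (le_refl (maxNorm s)) i
  exact (Int.natAbs_add_le _ _).trans (add_le_add h1 h2)

/-- The number of points of the lattice cube. -/
def boxVol (d n : ℕ) : ℝ := (2 * (n : ℝ) + 1) ^ d

theorem card_latticeBox (n : ℕ) : ((latticeBox d n).card : ℝ) = boxVol d n := by
  rw [latticeBox, gridBox, Pi.card_Icc, boxVol]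
  simp only [Int.card_Icc, Finset.prod_const, Finset.card_univ, Fintype.card_fin]
  push_cast
  congr 1
  rw [show ((n : ℤ) + 1 - 1 + 1 - (1 - (n + 1))).toNat = 2 * n + 1 by omega]
  push_cast
  ring

theorem boxVol_pos (n : ℕ) : 0 < boxVol d n := by unfold boxVol; positivity

theorem boxVol_mono {n m : ℕ} (h : n ≤ m) : boxVol d n ≤ boxVol d m := by
  unfold boxVol
  gcongr

/-- For `p ≤ q` the side length satisfies `2(q + p) + 1 ≤ 3(2q + 1)`; the minimum supplies the
volume of the smaller box. -/
theorem boxVol_add_le (n k : ℕ) :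
    min (boxVol d n) (boxVol d k) * boxVol d (n + k) ≤ 3 ^ d * (boxVol d n * boxVol d k) := by
  have key : ∀ {p q : ℕ}, p ≤ q → boxVol d (q + p) ≤ 3 ^ d * boxVol d q := fun {p q} h => by
    rw [boxVol, boxVol, ← mul_pow]
    have h' : (p : ℝ) ≤ q := by exact_mod_cast h
    gcongr
    push_cast
    linarith
  rcases le_total k n with h | h
  · rw [min_eq_right (boxVol_mono h)]
    calc _ ≤ boxVol d k * (3 ^ d * boxVol d n) :=
          mul_le_mul_of_nonneg_left (key h) (boxVol_pos k).le
      _ = _ := by ring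
  · rw [min_eq_left (boxVol_mono h), add_comm]
    calc _ ≤ boxVol d n * (3 ^ d * boxVol d k) :=
          mul_le_mul_of_nonneg_left (key h) (boxVol_pos n).le
      _ = _ := by ring

variable {a : ℕ → ℝ}

theorem tendsto_of_summable_maxNorm [Nonempty (Fin d)]
    (hs : Summable fun r : Fin d → ℤ => a (maxNorm r)) : Tendsto a atTop (𝓝 0) := by
  have hinj : Function.Injective fun (k : ℕ) (_ : Fin d) => (k : ℤ) := fun k l h => by
    have := congrFun h (Classical.arbitrary _)
    simpa using this
  have h := (hs.comp_injective hinj).tendsto_atTop_zero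
  refine h.congr fun k => ?_
  simp only [Function.comp]
  congr 1
  simp [maxNorm, Finset.sup_const Finset.univ_nonempty]

/-- A telescoping sum. Writing `a m` as the sum of its decrements over `k ≥ m` turns interaction
sums into counts in lattice boxes. -/
theorem sum_range_layers (a : ℕ → ℝ) (m K : ℕ) :
    ∑ k ∈ Finset.range K, (if m ≤ k then a k - a (k + 1) else 0) = a m - a (max m K) := by
  induction K with
  | zero => simp
  | succ K ih =>
    rw [Finset.sum_range_succ, ih]
    split_ifs with h
    · rw [max_eq_right h, max_eq_right (by omega : m ≤ K + 1)]; ring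
    · rw [max_eq_left (by omega : K ≤ m), max_eq_left (by omega : K + 1 ≤ m)]; ring

theorem hasSum_layers (ha : Antitone a) (h0 : Tendsto a atTop (𝓝 0)) (m : ℕ) :
    HasSum (fun k => if m ≤ k then a k - a (k + 1) else 0) (a m) := by
  rw [hasSum_iff_tendsto_nat_of_nonneg]
  · simp_rw [sum_range_layers]
    have h1 : Tendsto (fun K => a (max m K)) atTop (𝓝 0) :=
      h0.comp (tendsto_atTop_mono (fun K => le_max_right m K) tendsto_id)
    simpa using h1.const_sub (a m)
  · intro k
    split_ifs
    · linarith [ha (Nat.le_succ k)]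
    · exact le_rfl

/-- Summation by parts: each decrement, counted once for every `r` with `‖r‖ ≤ k`, reassembles into
at most `a (maxNorm r)`. -/
theorem summable_layers (ha : Antitone a) (hpos : ∀ n, 0 < a n)
    (hs : Summable fun r : Fin d → ℤ => a (maxNorm r)) :
    Summable fun k => (a k - a (k + 1)) * boxVol d k := by
  have hΔ : ∀ k, 0 ≤ a k - a (k + 1) := fun k => sub_nonneg.2 (ha (Nat.le_succ k))
  refine summable_of_sum_range_le (c := ∑' r : Fin d → ℤ, a (maxNorm r))
    (fun k => mul_nonneg (hΔ k) (boxVol_pos k).le) fun K => ?_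
  have h1 : ∀ k ∈ Finset.range K, (a k - a (k + 1)) * boxVol d k =
      ∑ r ∈ latticeBox d K, if maxNorm r ≤ k then a k - a (k + 1) else 0 := fun k hk => by
    rw [← Finset.sum_filter, Finset.sum_const, nsmul_eq_mul, mul_comm, ← card_latticeBox]
    congr 2
    congr 1
    ext r
    rw [Finset.mem_filter, mem_latticeBox, mem_latticeBox]
    have := Finset.mem_range.1 hk
    constructor
    · intro h; exact ⟨by omega, h⟩
    · exact fun h => h.2
  rw [Finset.sum_congr rfl h1, Finset.sum_comm]
  calc _ ≤ ∑ r ∈ latticeBox d K, a (maxNorm r) := by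
        refine Finset.sum_le_sum fun r _ => ?_
        rw [sum_range_layers]
        linarith [hpos (max (maxNorm r) K)]
    _ ≤ _ := hs.sum_le_tsum _ fun r _ => (hpos _).le

/-- The influence on the cube `‖r‖ ≤ n` of a function on the complement, in terms of its sums over
concentric cubes. -/
theorem sum_outer_le [Nonempty (Fin d)] (ha : Antitone a) (hpos : ∀ n, 0 < a n)
    (hs : Summable fun r : Fin d → ℤ => a (maxNorm r)) {s : (Fin d → ℤ) → ℝ} (hs0 : ∀ r, 0 ≤ s r)
    {n : ℕ} {C : ℝ} (hC : ∀ k, ∑ r ∈ latticeBox d (n + k), s r ≤ C * boxVol d (n + k))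
    {R : Finset (Fin d → ℤ)} (hR : Disjoint (latticeBox d n) R) :
    Summable (fun k => (a k - a (k + 1)) * (min (boxVol d n) (boxVol d k) *
      (C * boxVol d (n + k) - ∑ r ∈ latticeBox d n, s r))) ∧
    ∑ r ∈ latticeBox d n, ∑ r' ∈ R, a (maxNorm (r - r')) * s r' ≤
      ∑' k, (a k - a (k + 1)) * (min (boxVol d n) (boxVol d k) *
        (C * boxVol d (n + k) - ∑ r ∈ latticeBox d n, s r)) := by
  classical
  set S := ∑ r ∈ latticeBox d n, s r with hS
  have hS0 : 0 ≤ S := Finset.sum_nonneg fun r _ => hs0 r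
  have hΔ : ∀ k, 0 ≤ a k - a (k + 1) := fun k => sub_nonneg.2 (ha (Nat.le_succ k))
  have hmin : ∀ k, 0 ≤ min (boxVol d n) (boxVol d k) := fun k =>
    le_min (boxVol_pos _).le (boxVol_pos _).le
  have hSk : ∀ k, S ≤ ∑ r ∈ latticeBox d (n + k), s r := fun k =>
    Finset.sum_le_sum_of_subset_of_nonneg (latticeBox_mono (Nat.le_add_right n k))
      fun r _ _ => hs0 r
  have hCS : ∀ k, 0 ≤ C * boxVol d (n + k) - S := fun k => sub_nonneg.2 ((hSk k).trans (hC k))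
  have hC0 : 0 ≤ C := by
    have h1 := hCS 0
    have h2 := boxVol_pos (d := d) (n + 0)
    by_contra h
    nlinarith
  have hsum : Summable (fun k => (a k - a (k + 1)) * (min (boxVol d n) (boxVol d k) *
      (C * boxVol d (n + k) - S))) := by
    refine ((summable_layers ha hpos hs).mul_left (C * 3 ^ d * boxVol d n)).of_nonneg_of_le
      (fun k => mul_nonneg (hΔ k) (mul_nonneg (hmin k) (hCS k))) fun k => ?_
    have h1 := boxVol_add_le (d := d) n k
    calc _ ≤ (a k - a (k + 1)) * (C * (min (boxVol d n) (boxVol d k) * boxVol d (n + k))) := by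
          refine mul_le_mul_of_nonneg_left ?_ (hΔ k)
          nlinarith [mul_nonneg (hmin k) hS0]
      _ ≤ (a k - a (k + 1)) * (C * (3 ^ d * (boxVol d n * boxVol d k))) := by
          refine mul_le_mul_of_nonneg_left ?_ (hΔ k)
          exact mul_le_mul_of_nonneg_left h1 hC0
      _ = _ := by ring
  refine ⟨hsum, ?_⟩
  have hlay : HasSum (fun k => ∑ r ∈ latticeBox d n, ∑ r' ∈ R,
      (if maxNorm (r - r') ≤ k then a k - a (k + 1) else 0) * s r')
      (∑ r ∈ latticeBox d n, ∑ r' ∈ R, a (maxNorm (r - r')) * s r') :=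
    hasSum_sum fun r _ => hasSum_sum fun r' _ =>
      (hasSum_layers ha (tendsto_of_summable_maxNorm hs) _).mul_right _
  refine hasSum_le (fun k => ?_) hlay hsum.hasSum
  -- At most `min (boxVol d n) (boxVol d k)` points of the inner box lie within distance `k` of
  -- `r'`, and none unless `r'` is in the box of radius `n + k`.
  have hcount : ∀ r' ∈ R, ∑ r ∈ latticeBox d n,
      (if maxNorm (r - r') ≤ k then a k - a (k + 1) else 0) * s r' ≤
      if r' ∈ latticeBox d (n + k) then
        (a k - a (k + 1)) * (min (boxVol d n) (boxVol d k) * s r') else 0 := fun r' _ => by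
    rw [← Finset.sum_mul, ← Finset.sum_filter, Finset.sum_const, nsmul_eq_mul]
    split_ifs with h
    · have h1 : (((latticeBox d n).filter fun r => maxNorm (r - r') ≤ k).card : ℝ) ≤
          min (boxVol d n) (boxVol d k) := by
        refine le_min ?_ ?_
        · rw [← card_latticeBox]
          exact_mod_cast Finset.card_filter_le _ _
        · rw [← card_latticeBox]
          norm_cast
          refine Finset.card_le_card_of_injOn (fun r => r - r') (fun r hr => ?_)
            (fun x _ y _ hxy => sub_left_injective hxy)
          have := (Finset.mem_filter.1 hr).2
          exact Finset.mem_coe.2 (mem_latticeBox.2 this)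
      calc _ = (((latticeBox d n).filter fun r => maxNorm (r - r') ≤ k).card : ℝ) *
            ((a k - a (k + 1)) * s r') := by ring
        _ ≤ min (boxVol d n) (boxVol d k) * ((a k - a (k + 1)) * s r') :=
            mul_le_mul_of_nonneg_right h1 (mul_nonneg (hΔ k) (hs0 _))
        _ = _ := by ring
    · have h1 : (latticeBox d n).filter (fun r => maxNorm (r - r') ≤ k) = ∅ := by
        refine Finset.filter_eq_empty_iff.2 fun r hr hk => h ?_
        rw [mem_latticeBox] at hr ⊢
        have h2 := maxNorm_add_le r (-(r - r'))
        rw [maxNorm_neg] at h2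
        have h3 : r + -(r - r') = r' := by abel
        rw [h3] at h2
        omega
      rw [h1]
      simp
  rw [Finset.sum_comm]
  refine (Finset.sum_le_sum hcount).trans ?_
  rw [← Finset.sum_filter, ← Finset.mul_sum, ← Finset.mul_sum]
  refine mul_le_mul_of_nonneg_left (mul_le_mul_of_nonneg_left ?_ (hmin k)) (hΔ k)
  -- Disjointness of `R` from the inner box allows `∑ s` over the inner box to be subtracted. This
  -- gain is what leaves only the small excess `ε` in `exists_sum_outer_le`.
  rw [le_sub_iff_add_le]
  refine le_trans ?_ (hC k)
  rw [hS, ← Finset.sum_union]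
  · refine Finset.sum_le_sum_of_subset_of_nonneg ?_ fun r _ _ => hs0 r
    refine Finset.union_subset (fun r hr => (Finset.mem_filter.1 hr).2)
      (latticeBox_mono (Nat.le_add_right n k))
  · exact (Finset.disjoint_of_subset_left (Finset.filter_subset _ _) hR.symm)

/-- If the sums over concentric cubes grow at most like the volume, the influence of the complement
on a large cube is small. -/
theorem exists_sum_outer_le [Nonempty (Fin d)] (ha : Antitone a) (hpos : ∀ n, 0 < a n)
    (hs : Summable fun r : Fin d → ℤ => a (maxNorm r)) {δ : ℝ} (hδ : 0 < δ) :
    ∃ ε > 0, ∃ n₀ : ℕ, ∀ n ≥ n₀, ∀ s : (Fin d → ℤ) → ℝ, (∀ r, 0 ≤ s r) →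
      (∀ k, (∑ r ∈ latticeBox d (n + k), s r) * boxVol d n ≤
        (1 + ε) * (∑ r ∈ latticeBox d n, s r) * boxVol d (n + k)) →
      ∀ R : Finset (Fin d → ℤ), Disjoint (latticeBox d n) R →
        ∑ r ∈ latticeBox d n, ∑ r' ∈ R, a (maxNorm (r - r')) * s r' ≤
          δ * ∑ r ∈ latticeBox d n, s r := by
  have hΔ : ∀ k, 0 ≤ a k - a (k + 1) := fun k => sub_nonneg.2 (ha (Nat.le_succ k))
  have hlay := summable_layers ha hpos hs
  set Θ := ∑' k, (a k - a (k + 1)) * boxVol d k with hΘ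
  have hΘ0 : 0 ≤ Θ := tsum_nonneg fun k => mul_nonneg (hΔ k) (boxVol_pos k).le
  -- The layer bound divided by `∑ s` over the inner box tends to `ε * Θ`, which this choice keeps
  -- below `δ`.
  set ε := δ / (2 * (Θ + 1)) with hε
  have hε0 : 0 < ε := by positivity
  have hεΘ : ε * Θ < δ := by
    have : ε * (Θ + 1) = δ / 2 := by rw [hε]; field_simp
    nlinarith
  -- For fixed `k` the minimum becomes `boxVol d k` and the volume ratio tends to `1`, so the
  -- bracket tends to `ε`. Boundary effects disappear, with domination by the summable layers.
  have hlim : Tendsto (fun n => ∑' k, (a k - a (k + 1)) * (min (boxVol d n) (boxVol d k) *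
      ((1 + ε) * (boxVol d (n + k) / boxVol d n) - 1))) atTop (𝓝 (∑' k, (a k - a (k + 1)) *
      (boxVol d k * ε))) := by
    refine tendsto_tsum_of_dominated_convergence
      (bound := fun k => (1 + ε) * 3 ^ d * ((a k - a (k + 1)) * boxVol d k))
      (hlay.mul_left _) (fun k => ?_) (Eventually.of_forall fun n k => ?_)
    · refine Tendsto.const_mul _ ?_
      have h1 : Tendsto (fun n => min (boxVol d n) (boxVol d k)) atTop (𝓝 (boxVol d k)) := by
        refine tendsto_const_nhds.congr' ?_
        filter_upwards [eventually_ge_atTop k] with n hn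
        rw [min_eq_right (boxVol_mono hn)]
      have h2 : Tendsto (fun n : ℕ => boxVol d (n + k) / boxVol d n) atTop (𝓝 1) := by
        have h3 : Tendsto (fun n : ℕ => 1 + (2 * (k : ℝ)) / (2 * (n : ℝ) + 1)) atTop
            (𝓝 (1 + 0)) := by
          refine Tendsto.const_add _ (Tendsto.const_div_atTop ?_ _)
          exact tendsto_atTop_add_const_right _ _
            (tendsto_natCast_atTop_atTop.const_mul_atTop two_pos)
        have h4 := h3.pow d
        rw [add_zero, one_pow] at h4
        refine h4.congr fun n => ?_
        rw [boxVol, boxVol, ← div_pow]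
        congr 1
        push_cast
        field_simp
        ring
      have h3 := h1.mul ((h2.const_mul (1 + ε)).sub_const 1)
      convert h3 using 2
      ring
    · have hw := boxVol_pos (d := d) n
      have h1 : 1 ≤ boxVol d (n + k) / boxVol d n := by
        rw [one_le_div hw]; exact boxVol_mono (Nat.le_add_right n k)
      have hmin : 0 ≤ min (boxVol d n) (boxVol d k) := le_min hw.le (boxVol_pos _).le
      have h2 : 0 ≤ (1 + ε) * (boxVol d (n + k) / boxVol d n) - 1 := by nlinarith
      rw [Real.norm_of_nonneg (mul_nonneg (hΔ k) (mul_nonneg hmin h2))]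
      have h3 : min (boxVol d n) (boxVol d k) * (boxVol d (n + k) / boxVol d n) ≤
          3 ^ d * boxVol d k := by
        rw [← mul_div_assoc, div_le_iff₀ hw]
        exact (boxVol_add_le n k).trans_eq (by ring)
      calc _ ≤ (a k - a (k + 1)) * ((1 + ε) *
            (min (boxVol d n) (boxVol d k) * (boxVol d (n + k) / boxVol d n))) := by
            refine mul_le_mul_of_nonneg_left ?_ (hΔ k)
            nlinarith
        _ ≤ (a k - a (k + 1)) * ((1 + ε) * (3 ^ d * boxVol d k)) := by
            refine mul_le_mul_of_nonneg_left ?_ (hΔ k)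
            exact mul_le_mul_of_nonneg_left h3 (by positivity)
        _ = _ := by ring
  have hval : ∑' k, (a k - a (k + 1)) * (boxVol d k * ε) = ε * Θ := by
    rw [hΘ, ← tsum_mul_left]
    exact tsum_congr fun k => by ring
  rw [hval] at hlim
  obtain ⟨n₀, hn₀⟩ := eventually_atTop.1 (hlim.eventually_lt_const hεΘ)
  refine ⟨ε, hε0, n₀, fun n hn s hs0 hgrow R hR => ?_⟩
  set S := ∑ r ∈ latticeBox d n, s r with hS
  have hS0 : 0 ≤ S := Finset.sum_nonneg fun r _ => hs0 r
  have hw := boxVol_pos (d := d) n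
  have h1 := (sum_outer_le ha hpos hs hs0 (n := n) (C := (1 + ε) * S / boxVol d n) (fun k => by
    have := hgrow k
    rw [div_mul_eq_mul_div, le_div_iff₀ hw]
    exact this) hR).2
  refine h1.trans ?_
  rw [← hS]
  calc _ = S * ∑' k, (a k - a (k + 1)) * (min (boxVol d n) (boxVol d k) *
      ((1 + ε) * (boxVol d (n + k) / boxVol d n) - 1)) := by
        rw [← tsum_mul_left]
        refine tsum_congr fun k => ?_
        field_simp
    _ ≤ S * δ := mul_le_mul_of_nonneg_left (hn₀ n hn).le hS0
    _ = _ := mul_comm _ _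

/-- The counterpart for sparse configurations: at a fixed radius, a density bound `t` on larger
boxes gives a constant independent of `s`. -/
theorem exists_sum_outer_bound [Nonempty (Fin d)] (ha : Antitone a) (hpos : ∀ n, 0 < a n)
    (hs : Summable fun r : Fin d → ℤ => a (maxNorm r)) (n : ℕ) {t : ℝ} :
    ∃ C, ∀ s : (Fin d → ℤ) → ℝ, (∀ r, 0 ≤ s r) →
      (∀ k, ∑ r ∈ latticeBox d (n + k), s r ≤ t * boxVol d (n + k)) →
      ∀ R : Finset (Fin d → ℤ), Disjoint (latticeBox d n) R →
        ∑ r ∈ latticeBox d n, ∑ r' ∈ R, a (maxNorm (r - r')) * s r' ≤ C := by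
  have hΔ : ∀ k, 0 ≤ a k - a (k + 1) := fun k => sub_nonneg.2 (ha (Nat.le_succ k))
  have hlay := summable_layers ha hpos hs
  refine ⟨∑' k, t * 3 ^ d * boxVol d n * ((a k - a (k + 1)) * boxVol d k),
    fun s hs0 hgrow R hR => ?_⟩
  obtain ⟨h1, h2⟩ := sum_outer_le ha hpos hs hs0 (n := n) hgrow hR
  refine h2.trans (h1.tsum_le_tsum (fun k => ?_) (hlay.mul_left _))
  have hS0 : 0 ≤ ∑ r ∈ latticeBox d n, s r := Finset.sum_nonneg fun r _ => hs0 r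
  have ht : 0 ≤ t := by
    have h3 := hS0.trans (hgrow 0)
    have h4 := boxVol_pos (d := d) (n + 0)
    by_contra h
    nlinarith
  have hmin : 0 ≤ min (boxVol d n) (boxVol d k) := le_min (boxVol_pos _).le (boxVol_pos _).le
  calc _ ≤ (a k - a (k + 1)) * (t * (min (boxVol d n) (boxVol d k) * boxVol d (n + k))) := by
        refine mul_le_mul_of_nonneg_left ?_ (hΔ k)
        nlinarith [mul_nonneg hmin hS0]
    _ ≤ (a k - a (k + 1)) * (t * (3 ^ d * (boxVol d n * boxVol d k))) := by
        refine mul_le_mul_of_nonneg_left ?_ (hΔ k)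
        exact mul_le_mul_of_nonneg_left (boxVol_add_le n k) ht
    _ = _ := by ring

end Lattice

/-! ### Adding finitely many particles -/

/-- Add the points of a list to a configuration. -/
def addList (γ : Config d) : List (Space d) → Config d
  | [] => γ
  | x :: l => (addList γ l).add x

theorem mem_addList {γ : Config d} {l : List (Space d)} {x : Space d} :
    x ∈ (addList γ l).pts ↔ x ∈ l ∨ x ∈ γ.pts := by
  induction l with
  | nil => simp [addList]
  | cons y l ih =>
    change x = y ∨ x ∈ (addList γ l).pts ↔ _
    rw [ih, List.mem_cons, or_assoc]

/-- The product of the Boltzmann factors of successively added particles. -/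
def listWeight (φ : Space d → EReal) (γ : Config d) : List (Space d) → ℝ≥0∞
  | [] => 1
  | x :: l => boltzmann φ x (addList γ l) * listWeight φ γ l

/-- The event that there are `n` points in `Λ`. -/
def countEvent (Λ : Set (Space d)) (n : ℕ) : Set (Config d) := {γ | γ.pointMeasure Λ = n}

theorem measurableSet_countEvent {Λ : Set (Space d)} (hΛ : MeasurableSet Λ) (n : ℕ) :
    MeasurableSet (countEvent Λ n) :=
  ((Measure.measurable_coe hΛ).comp Config.measurable_pointMeasure) (measurableSet_singleton _)

theorem pointMeasure_add {γ : Config d} {x : Space d} {Λ : Set (Space d)} (hΛ : MeasurableSet Λ)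
    (hx : x ∈ Λ) (hxγ : x ∉ γ.pts) : (γ.add x).pointMeasure Λ = γ.pointMeasure Λ + 1 := by
  rw [Config.pointMeasure_apply _ hΛ, Config.pointMeasure_apply _ hΛ]
  have : (γ.add x).pts ∩ Λ = insert x (γ.pts ∩ Λ) := Set.insert_inter_of_mem hx
  rw [this, Set.encard_insert_of_notMem fun h => hxγ h.1]
  simp

/-- A bound for expectations on the event that there are `n` particles in `Λ`. -/
theorem setLIntegral_countEvent_le [Nonempty (Fin d)] (hφ : Measurable φ) (hμ : IsGibbs φ z μ)
    {Λ : Set (Space d)} (hΛ : MeasurableSet Λ) {C : ℝ≥0∞} (n : ℕ) {G : Config d → ℝ≥0∞}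
    (hG : Measurable G)
    (hC : ∀ (γ : Config d) (l : List (Space d)), l.length = n → l.Nodup →
      (∀ x ∈ l, x ∈ Λ ∧ x ∉ γ.pts) → γ.pts ∩ Λ = ∅ →
      ENNReal.ofReal z ^ n * listWeight φ γ l * G (addList γ l) ≤ C) :
    ∫⁻ γ in countEvent Λ n, G γ ∂μ ≤ C * (volume Λ ^ n / n.factorial) := by
  classical
  have := hμ.1
  -- The Gibbs identity extracts one of the `n + 1` particles in `Λ`, and these `n + 1` choices
  -- produce the factorial. The remaining integral has `n` particles and a new integrand, hence the
  -- generalization over `G`.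
  induction n generalizing G with
  | zero =>
    calc ∫⁻ γ in countEvent Λ 0, G γ ∂μ ≤ ∫⁻ γ in countEvent Λ 0, C ∂μ := by
          refine setLIntegral_mono measurable_const fun γ hγ => ?_
          have h0 : γ.pts ∩ Λ = ∅ := by
            have : γ.pointMeasure Λ = ((0 : ℕ) : ℝ≥0∞) := hγ
            rw [Config.pointMeasure_apply _ hΛ] at this
            simpa using this
          simpa [listWeight, addList] using hC γ [] rfl List.nodup_nil (by simp) h0
      _ ≤ C := by
          rw [setLIntegral_const]
          exact mul_le_of_le_one_right zero_le prob_le_one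
      _ = _ := by simp
  | succ n ih =>
    set E := countEvent Λ (n + 1) with hE
    have hEm : MeasurableSet E := measurableSet_countEvent hΛ _
    have hE' : MeasurableSet (countEvent (d := d) Λ n) := measurableSet_countEvent hΛ _
    -- Setting the integrand to `0` at `x ∈ γ` changes nothing almost everywhere and ensures that
    -- the extended list has no repetitions.
    set Gx : Space d → Config d → ℝ≥0∞ := fun x γ =>
      if x ∈ γ.pts then 0 else ENNReal.ofReal z * boltzmann φ x γ * G (γ.add x) with hGx
    have hGxm : Measurable fun p : Config d × Space d => Gx p.2 p.1 :=
      Measurable.ite (Config.measurableSet_mem measurable_fst measurable_snd) measurable_const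
        ((measurable_birthDensity hφ).mul
          (hG.comp (Config.measurable_add measurable_fst measurable_snd)))
    have hGxm' : ∀ x, Measurable (Gx x) := fun x =>
      hGxm.comp (measurable_id.prodMk measurable_const)
    have hind : Measurable fun p : Config d × Space d => Λ.indicator (1 : Space d → ℝ≥0∞) p.2 :=
      (measurable_one.indicator hΛ).comp measurable_snd
    have hstep : ∀ x ∈ Λ, ∫⁻ γ in countEvent Λ n, Gx x γ ∂μ ≤
        C * (volume Λ ^ n / n.factorial) := fun x hx => by
      refine ih (hGxm' x) fun γ l hl hnd hmem h0 => ?_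
      by_cases hxl : x ∈ (addList γ l).pts
      · simp [hGx, hxl]
      · simp only [hGx, if_neg hxl]
        rw [mem_addList, not_or] at hxl
        have h := hC γ (x :: l) (by simp [hl]) (List.nodup_cons.2 ⟨hxl.1, hnd⟩)
          (fun y hy => by
            rcases List.mem_cons.1 hy with rfl | hy
            · exact ⟨hx, hxl.2⟩
            · exact hmem y hy) h0
        refine le_of_eq_of_le ?_ h
        simp only [listWeight, addList]
        ring
    have hgnz := hμ.2 (fun γ x => Λ.indicator 1 x * E.indicator G γ)
      (hind.mul ((hG.indicator hEm).comp measurable_fst))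
    have hleft : ∀ γ : Config d, ∑' x : γ.pts, Λ.indicator (1 : Space d → ℝ≥0∞) (x : Space d) *
        E.indicator G γ = (n + 1 : ℝ≥0∞) * E.indicator G γ := fun γ => by
      rw [ENNReal.tsum_mul_right, ← Config.lintegral_pointMeasure, lintegral_indicator_one hΛ]
      by_cases hγ : γ ∈ E
      · rw [show γ.pointMeasure Λ = ((n + 1 : ℕ) : ℝ≥0∞) from hγ]
        push_cast
        rfl
      · rw [Set.indicator_of_notMem hγ, mul_zero, mul_zero]
    have hright : ∀ γ : Config d, ∫⁻ x, ENNReal.ofReal z * boltzmann φ x γ *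
        (Λ.indicator 1 x * E.indicator G (γ.add x)) =
        ∫⁻ x, Λ.indicator 1 x * (countEvent Λ n).indicator (Gx x) γ := fun γ => by
      refine lintegral_congr_ae ?_
      filter_upwards [ae_notMem_pts γ] with x hx
      by_cases hxΛ : x ∈ Λ
      · have hiff : γ.add x ∈ E ↔ γ ∈ countEvent Λ n := by
          change (γ.add x).pointMeasure Λ = ((n + 1 : ℕ) : ℝ≥0∞) ↔ γ.pointMeasure Λ = n
          rw [pointMeasure_add hΛ hxΛ hx]
          push_cast
          exact (ENNReal.add_left_inj ENNReal.one_ne_top)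
        rw [Set.indicator_of_mem hxΛ, Pi.one_apply, one_mul, one_mul]
        by_cases hγ : γ ∈ countEvent Λ n
        · rw [Set.indicator_of_mem hγ, Set.indicator_of_mem (hiff.2 hγ)]
          simp only [hGx, if_neg hx]
        · rw [Set.indicator_of_notMem hγ, Set.indicator_of_notMem (fun h => hγ (hiff.1 h)), mul_zero]
      · rw [Set.indicator_of_notMem hxΛ]
        simp
    simp_rw [hleft, hright] at hgnz
    rw [lintegral_const_mul _ (hG.indicator hEm), lintegral_indicator hEm,
      lintegral_lintegral_swap] at hgnz
    · have hbound : ∫⁻ x, ∫⁻ γ, Λ.indicator (1 : Space d → ℝ≥0∞) x *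
          (countEvent Λ n).indicator (Gx x) γ ∂μ ≤
          volume Λ * (C * (volume Λ ^ n / n.factorial)) := by
        calc _ ≤ ∫⁻ x, Λ.indicator (1 : Space d → ℝ≥0∞) x * (C * (volume Λ ^ n / n.factorial)) := by
              refine lintegral_mono fun x => ?_
              rw [lintegral_const_mul _ ((hGxm' x).indicator hE'), lintegral_indicator hE']
              by_cases hx : x ∈ Λ
              · gcongr
                exact hstep x hx
              · rw [Set.indicator_of_notMem hx, zero_mul, zero_mul]
          _ = _ := by
              rw [lintegral_mul_const _ (measurable_one.indicator hΛ), lintegral_indicator_one hΛ]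
      rw [← hgnz] at hbound
      have hn0 : (n + 1 : ℝ≥0∞) ≠ 0 := by positivity
      have hnt : (n + 1 : ℝ≥0∞) ≠ ⊤ := by finiteness
      calc _ ≤ (n + 1 : ℝ≥0∞)⁻¹ * (volume Λ * (C * (volume Λ ^ n / n.factorial))) := by
            exact (ENNReal.mul_le_iff_le_inv hn0 hnt).1 hbound
        _ = _ := by
            rw [Nat.factorial_succ, pow_succ]
            push_cast
            rw [div_eq_mul_inv, div_eq_mul_inv, ENNReal.mul_inv (Or.inl hn0) (Or.inl hnt)]
            ring
    · refine (hind.mul ?_).aemeasurable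
      have : (fun p : Config d × Space d => (countEvent Λ n).indicator (Gx p.2) p.1) =
          (Prod.fst ⁻¹' countEvent Λ n).indicator fun p => Gx p.2 p.1 := by
        ext p
        by_cases hp : p.1 ∈ countEvent Λ n <;> simp [hp]
      rw [this]
      exact hGxm.indicator (measurable_fst hE')

/-- A bound for expectations, from a bound for the finite volume densities. -/
theorem lintegral_le_of_listWeight [Nonempty (Fin d)] (hz : 0 < z) (hφ : Measurable φ)
    (hμ : IsGibbs φ z μ) {Λ : Set (Space d)} (hΛ : MeasurableSet Λ)
    (hb : Bornology.IsBounded Λ) {v D : ℝ} (hv0 : 0 ≤ v)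
    (hv : volume Λ = ENNReal.ofReal v) {G : Config d → ℝ≥0∞} (hG : Measurable G)
    (hC : ∀ (γ : Config d) (l : List (Space d)), l.Nodup →
      (∀ x ∈ l, x ∈ Λ ∧ x ∉ γ.pts) → γ.pts ∩ Λ = ∅ →
      listWeight φ γ l * G (addList γ l) ≤ ENNReal.ofReal D) :
    ∫⁻ γ, G γ ∂μ ≤ ENNReal.ofReal (D * Real.exp (z * v)) := by
  have := hμ.1
  have hcover : (⋃ n, countEvent (d := d) Λ n) = Set.univ := by
    refine Set.eq_univ_of_forall fun γ => Set.mem_iUnion.2 ⟨_, γ.pointMeasure_eq_ncard hΛ hb⟩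
  have hdisj : Pairwise (Function.onFun Disjoint fun n => countEvent (d := d) Λ n) :=
    fun n m hnm => Set.disjoint_left.2 fun γ h1 h2 => hnm (by
      have : (n : ℝ≥0∞) = m := (show γ.pointMeasure Λ = n from h1).symm.trans h2
      exact_mod_cast this)
  rw [← setLIntegral_univ, ← hcover, lintegral_iUnion (measurableSet_countEvent hΛ) hdisj]
  have hexp : HasSum (fun n : ℕ => (z * v) ^ n / n.factorial) (Real.exp (z * v)) := by
    rw [Real.exp_eq_exp_ℝ]
    exact NormedSpace.expSeries_div_hasSum_exp (z * v)
  have hzv : 0 ≤ z * v := mul_nonneg hz.le hv0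
  calc _ ≤ ∑' n : ℕ, ENNReal.ofReal D * ENNReal.ofReal ((z * v) ^ n / n.factorial) := by
        refine ENNReal.tsum_le_tsum fun n => ?_
        refine (setLIntegral_countEvent_le hφ hμ hΛ (C := ENNReal.ofReal z ^ n * ENNReal.ofReal D)
          n hG fun γ l _ hnd hmem h0 => ?_).trans_eq ?_
        · rw [mul_assoc]
          gcongr
          exact hC γ l hnd hmem h0
        · rw [hv, ENNReal.ofReal_div_of_pos (by positivity), mul_pow,
            ENNReal.ofReal_mul (by positivity), ENNReal.ofReal_pow hz.le, ENNReal.ofReal_pow hv0,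
            ENNReal.ofReal_natCast, div_eq_mul_inv, div_eq_mul_inv]
          ring
    _ = _ := by
        rw [ENNReal.tsum_mul_left, ← ENNReal.ofReal_tsum_of_nonneg (fun n => by positivity)
          hexp.summable, hexp.tsum_eq, ENNReal.ofReal_mul' (Real.exp_pos _).le]

/-! ### The energy of finitely many added particles -/

theorem boltzmann_eq_of_ne_zero {x : Space d} {γ : Config d} (h : boltzmann φ x γ ≠ 0) :
    Summable (fun y : γ.pts => |(φ (x - y)).toReal|) ∧
      boltzmann φ x γ = ENNReal.ofReal (Real.exp (-∑' y : γ.pts, (φ (x - y)).toReal)) := by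
  by_cases hs : Summable (fun y : γ.pts => |(φ (x - y)).toReal|)
  · refine ⟨hs, ?_⟩
    rw [boltzmann, relEnergy, if_pos hs, ← EReal.coe_neg, EReal.exp_coe]
  · exfalso
    apply h
    rw [boltzmann, relEnergy, if_neg hs, EReal.neg_top, EReal.exp_bot]

theorem summable_of_subset {α : Type*} {s t : Set α} {f : α → ℝ} (h : s ⊆ t)
    (ht : Summable fun y : t => f y) : Summable fun y : s => f y :=
  Summable.comp_injective (f := fun y : t => f y) ht (Set.inclusion_injective h)

theorem tsum_union_finset {α : Type*} {s : Set α} {t : Finset α} (hd : Disjoint s (t : Set α))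
    {f : α → ℝ} (hs : Summable fun y : s => f y) :
    ∑' y : ↥(s ∪ (t : Set α)), f y = ∑' y : s, f y + ∑ y ∈ t, f y := by
  rw [Summable.tsum_union_disjoint hd hs (Summable.of_finite), Finset.tsum_subtype' t f]

-- Each Boltzmann factor contributes the interaction of the new particle with `γ` and with the
-- earlier ones, so the product is the exponential of minus the total energy. Evenness of `φ`
-- accounts for the factor `1/2`; a nonzero factor certifies summability.
open Classical in
theorem listWeight_eq (hφ : IsPairPotential φ) {γ : Config d} {l : List (Space d)}
    (hnd : l.Nodup) (hl : ∀ x ∈ l, x ∉ γ.pts) (h : listWeight φ γ l ≠ 0) :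
    (∀ x ∈ l, Summable (fun y : γ.pts => |(φ (x - y)).toReal|)) ∧
      listWeight φ γ l = ENNReal.ofReal (Real.exp
        (-((1 / 2) * ∑ p ∈ l.toFinset.offDiag, (φ (p.1 - p.2)).toReal +
          ∑ x ∈ l.toFinset, ∑' y : γ.pts, (φ (x - y)).toReal))) := by
  induction l with
  | nil => simp [listWeight]
  | cons x l ih =>
    rw [List.nodup_cons] at hnd
    rw [listWeight] at h ⊢
    obtain ⟨h1, h2⟩ := mul_ne_zero_iff.1 h
    obtain ⟨ih1, ih2⟩ := ih hnd.2 (fun y hy => hl y (List.mem_cons_of_mem _ hy)) h2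
    obtain ⟨hs, hb⟩ := boltzmann_eq_of_ne_zero h1
    have hpts : (addList γ l).pts = γ.pts ∪ (l.toFinset : Set (Space d)) := by
      ext y
      rw [mem_addList, Set.mem_union, Finset.mem_coe, List.mem_toFinset, or_comm]
    have hdisj : Disjoint γ.pts (l.toFinset : Set (Space d)) :=
      Set.disjoint_left.2 fun y hy hyl => hl y (List.mem_cons_of_mem _ (by simpa using hyl)) hy
    rw [hpts] at hs hb
    have hsγ : Summable (fun y : γ.pts => |(φ (x - y)).toReal|) :=
      summable_of_subset (f := fun y => |(φ (x - y)).toReal|) Set.subset_union_left hs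
    have hsum : ∑' y : ↥(γ.pts ∪ (l.toFinset : Set (Space d))), (φ (x - y)).toReal =
        ∑' y : γ.pts, (φ (x - y)).toReal + ∑ y ∈ l.toFinset, (φ (x - y)).toReal := by
      exact tsum_union_finset hdisj (f := fun y => (φ (x - y)).toReal) (Summable.of_abs hsγ)
    refine ⟨fun y hy => ?_, ?_⟩
    · rcases List.mem_cons.1 hy with rfl | hy
      · exact hsγ
      · exact ih1 y hy
    · have hx : x ∉ l.toFinset := by simpa using hnd.1
      rw [hb, hsum, ih2, ← ENNReal.ofReal_mul (Real.exp_pos _).le, ← Real.exp_add]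
      congr 2
      rw [List.toFinset_cons, Finset.sum_insert hx, Finset.offDiag_insert hx, Finset.sum_union,
        Finset.sum_union]
      · have e1 : ∑ p ∈ ({x} : Finset (Space d)) ×ˢ l.toFinset, (φ (p.1 - p.2)).toReal =
            ∑ y ∈ l.toFinset, (φ (x - y)).toReal := by
          rw [Finset.sum_product, Finset.sum_singleton]
        have e2 : ∑ p ∈ l.toFinset ×ˢ ({x} : Finset (Space d)), (φ (p.1 - p.2)).toReal =
            ∑ y ∈ l.toFinset, (φ (x - y)).toReal := by
          rw [Finset.sum_product]
          refine Finset.sum_congr rfl fun y hy => ?_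
          rw [Finset.sum_singleton]
          dsimp only
          rw [← neg_sub x y, hφ.even (x - y) (sub_ne_zero.2 fun hxy : x = y => hx (by rwa [hxy]))]
        rw [e1, e2]
        ring
      · rw [Finset.disjoint_left]
        intro p hp hp'
        simp only [Finset.mem_offDiag, Finset.mem_product, Finset.mem_singleton] at hp hp'
        exact hx (hp'.1 ▸ hp.1)
      · rw [Finset.disjoint_left]
        intro p hp hp'
        simp only [Finset.mem_union, Finset.mem_offDiag, Finset.mem_product,
          Finset.mem_singleton] at hp hp'
        rcases hp with hp | hp
        · exact hx (hp'.2 ▸ hp.2.1)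
        · exact hx (hp'.2 ▸ hp.2)

/-! ### Occupation numbers -/

theorem finite_inter_cube (γ : Config d) (r : Fin d → ℤ) : (γ.pts ∩ cube r).Finite :=
  γ.finite_inter_of_isBounded (isBounded_cube r)

theorem cubeCount_mono {γ : Config d} {s : Set (Space d)} (h : s ⊆ γ.pts) (r : Fin d → ℤ) :
    cubeCount s r ≤ cubeCount γ.pts r :=
  Set.ncard_le_ncard (Set.inter_subset_inter_left _ h) (finite_inter_cube γ r)

theorem measurable_cubeCount (r : Fin d → ℤ) :
    Measurable fun γ : Config d => (cubeCount γ.pts r : ℝ) := by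
  have h : ∀ γ : Config d, (cubeCount γ.pts r : ℝ) = (γ.pointMeasure (cube r)).toReal := fun γ => by
    rw [γ.pointMeasure_eq_ncard (measurableSet_cube r) (isBounded_cube r), cubeCount,
      ENNReal.toReal_natCast]
  simp_rw [h]
  exact ((Measure.measurable_coe (measurableSet_cube r)).comp
    Config.measurable_pointMeasure).ennreal_toReal

/-- The sum of the squares of the occupation numbers of the cubes `Q_r`, `‖r‖ ≤ n`. -/
def sqSum (γ : Config d) (n : ℕ) : ℝ := ∑ r ∈ latticeBox d n, (cubeCount γ.pts r : ℝ) ^ 2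

theorem sqSum_nonneg (γ : Config d) (n : ℕ) : 0 ≤ sqSum γ n :=
  Finset.sum_nonneg fun _ _ => sq_nonneg _

theorem measurable_sqSum (n : ℕ) : Measurable fun γ : Config d => sqSum γ n :=
  Finset.measurable_fun_sum _ fun r _ => (measurable_cubeCount r).pow_const 2

theorem boxCount_eq_sum (γ : Config d) (n : ℕ) :
    boxCount γ (n + 1) = ∑ r ∈ latticeBox d n, (cubeCount γ.pts r : ℝ) := by
  have h : γ.pointMeasure (bigCube d (n + 1)) =
      ∑ r ∈ latticeBox d n, γ.pointMeasure (cube r) := by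
    rw [bigCube, measure_biUnion_finset (fun r _ s _ h => disjoint_cube h)
      fun r _ => measurableSet_cube r]
    rfl
  simp_rw [γ.pointMeasure_eq_ncard (measurableSet_cube _) (isBounded_cube _)] at h
  rw [γ.pointMeasure_eq_ncard (measurableSet_bigCube _) (isBounded_bigCube _)] at h
  simp only [boxCount, cubeCount]
  exact_mod_cast h

theorem cast_le_sq (n : ℕ) : (n : ℝ) ≤ (n : ℝ) ^ 2 := by
  exact_mod_cast Nat.le_self_pow two_ne_zero n

theorem boxCount_le_sqSum (γ : Config d) (n : ℕ) : boxCount γ (n + 1) ≤ sqSum γ n := by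
  rw [boxCount_eq_sum]
  exact Finset.sum_le_sum fun r _ => cast_le_sq _

theorem boxCount_mono (γ : Config d) {N M : ℕ} (h : N ≤ M) : boxCount γ N ≤ boxCount γ M := by
  unfold boxCount
  exact_mod_cast Set.ncard_le_ncard (Set.inter_subset_inter_right _ (bigCube_mono h))
    (γ.finite_inter_of_isBounded (isBounded_bigCube M))

/-- Completing the square in each unit cube; a linear term in the count costs a little of the
quadratic one and a volume term. -/
theorem mul_boxCount_le (γ : Config d) (n : ℕ) (b : ℝ) {α : ℝ} (hα : 0 < α) :
    b * boxCount γ (n + 1) ≤ α * sqSum γ n + b ^ 2 / (4 * α) * boxVol d n := by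
  rw [boxCount_eq_sum, sqSum, Finset.mul_sum, Finset.mul_sum, ← card_latticeBox, mul_comm _ (_ : ℝ),
    ← nsmul_eq_mul, ← Finset.sum_const, mul_comm, ← Finset.sum_add_distrib]
  refine Finset.sum_le_sum fun r _ => ?_
  have h : α * (cubeCount γ.pts r : ℝ) ^ 2 + b ^ 2 / (4 * α) - b * cubeCount γ.pts r =
      (2 * α * cubeCount γ.pts r - b) ^ 2 / (4 * α) := by
    field_simp
    ring
  rw [← sub_nonneg, mul_comm α 4, h]
  positivity

/-! ### Lower bounds for the energy -/

/-- This passes from finite subconfigurations, where lower regularity is assumed, to the interaction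
with an infinite exterior. -/
theorem le_tsum_of_le_sum {α : Type*} {s : Set α} {f : α → ℝ} (hf : Summable fun y : s => f y)
    {c : ℝ} (h : ∀ t : Finset α, (t : Set α) ⊆ s → c ≤ ∑ y ∈ t, f y) : c ≤ ∑' y : s, f y := by
  refine ge_of_tendsto' hf.hasSum fun u => ?_
  have := h (u.map (Function.Embedding.subtype _)) (by
    intro y hy
    simp only [Finset.coe_map, Set.mem_image] at hy
    obtain ⟨x, -, rfl⟩ := hy
    exact x.2)
  rwa [Finset.sum_map] at this

variable {a : ℕ → ℝ} {A B : ℝ}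

open Classical in
/-- The inequality in the definition of superstability. -/
def SuperstableWith (φ : Space d → EReal) (A B : ℝ) : Prop :=
  ∀ N : ℕ, 1 ≤ N → ∀ γ : Finset (Space d), (γ : Set (Space d)) ⊆ bigCube d N →
    ∑ r ∈ gridBox d N, (A * (cubeCount (γ : Set (Space d)) r : ℝ) ^ 2
        - B * (cubeCount (γ : Set (Space d)) r : ℝ))
      ≤ (1 / 2) * ∑ p ∈ γ.offDiag, (φ (p.1 - p.2)).toReal

/-- The inequality in the definition of lower regularity. -/
def LowerRegularWith (φ : Space d → EReal) (a : ℕ → ℝ) : Prop :=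
  ∀ R' R'' : Finset (Fin d → ℤ), Disjoint R' R'' → ∀ γ' γ'' : Finset (Space d),
    (γ' : Set (Space d)) ⊆ (⋃ r ∈ R', cube r) → (γ'' : Set (Space d)) ⊆ (⋃ r ∈ R'', cube r) →
      -(∑ r' ∈ R', ∑ r'' ∈ R'', a (maxNorm (r' - r'')) *
          (cubeCount (γ' : Set (Space d)) r' : ℝ) * (cubeCount (γ'' : Set (Space d)) r'' : ℝ))
        ≤ ∑ x ∈ γ', ∑ y ∈ γ'', (φ (x - y)).toReal

-- The finite set `t` meets only the cubes indexed by its image. Since `a > 0`, replacing the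
-- occupation numbers of `s` and `t` by those of `ζ` only weakens the bound.
open Classical in
theorem LowerRegularWith.interaction_ge (h : LowerRegularWith φ a) (hpos : ∀ n, 0 < a n)
    {ζ : Config d} {n : ℕ} {s t : Finset (Space d)} (hs : (s : Set (Space d)) ⊆ ζ.pts)
    (ht : (t : Set (Space d)) ⊆ ζ.pts) (hsn : ∀ x ∈ s, x ∈ bigCube d (n + 1))
    (htn : ∀ y ∈ t, y ∉ bigCube d (n + 1)) :
    Disjoint (latticeBox d n) (t.image cubeIndex) ∧
    -(∑ r ∈ latticeBox d n, ∑ r' ∈ t.image cubeIndex, a (maxNorm (r - r')) *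
      (cubeCount ζ.pts r : ℝ) * (cubeCount ζ.pts r' : ℝ)) ≤
        ∑ x ∈ s, ∑ y ∈ t, (φ (x - y)).toReal := by
  have hdisj : Disjoint (latticeBox d n) (t.image cubeIndex) := by
    rw [Finset.disjoint_left]
    intro r hr hr'
    obtain ⟨y, hy, rfl⟩ := Finset.mem_image.1 hr'
    exact htn y hy (mem_bigCube.2 hr)
  refine ⟨hdisj, le_trans (neg_le_neg ?_) (h (latticeBox d n) (t.image cubeIndex) hdisj s t
    (fun x hx => hsn x hx) fun y hy => mem_biUnion_cube.2 (Finset.mem_image_of_mem _ hy))⟩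
  refine Finset.sum_le_sum fun r _ => Finset.sum_le_sum fun r' _ => ?_
  have h1 := cubeCount_mono hs r
  have h2 := cubeCount_mono ht r'
  have h3 := (hpos (maxNorm (r - r'))).le
  gcongr

/-- The interaction of a cube with its complement is controlled by the occupation numbers of the
cube, if the influence of the complement is small. -/
theorem sum_mul_le_of_outer_le (hA : 0 < A) (hpos : ∀ n, 0 < a n)
    (hs : Summable fun r : Fin d → ℤ => a (maxNorm r)) {c : (Fin d → ℤ) → ℝ} {n : ℕ}
    {R : Finset (Fin d → ℤ)}
    (h : ∑ r ∈ latticeBox d n, ∑ r' ∈ R, a (maxNorm (r - r')) * c r' ^ 2 ≤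
      A ^ 2 / (4 * ∑' r : Fin d → ℤ, a (maxNorm r)) * ∑ r ∈ latticeBox d n, c r ^ 2) :
    ∑ r ∈ latticeBox d n, ∑ r' ∈ R, a (maxNorm (r - r')) * c r * c r' ≤
      A / 2 * ∑ r ∈ latticeBox d n, c r ^ 2 := by
  set Θ := ∑' r : Fin d → ℤ, a (maxNorm r) with hΘ
  have hΘ0 : 0 < Θ := hs.tsum_pos (fun r => (hpos _).le) 0 (hpos _)
  have h1 : ∀ r, ∑ r' ∈ R, a (maxNorm (r - r')) ≤ Θ := fun r => by
    have h2 : ∑ r' ∈ R, a (maxNorm (r - r')) =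
        ∑ r' ∈ R.map ⟨fun r' => r - r', sub_right_injective⟩, a (maxNorm r') := by
      rw [Finset.sum_map]; rfl
    rw [h2]
    exact hs.sum_le_tsum _ fun r _ => (hpos _).le
  -- Young's inequality with weights of product `1/4`. The inner squares, by summability of `a`, and
  -- the outer squares, by hypothesis, each contribute at most `A/4` times the sum of inner squares.
  calc _ ≤ ∑ r ∈ latticeBox d n, ∑ r' ∈ R, (A / (4 * Θ) * (c r ^ 2 * a (maxNorm (r - r'))) +
        Θ / A * (a (maxNorm (r - r')) * c r' ^ 2)) := by
        refine Finset.sum_le_sum fun r _ => Finset.sum_le_sum fun r' _ => ?_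
        have h2 : A / (4 * Θ) * (c r ^ 2 * a (maxNorm (r - r'))) +
            Θ / A * (a (maxNorm (r - r')) * c r' ^ 2) - a (maxNorm (r - r')) * c r * c r' =
            a (maxNorm (r - r')) * ((A * c r - 2 * Θ * c r') ^ 2 / (4 * Θ * A)) := by
          field_simp
          ring
        have h3 : 0 ≤ a (maxNorm (r - r')) * ((A * c r - 2 * Θ * c r') ^ 2 / (4 * Θ * A)) := by
          have := hpos (maxNorm (r - r'))
          positivity
        linarith
    _ = A / (4 * Θ) * ∑ r ∈ latticeBox d n, c r ^ 2 * ∑ r' ∈ R, a (maxNorm (r - r')) +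
        Θ / A * ∑ r ∈ latticeBox d n, ∑ r' ∈ R, a (maxNorm (r - r')) * c r' ^ 2 := by
        simp only [Finset.sum_add_distrib, Finset.mul_sum]
    _ ≤ A / (4 * Θ) * ∑ r ∈ latticeBox d n, c r ^ 2 * Θ +
        Θ / A * (A ^ 2 / (4 * Θ) * ∑ r ∈ latticeBox d n, c r ^ 2) := by
        gcongr with r
        exact h1 r
    _ = _ := by
        rw [← Finset.sum_mul]
        field_simp
        ring

/-- A pointwise bound for the finite volume densities. -/
theorem listWeight_le (hφ : IsPairPotential φ) (hA : 0 < A) (hSS : SuperstableWith φ A B)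
    (hLR : LowerRegularWith φ a) (hpos : ∀ n, 0 < a n)
    (hs : Summable fun r : Fin d → ℤ => a (maxNorm r)) {n : ℕ} {γ : Config d}
    {l : List (Space d)} (hnd : l.Nodup) (hl : ∀ x ∈ l, x ∈ bigCube d (n + 1) ∧ x ∉ γ.pts)
    (h0 : γ.pts ∩ bigCube d (n + 1) = ∅)
    (hout : ∀ R : Finset (Fin d → ℤ), Disjoint (latticeBox d n) R →
      ∑ r ∈ latticeBox d n, ∑ r' ∈ R, a (maxNorm (r - r')) *
        (cubeCount (addList γ l).pts r' : ℝ) ^ 2 ≤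
      A ^ 2 / (4 * ∑' r : Fin d → ℤ, a (maxNorm r)) * sqSum (addList γ l) n) :
    listWeight φ γ l ≤ ENNReal.ofReal
      (Real.exp (-(A / 4) * sqSum (addList γ l) n + B ^ 2 / A * boxVol d n)) := by
  classical
  by_cases hw : listWeight φ γ l = 0
  · rw [hw]; exact zero_le
  obtain ⟨hsum, heq⟩ := listWeight_eq hφ hnd (fun x hx => (hl x hx).2) hw
  set ζ := addList γ l with hζ
  have hlζ : ((l.toFinset : Finset (Space d)) : Set (Space d)) ⊆ ζ.pts := fun x hx =>
    mem_addList.2 (Or.inl (by simpa using hx))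
  have hγζ : γ.pts ⊆ ζ.pts := fun x hx => mem_addList.2 (Or.inr hx)
  -- `γ` has no points in the box, so there the list accounts for all occupation numbers of `ζ`.
  have hcount : ∀ r ∈ latticeBox d n,
      cubeCount ((l.toFinset : Finset (Space d)) : Set (Space d)) r = cubeCount ζ.pts r := by
    intro r hr
    unfold cubeCount
    congr 1
    refine Set.Subset.antisymm (Set.inter_subset_inter_left _ hlζ) ?_
    rintro x ⟨hx, hxr⟩
    refine ⟨?_, hxr⟩
    rcases mem_addList.1 hx with h | h
    · simpa using h
    · have hxn : x ∈ bigCube d (n + 1) := mem_bigCube.2 ((mem_cube_iff.1 hxr).symm ▸ hr)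
      exact (Set.eq_empty_iff_forall_notMem.1 h0 x ⟨h, hxn⟩).elim
  have hself := hSS (n + 1) (by omega) l.toFinset fun x hx => (hl x (by simpa using hx)).1
  have hself' : A * sqSum ζ n - B * boxCount ζ (n + 1) ≤
      (1 / 2) * ∑ p ∈ l.toFinset.offDiag, (φ (p.1 - p.2)).toReal := by
    refine le_of_eq_of_le ?_ hself
    rw [boxCount_eq_sum, sqSum, Finset.mul_sum, Finset.mul_sum, ← Finset.sum_sub_distrib]
    exact Finset.sum_congr rfl fun r hr => by rw [hcount r hr]
  have hmut : -(A / 2 * sqSum ζ n) ≤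
      ∑ x ∈ l.toFinset, ∑' y : γ.pts, (φ (x - y)).toReal := by
    have hsum' : ∀ x ∈ l.toFinset, Summable fun y : γ.pts => (φ (x - y)).toReal := fun x hx =>
      Summable.of_abs (hsum x (by simpa using hx))
    rw [← Summable.tsum_finsetSum hsum']
    refine le_tsum_of_le_sum (f := fun y => ∑ x ∈ l.toFinset, (φ (x - y)).toReal)
      (summable_sum hsum') fun t ht => ?_
    rw [Finset.sum_comm]
    obtain ⟨h1, h2⟩ := hLR.interaction_ge hpos (n := n) hlζ (ht.trans hγζ)
      (fun x hx => (hl x (by simpa using hx)).1)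
      (fun y hy hyn => Set.eq_empty_iff_forall_notMem.1 h0 y ⟨ht hy, hyn⟩)
    exact le_trans (neg_le_neg (sum_mul_le_of_outer_le hA hpos hs (hout _ h1))) h2
  -- Of the coefficient `A` from superstability, `A/2` is spent on the exterior and `A/4` on the
  -- linear term, leaving `A/4`.
  have hB := mul_boxCount_le ζ n B (α := A / 4) (by positivity)
  rw [show 4 * (A / 4) = A by ring] at hB
  rw [heq]
  refine ENNReal.ofReal_le_ofReal (Real.exp_le_exp.2 ?_)
  linarith

/-- Superstability for a two-point configuration, with the quadratic term dropped. -/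
theorem SuperstableWith.pair_ge (hφ : IsPairPotential φ) (h : SuperstableWith φ A B) (hA : 0 < A)
    {x y : Space d} (hxy : x ≠ y) (hB : 0 ≤ B) : -(2 * B) ≤ (φ (x - y)).toReal := by
  classical
  obtain ⟨N, hN⟩ := exists_nat_ge (max ‖x‖ ‖y‖ + 1)
  have hx : x ∈ bigCube d (N + 1) := by
    refine mem_bigCube_of_norm_le ?_
    push_cast
    linarith [le_max_left ‖x‖ ‖y‖]
  have hy : y ∈ bigCube d (N + 1) := by
    refine mem_bigCube_of_norm_le ?_
    push_cast
    linarith [le_max_right ‖x‖ ‖y‖]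
  have h1 := h (N + 1) (by omega) {x, y} (by
    intro w hw
    simp only [Finset.coe_insert, Finset.coe_singleton, Set.mem_insert_iff,
      Set.mem_singleton_iff] at hw
    rcases hw with rfl | rfl <;> assumption)
  have h2 : ∑ p ∈ ({x, y} : Finset (Space d)).offDiag, (φ (p.1 - p.2)).toReal =
      2 * (φ (x - y)).toReal := by
    have h3 : ({x, y} : Finset (Space d)).offDiag = {(x, y), (y, x)} := by
      ext ⟨p, q⟩
      simp only [Finset.mem_offDiag, Finset.mem_insert, Finset.mem_singleton, Prod.mk.injEq]
      constructor
      · rintro ⟨rfl | rfl, rfl | rfl, h⟩ <;> simp_all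
      · rintro (⟨rfl, rfl⟩ | ⟨rfl, rfl⟩) <;> simp [hxy, hxy.symm]
    rw [h3, Finset.sum_pair (by simp [hxy])]
    dsimp only
    rw [← neg_sub x y, hφ.even _ (sub_ne_zero.2 hxy)]
    ring
  have hcard : ∑ r ∈ gridBox d (N + 1), (cubeCount (({x, y} : Finset (Space d)) : Set (Space d)) r : ℝ)
      ≤ 2 := by
    have h4 : ∀ r, cubeCount (({x, y} : Finset (Space d)) : Set (Space d)) r =
        (({x, y} : Finset (Space d)).filter fun w => cubeIndex w = r).card := fun r => by
      rw [cubeCount, ← Set.ncard_coe_finset]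
      congr 1
      ext w
      simp [mem_cube_iff]
    simp_rw [h4]
    norm_cast
    rw [← Finset.card_eq_sum_card_fiberwise]
    · exact Finset.card_le_two
    · intro w hw
      simp only [Finset.coe_insert, Finset.coe_singleton, Set.mem_insert_iff,
        Set.mem_singleton_iff] at hw
      rcases hw with rfl | rfl
      · exact mem_bigCube.1 hx
      · exact mem_bigCube.1 hy
  rw [h2, Finset.sum_sub_distrib, ← Finset.mul_sum, ← Finset.mul_sum] at h1
  have h5 : 0 ≤ A * ∑ r ∈ gridBox d (N + 1),
      (cubeCount (({x, y} : Finset (Space d)) : Set (Space d)) r : ℝ) ^ 2 :=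
    mul_nonneg hA.le (Finset.sum_nonneg fun _ _ => sq_nonneg _)
  nlinarith [mul_le_mul_of_nonneg_left hcard hB]

/-- A pointwise bound for the Boltzmann factor. -/
theorem boltzmann_le (hφ : IsPairPotential φ) (hA : 0 < A) (hB : 0 ≤ B)
    (hSS : SuperstableWith φ A B) (hLR : LowerRegularWith φ a) (hpos : ∀ n, 0 < a n) {n : ℕ}
    {γ : Config d} {x : Space d} (hxn : x ∈ bigCube d (n + 1)) (hxγ : x ∉ γ.pts) {K : ℝ}
    (hout : ∀ R : Finset (Fin d → ℤ), Disjoint (latticeBox d n) R →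
      ∑ r ∈ latticeBox d n, ∑ r' ∈ R, a (maxNorm (r - r')) * (cubeCount γ.pts r' : ℝ) ^ 2 ≤ K) :
    boltzmann φ x γ ≤ ENNReal.ofReal (Real.exp (2 * B * boxCount γ (n + 1) + K)) := by
  classical
  by_cases hw : boltzmann φ x γ = 0
  · rw [hw]; exact zero_le
  obtain ⟨hsum, heq⟩ := boltzmann_eq_of_ne_zero hw
  rw [heq]
  refine ENNReal.ofReal_le_ofReal (Real.exp_le_exp.2 (neg_le.1 ?_))
  refine le_tsum_of_le_sum (f := fun y => (φ (x - y)).toReal) hsum.of_abs fun t ht => ?_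
  rw [← Finset.sum_filter_add_sum_filter_not t (fun y => y ∈ bigCube d (n + 1))]
  have h1 : -(2 * B * boxCount γ (n + 1)) ≤
      ∑ y ∈ t.filter (fun y => y ∈ bigCube d (n + 1)), (φ (x - y)).toReal := by
    have hle := Finset.card_nsmul_le_sum (t.filter (fun y => y ∈ bigCube d (n + 1)))
      (fun y => (φ (x - y)).toReal) (-(2 * B)) fun y hy =>
        hSS.pair_ge hφ hA (fun hxy => hxγ (hxy ▸ ht (Finset.mem_filter.1 hy).1)) hB
    refine le_trans ?_ hle
    have hcard : ((t.filter (fun y => y ∈ bigCube d (n + 1))).card : ℝ) ≤ boxCount γ (n + 1) := by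
      unfold boxCount
      rw [← Set.ncard_coe_finset]
      refine Nat.cast_le.2 (Set.ncard_le_ncard (fun y hy => ?_)
        (γ.finite_inter_of_isBounded (isBounded_bigCube _)))
      have := Finset.mem_filter.1 (Finset.mem_coe.1 hy)
      exact ⟨ht this.1, this.2⟩
    rw [nsmul_eq_mul]
    nlinarith
  -- Lower regularity for the one-point configuration `{x}`: the result is dominated by one row of
  -- the double sum that `hout` controls.
  have h2 : -K ≤ ∑ y ∈ t.filter (fun y => y ∉ bigCube d (n + 1)), (φ (x - y)).toReal := by
    set u := t.filter (fun y => y ∉ bigCube d (n + 1)) with hu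
    have hxr : cubeIndex x ∈ latticeBox d n := mem_bigCube.1 hxn
    have hun : ∀ y ∈ u, cubeIndex y ∉ latticeBox d n := fun y hy h =>
      (Finset.mem_filter.1 hy).2 (mem_bigCube.2 h)
    have hdisj : Disjoint (latticeBox d n) (u.image cubeIndex) := by
      rw [Finset.disjoint_right]
      intro r hr
      obtain ⟨y, hy, rfl⟩ := Finset.mem_image.1 hr
      exact hun y hy
    have h3 := hLR {cubeIndex x} (u.image cubeIndex)
      (Finset.disjoint_of_subset_left (Finset.singleton_subset_iff.2 hxr) hdisj) {x} u
      (by simp [mem_cube_cubeIndex])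
      fun y hy => mem_biUnion_cube.2 (Finset.mem_image_of_mem _ hy)
    rw [Finset.sum_singleton, Finset.sum_singleton] at h3
    refine le_trans (neg_le_neg (le_trans ?_ (hout _ hdisj))) h3
    have hut : (u : Set (Space d)) ⊆ γ.pts :=
      fun y hy => ht (Finset.mem_filter.1 (Finset.mem_coe.1 hy)).1
    have hx1 : (cubeCount (({x} : Finset (Space d)) : Set (Space d)) (cubeIndex x) : ℝ) ≤ 1 := by
      rw [cubeCount, Finset.coe_singleton, Nat.cast_le_one, ← Set.ncard_singleton x]
      exact Set.ncard_le_ncard Set.inter_subset_left (Set.finite_singleton x)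
    calc _ ≤ ∑ r' ∈ u.image cubeIndex, a (maxNorm (cubeIndex x - r')) *
          (cubeCount γ.pts r' : ℝ) ^ 2 := by
          refine Finset.sum_le_sum fun r' _ => ?_
          have h4 : (cubeCount (u : Set (Space d)) r' : ℝ) ≤ cubeCount γ.pts r' := by
            exact_mod_cast cubeCount_mono hut r'
          have h5 := (hpos (maxNorm (cubeIndex x - r'))).le
          calc _ ≤ a (maxNorm (cubeIndex x - r')) * 1 * (cubeCount γ.pts r' : ℝ) := by gcongr
            _ ≤ _ := by
              rw [mul_one]
              exact mul_le_mul_of_nonneg_left (cast_le_sq _) h5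
      _ ≤ _ := Finset.single_le_sum (f := fun r => ∑ r' ∈ u.image cubeIndex,
          a (maxNorm (r - r')) * (cubeCount γ.pts r' : ℝ) ^ 2)
          (fun r _ => Finset.sum_nonneg fun r' _ => mul_nonneg (hpos _).le (sq_nonneg _)) hxr
  linarith

/-! ### Moment bounds for superstable potentials -/

/-- The event that the cube `‖r‖ ≤ n` is dense, and almost maximally dense among the larger ones. -/
def denseEvent (d : ℕ) (ε t : ℝ) (n : ℕ) : Set (Config d) :=
  {γ | t * boxVol d n ≤ sqSum γ n ∧
    ∀ k, sqSum γ (n + k) * boxVol d n ≤ (1 + ε) * sqSum γ n * boxVol d (n + k)}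

theorem measurableSet_denseEvent (ε t : ℝ) (n : ℕ) : MeasurableSet (denseEvent d ε t n) :=
  (measurableSet_le measurable_const (measurable_sqSum n)).inter <|
    measurableSet_setOfPred.2 <| Measurable.forall fun k => measurableSet_setOfPred.1 <|
      measurableSet_le ((measurable_sqSum (n + k)).mul_const _)
        (((measurable_sqSum n).const_mul _).mul_const _)

/-- Let `s` be the supremum from an index where `f ≥ t` onwards. If `s ≤ (1 + ε) t` that index
works; otherwise any value above `s / (1 + ε)` exceeds `t`. -/
theorem exists_almost_max {f : ℕ → ℝ} (hf : BddAbove (Set.range f)) {ε t : ℝ} (hε : 0 < ε)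
    (ht : 0 < t) {n₀ : ℕ} (h : ∃ n ≥ n₀, t ≤ f n) :
    ∃ n ≥ n₀, t ≤ f n ∧ ∀ k, f (n + k) ≤ (1 + ε) * f n := by
  obtain ⟨n₁, hn₁, h₁⟩ := h
  have hb : BddAbove (Set.range fun k => f (n₁ + k)) :=
    hf.mono (Set.range_comp_subset_range (fun k => n₁ + k) f)
  set s := ⨆ k, f (n₁ + k) with hs
  have hle : ∀ k, f (n₁ + k) ≤ s := fun k => le_ciSup hb k
  have hts : t ≤ s := h₁.trans (hle 0)
  have hs0 : 0 < s := ht.trans_le hts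
  suffices ∃ k, t ≤ f (n₁ + k) ∧ s ≤ (1 + ε) * f (n₁ + k) by
    obtain ⟨k, hk1, hk2⟩ := this
    refine ⟨n₁ + k, by omega, hk1, fun j => le_trans ?_ hk2⟩
    rw [add_assoc]
    exact hle _
  by_cases hc : s ≤ (1 + ε) * t
  · exact ⟨0, h₁, hc.trans (by gcongr; exact h₁)⟩
  · have hlt : s / (1 + ε) < s := by
      rw [div_lt_iff₀ (by positivity)]
      nlinarith
    obtain ⟨k, hk⟩ := exists_lt_of_lt_ciSup hlt
    rw [div_lt_iff₀ (by positivity)] at hk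
    rw [not_le] at hc
    exact ⟨k, by nlinarith, by linarith⟩

/-- Temperedness serves here to bound the ratios of squared occupation to volume, so that an almost
maximal one exists. -/
theorem exists_mem_denseEvent {γ : Config d}
    (hγ : ∃ n : ℕ, 1 ≤ n ∧ ∀ N : ℕ, 1 ≤ N →
      ∑ r ∈ gridBox d N, cubeCount γ.pts r ^ 2 ≤ n ^ 2 * (gridBox d N).card)
    {ε t : ℝ} (hε : 0 < ε) (ht : 0 < t) (n₀ : ℕ) :
    (∀ n ≥ n₀, sqSum γ n ≤ t * boxVol d n) ∨ ∃ n ≥ n₀, γ ∈ denseEvent d ε t n := by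
  obtain ⟨m, -, hm⟩ := hγ
  have hbd : BddAbove (Set.range fun n => sqSum γ n / boxVol d n) := by
    refine ⟨(m : ℝ) ^ 2, ?_⟩
    rintro _ ⟨n, rfl⟩
    dsimp only
    rw [div_le_iff₀ (boxVol_pos n), ← card_latticeBox, sqSum]
    exact_mod_cast hm (n + 1) (by omega)
  by_cases h : ∃ n ≥ n₀, t ≤ sqSum γ n / boxVol d n
  · obtain ⟨n, hn, h1, h2⟩ := exists_almost_max hbd hε ht h
    refine Or.inr ⟨n, hn, (le_div_iff₀ (boxVol_pos n)).1 h1, fun k => ?_⟩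
    have h3 := h2 k
    have hv := boxVol_pos (d := d) n
    rw [div_le_iff₀ (boxVol_pos _), ← mul_div_assoc, div_mul_eq_mul_div, le_div_iff₀ hv] at h3
    exact h3
  · push Not at h
    refine Or.inl fun n hn => ?_
    have h1 := h n hn
    rw [div_lt_iff₀ (boxVol_pos n)] at h1
    exact h1.le

theorem self_le_boxVol [Nonempty (Fin d)] (n : ℕ) : (n : ℝ) ≤ boxVol d n := by
  have hd : d ≠ 0 := fun h => by subst h; exact isEmptyElim (Classical.arbitrary (Fin 0))
  have h1 : (1 : ℝ) ≤ 2 * n + 1 := by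
    have : (0 : ℝ) ≤ n := Nat.cast_nonneg n
    linarith
  calc (n : ℝ) ≤ 2 * n + 1 := by linarith
    _ ≤ _ := le_self_pow₀ h1 hd

/-- The expectation of `exp((A / 8) ∑ |γ_r|²)` on the event that a cube is dense. -/
theorem lintegral_denseEvent_le [Nonempty (Fin d)] (hz : 0 < z) (hφ : IsPairPotential φ)
    (hμ : IsGibbs φ z μ) (hA : 0 < A) (hSS : SuperstableWith φ A B) (hLR : LowerRegularWith φ a)
    (hpos : ∀ n, 0 < a n) (hs : Summable fun r : Fin d → ℤ => a (maxNorm r)) {ε t : ℝ} {n : ℕ}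
    (hout : ∀ γ ∈ denseEvent d ε t n, ∀ R : Finset (Fin d → ℤ), Disjoint (latticeBox d n) R →
      ∑ r ∈ latticeBox d n, ∑ r' ∈ R, a (maxNorm (r - r')) * (cubeCount γ.pts r' : ℝ) ^ 2 ≤
      A ^ 2 / (4 * ∑' r : Fin d → ℤ, a (maxNorm r)) * sqSum γ n)
    (ht : z + B ^ 2 / A + 1 ≤ A / 8 * t) :
    ∫⁻ γ, (denseEvent d ε t n).indicator
      (fun γ => ENNReal.ofReal (Real.exp (A / 8 * sqSum γ n))) γ ∂μ ≤
        ENNReal.ofReal (Real.exp (-1) ^ n) := by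
  have hv := boxVol_pos (d := d) n
  -- The weight `exp((A/8) sqSum)` uses half of the decay `-(A/4) sqSum`; on the event the other
  -- half is at most `-(A/8) t` times the volume. By `ht` this also absorbs the factor `exp(z *
  -- volume)`.
  refine (lintegral_le_of_listWeight (D := Real.exp ((B ^ 2 / A - A / 8 * t) * boxVol d n))
    hz hφ.measurable hμ (measurableSet_bigCube (n + 1)) (isBounded_bigCube _) hv.le ?_
    (Measurable.indicator ?_ (measurableSet_denseEvent ε t n)) ?_).trans ?_
  · rw [volume_bigCube, ← card_latticeBox, ENNReal.ofReal_natCast]; rfl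
  · exact ENNReal.measurable_ofReal.comp
      (Real.measurable_exp.comp ((measurable_sqSum n).const_mul _))
  · intro γ l hnd hl h0
    by_cases hmem : addList γ l ∈ denseEvent d ε t n
    · rw [Set.indicator_of_mem hmem]
      refine (mul_le_mul_left (listWeight_le hφ hA hSS hLR hpos hs hnd hl h0 (hout _ hmem)) _).trans ?_
      rw [← ENNReal.ofReal_mul (Real.exp_pos _).le, ← Real.exp_add]
      refine ENNReal.ofReal_le_ofReal (Real.exp_le_exp.2 ?_)
      have h1 := hmem.1
      nlinarith
    · rw [Set.indicator_of_notMem hmem, mul_zero]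
      exact zero_le
  · rw [← Real.exp_add, ← Real.exp_nat_mul]
    refine ENNReal.ofReal_le_ofReal (Real.exp_le_exp.2 ?_)
    have h1 := self_le_boxVol (d := d) n
    nlinarith

/-- The majorant is a constant, for configurations sparse at all scales beyond `n₀`, plus a multiple
of the sum over `n ≥ n₀` of `exp((A/8) sqSum)` on the dense events; its expectation is dominated by
a geometric series. -/
theorem hasMomentBounds_of_superstableWith [Nonempty (Fin d)] (hz : 0 < z)
    (hφ : IsPairPotential φ) (hμ : IsGibbs φ z μ) (hA : 0 < A) (hB : 0 ≤ B)
    (hSS : SuperstableWith φ A B) (ha : Antitone a) (hpos : ∀ n, 0 < a n)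
    (hs : Summable fun r : Fin d → ℤ => a (maxNorm r)) (hLR : LowerRegularWith φ a)
    (htemp : IsTempered μ) : HasMomentBounds φ μ := by
  have := hμ.1
  intro N
  set Θ := ∑' r : Fin d → ℤ, a (maxNorm r) with hΘ
  have hΘ0 : 0 < Θ := hs.tsum_pos (fun r => (hpos _).le) 0 (hpos _)
  -- `A ^ 2 / (4 * Θ)` is what the density bound requires of the exterior; `A / 32` is what the
  -- Boltzmann factor bound requires.
  obtain ⟨ε, hε, n₁, hn₁⟩ := exists_sum_outer_le ha hpos hs
    (δ := min (A ^ 2 / (4 * Θ)) (A / 32)) (by positivity)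
  set n₀ := max n₁ N with hn₀
  -- The first term gives the decay `e⁻ⁿ` on dense events; the second absorbs the volume term in the
  -- estimate of `2 * B * boxCount`.
  set t := 8 / A * (z + B ^ 2 / A + 1) + 4096 * B ^ 2 / A ^ 2 with ht
  have ht0 : 0 < t := by positivity
  have ht1 : z + B ^ 2 / A + 1 ≤ A / 8 * t := by
    have : A / 8 * t = z + B ^ 2 / A + 1 + A / 8 * (4096 * B ^ 2 / A ^ 2) := by
      rw [ht]; field_simp
    rw [this]
    exact le_add_of_nonneg_right (by positivity)
  have ht2 : 4096 * B ^ 2 / A ^ 2 ≤ t := le_add_of_nonneg_left (by positivity)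
  have hout : ∀ n ≥ n₁, ∀ γ ∈ denseEvent d ε t n, ∀ R : Finset (Fin d → ℤ),
      Disjoint (latticeBox d n) R →
      ∑ r ∈ latticeBox d n, ∑ r' ∈ R, a (maxNorm (r - r')) * (cubeCount γ.pts r' : ℝ) ^ 2 ≤
      min (A ^ 2 / (4 * Θ)) (A / 32) * sqSum γ n := fun n hn γ hγ R hR =>
    hn₁ n hn (fun r => (cubeCount γ.pts r : ℝ) ^ 2) (fun r => sq_nonneg _) hγ.2 R hR
  obtain ⟨C, hC⟩ := exists_sum_outer_bound ha hpos hs n₀ (t := t)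
  set G : ℕ → Config d → ℝ≥0∞ := fun n => (denseEvent d ε t n).indicator
    (fun γ => ENNReal.ofReal (Real.exp (A / 8 * sqSum γ n))) with hG
  have hGm : ∀ n, Measurable (G n) := fun n => Measurable.indicator
    (ENNReal.measurable_ofReal.comp (Real.measurable_exp.comp ((measurable_sqSum n).const_mul _)))
    (measurableSet_denseEvent ε t n)
  have hGi : ∀ n ≥ n₁, ∫⁻ γ, G n γ ∂μ ≤ ENNReal.ofReal (Real.exp (-1) ^ n) := fun n hn =>
    lintegral_denseEvent_le hz hφ hμ hA hSS hLR hpos hs (fun γ hγ R hR =>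
      (hout n hn γ hγ R hR).trans
        (mul_le_mul_of_nonneg_right (min_le_left _ _) (sqSum_nonneg _ _))) ht1
  -- `c₀` covers both quantities in the sparse case. In `c₁`, the `1` serves the Boltzmann factor
  -- and `2 (8/A)²` the squared count, through `u² / 2! ≤ exp u` with `u = (A/8) sqSum`.
  set c₀ : ℝ := Real.exp (2 * B * (t * boxVol d n₀) + C) ^ 2 + (t * boxVol d n₀) ^ 2 with hc₀
  set c₁ : ℝ := 1 + 2 * (8 / A) ^ 2 with hc₁
  refine ⟨fun γ => ENNReal.ofReal c₀ + ENNReal.ofReal c₁ * ∑' k, G (n₀ + k) γ,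
    measurable_const.add ((Measurable.tsum fun k => hGm _).const_mul _), ?_, ?_⟩
  · rw [lintegral_add_left measurable_const,
      lintegral_const_mul _ (Measurable.tsum fun k => hGm _),
      lintegral_tsum fun k => (hGm _).aemeasurable, lintegral_const, measure_univ, mul_one]
    refine ENNReal.add_ne_top.2 ⟨ENNReal.ofReal_ne_top,
      ENNReal.mul_ne_top ENNReal.ofReal_ne_top ?_⟩
    have hgeo : Summable fun k : ℕ => Real.exp (-1) ^ (n₀ + k) := by
      simp_rw [pow_add]
      exact (summable_geometric_of_lt_one (Real.exp_pos _).le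
        (Real.exp_lt_one_iff.2 (by norm_num))).mul_left _
    have hle : ∑' k, ∫⁻ γ, G (n₀ + k) γ ∂μ ≤ ENNReal.ofReal (∑' k, Real.exp (-1) ^ (n₀ + k)) := by
      rw [ENNReal.ofReal_tsum_of_nonneg (fun k => by positivity) hgeo]
      exact ENNReal.tsum_le_tsum fun k =>
        hGi _ ((le_max_left n₁ N).trans (Nat.le_add_right _ k))
    exact (hle.trans_lt ENNReal.ofReal_lt_top).ne
  · filter_upwards [htemp] with γ hγ
    rcases exists_mem_denseEvent hγ hε ht0 n₀ with h | ⟨n, hn, h⟩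
    · have hcount : boxCount γ (n₀ + 1) ≤ t * boxVol d n₀ :=
        (boxCount_le_sqSum γ n₀).trans (h n₀ le_rfl)
      refine ⟨fun x hx hxγ => le_add_right ?_, le_add_right ?_⟩
      · have h1 := boltzmann_le hφ hA hB hSS hLR hpos (n := n₀) (K := C)
          (bigCube_mono (by omega) hx) hxγ fun R hR => hC (fun r => (cubeCount γ.pts r : ℝ) ^ 2)
            (fun r => sq_nonneg _) (fun k => h (n₀ + k) (by omega)) R hR
        calc _ ≤ ENNReal.ofReal (Real.exp (2 * B * boxCount γ (n₀ + 1) + C)) ^ 2 := by gcongr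
          _ ≤ ENNReal.ofReal (Real.exp (2 * B * (t * boxVol d n₀) + C)) ^ 2 := by gcongr
          _ ≤ _ := by
            rw [← ENNReal.ofReal_pow (Real.exp_pos _).le]
            exact ENNReal.ofReal_le_ofReal (le_add_of_nonneg_right (by positivity))
      · rw [← ENNReal.ofReal_pow (boxCount_nonneg _ _)]
        refine ENNReal.ofReal_le_ofReal ?_
        have h1 := (boxCount_mono γ (by omega : N ≤ n₀ + 1)).trans hcount
        have h2 := boxCount_nonneg γ N
        have h3 : boxCount γ N ^ 2 ≤ (t * boxVol d n₀) ^ 2 := by gcongr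
        exact h3.trans (le_add_of_nonneg_left (by positivity))
    · have hnN : N ≤ n + 1 := by omega
      have hS := sqSum_nonneg γ n
      have hGn : ENNReal.ofReal (c₁ * Real.exp (A / 8 * sqSum γ n)) ≤
          ENNReal.ofReal c₁ * ∑' k, G (n₀ + k) γ := by
        rw [ENNReal.ofReal_mul (by positivity)]
        gcongr
        have h1 : G (n₀ + (n - n₀)) γ = ENNReal.ofReal (Real.exp (A / 8 * sqSum γ n)) := by
          rw [Nat.add_sub_of_le hn, hG]
          exact Set.indicator_of_mem h _
        rw [← h1]
        exact ENNReal.le_tsum _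
      refine ⟨fun x hx hxγ => le_add_left (le_trans ?_ hGn), le_add_left (le_trans ?_ hGn)⟩
      · have h1 := boltzmann_le hφ hA hB hSS hLR hpos (n := n) (K := A / 32 * sqSum γ n)
          (bigCube_mono hnN hx) hxγ fun R hR =>
            (hout n ((le_max_left n₁ N).trans hn) γ h R hR).trans
              (mul_le_mul_of_nonneg_right (min_le_right _ _) hS)
        -- The count term is at most `(A/64 + A/64) sqSum` and the exterior adds `(A/32) sqSum`. The
        -- total `A/16` becomes, after squaring, the exponent `A/8` of `G`.
        have h2 := mul_boxCount_le γ n (2 * B) (α := A / 64) (by positivity)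
        have h3 : (2 * B) ^ 2 / (4 * (A / 64)) * boxVol d n ≤ A / 64 * sqSum γ n := by
          calc _ = A / 64 * (4096 * B ^ 2 / A ^ 2 * boxVol d n) := by field_simp; ring
            _ ≤ A / 64 * (t * boxVol d n) := by
              have := (boxVol_pos (d := d) n).le
              gcongr
            _ ≤ _ := by
              have := h.1
              gcongr
        calc _ ≤ ENNReal.ofReal (Real.exp (2 * B * boxCount γ (n + 1) + A / 32 * sqSum γ n)) ^ 2 := by
              gcongr
          _ ≤ ENNReal.ofReal (Real.exp (A / 16 * sqSum γ n)) ^ 2 := by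
              gcongr
              linarith
          _ = ENNReal.ofReal (1 * Real.exp (A / 8 * sqSum γ n)) := by
              rw [← ENNReal.ofReal_pow (Real.exp_pos _).le, ← Real.exp_nat_mul, one_mul]
              congr 2
              push_cast
              ring
          _ ≤ _ := by
              refine ENNReal.ofReal_le_ofReal (mul_le_mul_of_nonneg_right ?_ (Real.exp_pos _).le)
              exact le_add_of_nonneg_right (by positivity)
      · rw [← ENNReal.ofReal_pow (boxCount_nonneg _ _)]
        refine ENNReal.ofReal_le_ofReal ?_
        have h1 := (boxCount_mono γ hnN).trans (boxCount_le_sqSum γ n)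
        have h2 := boxCount_nonneg γ N
        have h3 := Real.pow_div_factorial_le_exp (A / 8 * sqSum γ n) (by positivity) 2
        calc boxCount γ N ^ 2 ≤ sqSum γ n ^ 2 := by gcongr
          _ = 2 * (8 / A) ^ 2 * ((A / 8 * sqSum γ n) ^ 2 / (Nat.factorial 2 : ℝ)) := by
              simp only [Nat.factorial]
              push_cast
              field_simp
          _ ≤ 2 * (8 / A) ^ 2 * Real.exp (A / 8 * sqSum γ n) := by gcongr
          _ ≤ _ := mul_le_mul_of_nonneg_right (by rw [hc₁]; linarith) (Real.exp_pos _).le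

/-- Moment bounds for tempered Gibbs measures of superstable, lower regular potentials. -/
theorem hasMomentBounds_of_superstable [Nonempty (Fin d)] (hz : 0 < z)
    (hφ : IsPairPotential φ) (hμ : IsGibbs φ z μ) (hSS : Superstable φ) (hLR : LowerRegular φ)
    (htemp : IsTempered μ) : HasMomentBounds φ μ := by
  obtain ⟨A, B, hA, hB, hSS⟩ := hSS
  obtain ⟨a, ha, hpos, hs, hLR⟩ := hLR
  exact hasMomentBounds_of_superstableWith hz hφ hμ hA hB hSS ha hpos hs hLR htemp

/-! ### Contractions -/

namespace PartialForm

variable {V K : Type*} [NormedAddCommGroup V] [InnerProductSpace ℝ V]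
  [NormedAddCommGroup K] [InnerProductSpace ℝ K] {j : K →L[ℝ] V}
  (hj : Function.Injective j)

theorem tendsto_ofEmbedding_form {u : ℕ → (ofEmbedding j hj).domain}
    {x : (ofEmbedding j hj).domain} (hu : Tendsto (fun n => (u n : V)) atTop (𝓝 (x : V)))
    (hE : Tendsto (fun n => (ofEmbedding j hj).form (u n - x) (u n - x)) atTop (𝓝 0)) :
    Tendsto (fun n => (ofEmbedding j hj).form (u n) (u n)) atTop
      (𝓝 ((ofEmbedding j hj).form x x)) := by
  have h1 : Tendsto (fun n => ‖(u n : V) - x‖ ^ 2) atTop (𝓝 0) := by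
    have := ((tendsto_iff_norm_sub_tendsto_zero).1 hu).pow 2
    rwa [zero_pow two_ne_zero] at this
  have h2 : Tendsto (fun n => ‖preimage hj (u n) - preimage hj x‖ ^ 2) atTop (𝓝 0) := by
    have := hE.add h1
    rw [add_zero] at this
    refine this.congr fun n => ?_
    rw [ofEmbedding_form_self, map_sub, Submodule.coe_sub, sub_add_cancel]
  have h3 : Tendsto (fun n => preimage hj (u n)) atTop (𝓝 (preimage hj x)) := by
    rw [tendsto_iff_norm_sub_tendsto_zero]
    have := h2.sqrt
    simpa only [Real.sqrt_sq (norm_nonneg _), Real.sqrt_zero] using this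
  simp_rw [ofEmbedding_form_self]
  exact (h3.norm.pow 2).sub (hu.norm.pow 2)

/-- A continuous map which decreases the form on a core decreases the closed form. -/
theorem contraction_of_core [CompleteSpace V] [CompleteSpace K] {E₀ : PartialForm V} (hE : (ofEmbedding j hj).IsClosureOf E₀)
    {T : V → V} (hT : Continuous T)
    (h : ∀ u : E₀.domain, ∃ hu : T u ∈ (ofEmbedding j hj).domain,
      (ofEmbedding j hj).form ⟨T u, hu⟩ ⟨T u, hu⟩ ≤ E₀.form u u)
    (x : (ofEmbedding j hj).domain) : ∃ hx : T x ∈ (ofEmbedding j hj).domain,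
      (ofEmbedding j hj).form ⟨T x, hx⟩ ⟨T x, hx⟩ ≤ (ofEmbedding j hj).form x x := by
  obtain ⟨u, hu, hux, hEx⟩ := hE.core x
  choose hTu hle using fun n => h ⟨u n, hu n⟩
  obtain ⟨hinc, hext⟩ := hE.extends_form
  refine ofEmbedding_lsc hj (v := fun n => ⟨T (u n), hTu n⟩)
    (c := fun n => (ofEmbedding j hj).form (u n) (u n)) ((hT.tendsto _).comp hux)
    (fun n => (hle n).trans_eq ?_) (tendsto_ofEmbedding_form hj hux hEx)
  exact (hext ⟨u n, hu n⟩ ⟨u n, hu n⟩).symm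

end PartialForm

/-- A contraction of the real line is a uniform limit of smooth contractions. -/
theorem exists_smooth_contraction {T : ℝ → ℝ} (hT : LipschitzWith 1 T) {ε : ℝ} (hε : 0 < ε) :
    ∃ S : ℝ → ℝ, ContDiff ℝ ∞ S ∧ (∀ x y, |S x - S y| ≤ |x - y|) ∧ ∀ x, |S x - T x| ≤ ε := by
  -- Averaging translates of `T` against a probability density preserves the contraction property,
  -- and support in radius `ε` keeps the error at most `ε`.
  let b : ContDiffBump (0 : ℝ) := ⟨ε / 2, ε, by positivity, by linarith⟩
  have hTd : ∀ x y, |T x - T y| ≤ |x - y| := fun x y => by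
    simpa [Real.dist_eq] using hT.dist_le_mul x y
  set L : ℝ →L[ℝ] ℝ →L[ℝ] ℝ := ContinuousLinearMap.lsmul ℝ ℝ with hL
  have hcs : HasCompactSupport (b.normed volume) := b.hasCompactSupport_normed
  have hloc : LocallyIntegrable T := hT.continuous.locallyIntegrable
  have hex : ConvolutionExists (b.normed volume) T L volume :=
    hcs.convolutionExists_left _ b.continuous_normed hloc
  refine ⟨convolution (b.normed volume) T L volume,
    hcs.contDiff_convolution_left L b.contDiff_normed hloc,
    fun x y => ?_, fun x => ?_⟩
  · rw [convolution, convolution, ← integral_sub (hex x) (hex y)]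
    calc ‖∫ t, (L (b.normed volume t) (T (x - t)) - L (b.normed volume t) (T (y - t)))‖
        ≤ ∫ t, b.normed volume t * |x - y| := by
          refine norm_integral_le_of_norm_le
            ((b.integrable_normed (μ := volume)).mul_const _) (ae_of_all _ fun t => ?_)
          simp only [hL, ContinuousLinearMap.lsmul_apply, smul_eq_mul]
          rw [← mul_sub, norm_mul, Real.norm_of_nonneg (b.nonneg_normed t)]
          refine mul_le_mul_of_nonneg_left ?_ (b.nonneg_normed t)
          have := hTd (x - t) (y - t)
          rwa [sub_sub_sub_cancel_right] at this
      _ = |x - y| := by rw [integral_mul_const, b.integral_normed, one_mul]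
  · refine b.dist_normed_convolution_le hT.continuous.aestronglyMeasurable fun y hy => ?_
    rw [Real.dist_eq]
    refine (hTd y x).trans ?_
    rw [Metric.mem_ball, Real.dist_eq] at hy
    exact hy.le

/-! ### The generator as an operator in `L²` -/

theorem energy_comm (μ : Measure (Config d)) (F G : Config d → ℝ) :
    energy μ F G = energy μ G F := by
  simp only [energy, carre, mul_comm]

theorem energy_self_nonneg (μ : Measure (Config d)) (F : Config d → ℝ) : 0 ≤ energy μ F F :=
  integral_nonneg fun _ => tsum_nonneg fun _ => mul_self_nonneg _

/-- Contractions decrease the energy. -/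
theorem energy_comp_le [IsFiniteMeasure μ] (h : HasMomentBounds φ μ) {F : Config d → ℝ}
    (hF : F ∈ cylinderFunctions d) {S : ℝ → ℝ} (hS : ContDiff ℝ ∞ S)
    (hS1 : ∀ x y, |S x - S y| ≤ |x - y|) :
    energy μ (fun γ => S (F γ)) (fun γ => S (F γ)) ≤ energy μ F F := by
  have hSF := cylinder_comp hF hS
  refine integral_mono (integrable_carre h hSF hSF) (integrable_carre h hF hF) fun γ => ?_
  have hsum : ∀ {G : Config d → ℝ}, G ∈ cylinderFunctions d →
      Summable fun x : γ.pts => dMinus G γ x * dMinus G γ x := fun {G} hG => by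
    obtain ⟨N, c, -, -, hb⟩ := exists_difference_bounds hG
    exact summable_of_bigCube γ (f := fun x => dMinus G γ x * dMinus G γ x) (N := N)
      fun x hx => by rw [((hb γ x).2.2 hx).1, zero_mul]
  exact (hsum hSF).tsum_le_tsum (fun x => abs_le_iff_mul_self_le.1 (hS1 _ _)) (hsum hF)

theorem integral_generator_mul_comm [Nonempty (Fin d)] (hz : 0 < z) (hφ : Measurable φ)
    (hμ : IsGibbs φ z μ) (h : HasMomentBounds φ μ) {F G : Config d → ℝ}
    (hF : F ∈ cylinderFunctions d) (hG : G ∈ cylinderFunctions d) :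
    ∫ γ, generator φ z F γ * G γ ∂μ = ∫ γ, generator φ z G γ * F γ ∂μ := by
  rw [← energy_eq_integral_generator hz hφ hμ h hF hG, energy_comm,
    energy_eq_integral_generator hz hφ hμ h hG hF]

theorem exists_cylinder (u : cylinderSubmodule μ) :
    ∃ F ∈ cylinderFunctions d, ((u : Lp ℝ 2 μ) : Config d → ℝ) =ᵐ[μ] F := u.2

/-- The class of `HF`, for a cylinder function `F` in the class of `u`. -/
def generatorClass [Nonempty (Fin d)] (hz : 0 < z) (hφ : Measurable φ) (h : HasMomentBounds φ μ)
    (u : cylinderSubmodule μ) : Lp ℝ 2 μ :=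
  (generator_memLp hz hφ h (exists_cylinder u).choose_spec.1).toLp _

theorem inner_generator [Nonempty (Fin d)] (hz : 0 < z) (hφ : Measurable φ) (hμ : IsGibbs φ z μ)
    (h : HasMomentBounds φ μ) {F : Config d → ℝ} (hF : F ∈ cylinderFunctions d) {u w : Lp ℝ 2 μ}
    (hu : (u : Config d → ℝ) =ᵐ[μ] F) (hw : (w : Config d → ℝ) =ᵐ[μ] generator φ z F)
    (v : cylinderSubmodule μ) :
    inner ℝ w (v : Lp ℝ 2 μ) = inner ℝ u (generatorClass hz hφ h v) := by
  obtain ⟨hG, hv⟩ := (exists_cylinder v).choose_spec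
  rw [inner_eq_of_ae hw hv, integral_generator_mul_comm hz hφ hμ h hF hG,
    inner_eq_of_ae hu (v := generatorClass hz hφ h v)
      (generator_memLp hz hφ h hG).coeFn_toLp]
  simp only [mul_comm]

theorem generatorClass_symm [Nonempty (Fin d)] (hz : 0 < z) (hφ : Measurable φ)
    (hμ : IsGibbs φ z μ) (h : HasMomentBounds φ μ) (u v : cylinderSubmodule μ) :
    inner ℝ (generatorClass hz hφ h u) (v : Lp ℝ 2 μ) =
      inner ℝ (u : Lp ℝ 2 μ) (generatorClass hz hφ h v) :=
  inner_generator hz hφ hμ h (exists_cylinder u).choose_spec.1 (exists_cylinder u).choose_spec.2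
    (generator_memLp hz hφ h (exists_cylinder u).choose_spec.1).coeFn_toLp v

/-- A vector is determined by its pairings with the dense cylinder classes, and symmetry moves `H`
onto the test vector. Independence of the representative and linearity both follow, without a
pointwise comparison. -/
theorem eq_generatorClass [Nonempty (Fin d)] (hz : 0 < z) (hφ : Measurable φ)
    (hμ : IsGibbs φ z μ) (h : HasMomentBounds φ μ) {u : cylinderSubmodule μ} {w : Lp ℝ 2 μ}
    (hw : ∀ v : cylinderSubmodule μ, inner ℝ w (v : Lp ℝ 2 μ) =
      inner ℝ (u : Lp ℝ 2 μ) (generatorClass hz hφ h v)) : generatorClass hz hφ h u = w := by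
  have := hμ.1
  refine (dense_cylinderSubmodule μ).eq_of_inner_left ℝ fun v hv => ?_
  exact (generatorClass_symm hz hφ hμ h u ⟨v, hv⟩).trans (hw ⟨v, hv⟩).symm

/-- The operator `H` on the classes of cylinder functions. -/
def generatorOperator [Nonempty (Fin d)] (hz : 0 < z) (hφ : Measurable φ) (hμ : IsGibbs φ z μ)
    (h : HasMomentBounds φ μ) : Lp ℝ 2 μ →ₗ.[ℝ] Lp ℝ 2 μ where
  domain := cylinderSubmodule μ
  toFun :=
    { toFun := generatorClass hz hφ h
      map_add' := fun u v => eq_generatorClass hz hφ hμ h fun w => by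
        rw [inner_add_left, generatorClass_symm hz hφ hμ h, generatorClass_symm hz hφ hμ h,
          Submodule.coe_add, inner_add_left]
      map_smul' := fun c u => eq_generatorClass hz hφ hμ h fun w => by
        rw [RingHom.id_apply, real_inner_smul_left, generatorClass_symm hz hφ hμ h,
          Submodule.coe_smul, real_inner_smul_left] }

theorem isCylinderOperator_generatorOperator [Nonempty (Fin d)] (hz : 0 < z) (hφ : Measurable φ)
    (hμ : IsGibbs φ z μ) (h : HasMomentBounds φ μ) :
    IsCylinderOperator φ z μ (generatorOperator hz hφ hμ h) := by
  refine ⟨fun u => Iff.rfl, fun u F hF hu => ?_⟩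
  have hw := (generator_memLp hz hφ h hF).coeFn_toLp
  have := eq_generatorClass hz hφ hμ h (u := u) (inner_generator hz hφ hμ h hF hu hw)
  exact (Lp.ext_iff.1 this).trans hw

theorem isCylinderForm_generatorOperator [Nonempty (Fin d)] (hz : 0 < z) (hφ : Measurable φ)
    (hμ : IsGibbs φ z μ) (h : HasMomentBounds φ μ) :
    IsCylinderForm μ (PartialForm.ofOperator (generatorOperator hz hφ hμ h)) := by
  refine ⟨fun u => Iff.rfl, fun u v F hF G hG hu hv => ?_⟩
  rw [energy_eq_integral_generator hz hφ hμ h hF hG]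
  exact inner_eq_of_ae ((isCylinderOperator_generatorOperator hz hφ hμ h).2 u F hF hu) hv

theorem isNonnegSymm_generatorOperator [Nonempty (Fin d)] (hz : 0 < z) (hφ : Measurable φ)
    (hμ : IsGibbs φ z μ) (h : HasMomentBounds φ μ) :
    PartialForm.IsNonnegSymm (generatorOperator hz hφ hμ h) where
  symm u v := generatorClass_symm hz hφ hμ h u v
  nonneg u := by
    obtain ⟨F, hF, hu⟩ := u.2
    have := (isCylinderForm_generatorOperator hz hφ hμ h).2 u u F hF F hF hu hu
    exact (energy_self_nonneg μ F).trans_eq this.symm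

/-! ### The Dirichlet form -/

/-- The map `x ↦ (0 ∨ x) ∧ 1`. -/
def unitClamp (x : ℝ) : ℝ := min (max 0 x) 1

theorem lipschitzWith_unitClamp : LipschitzWith 1 unitClamp :=
  (LipschitzWith.id.const_max 0).min_const 1

theorem unitClamp_zero : unitClamp 0 = 0 := by simp [unitClamp]

/-- The image of a cylinder function under a contraction belongs to the domain of the closed form. -/
theorem contraction_of_cylinder [Nonempty (Fin d)] (hz : 0 < z) (hφ : Measurable φ)
    (hμ : IsGibbs φ z μ) (h : HasMomentBounds φ μ) {T : ℝ → ℝ} (hT : LipschitzWith 1 T)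
    (hT0 : T 0 = 0) {K : Type*} [NormedAddCommGroup K] [InnerProductSpace ℝ K] [CompleteSpace K]
    {j : K →L[ℝ] Lp ℝ 2 μ} (hj : Function.Injective j)
    (hE : (PartialForm.ofEmbedding j hj).IsClosureOf
      (PartialForm.ofOperator (generatorOperator hz hφ hμ h)))
    (u : (PartialForm.ofOperator (generatorOperator hz hφ hμ h)).domain) :
    ∃ hu : hT.compLp hT0 (u : Lp ℝ 2 μ) ∈ (PartialForm.ofEmbedding j hj).domain,
      (PartialForm.ofEmbedding j hj).form ⟨_, hu⟩ ⟨_, hu⟩ ≤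
        (PartialForm.ofOperator (generatorOperator hz hφ hμ h)).form u u := by
  have := hμ.1
  obtain ⟨F, hF, huF⟩ := u.2
  -- The compositions `S n ∘ F` are cylinder functions converging uniformly to `T ∘ F`, and their
  -- energies never exceed that of `F`, so lower semicontinuity applies with a constant bound.
  choose S hS hS1 hST using fun n : ℕ =>
    exists_smooth_contraction hT (Nat.one_div_pos_of_nat (α := ℝ) (n := n))
  have hSF : ∀ n, (fun γ => S n (F γ)) ∈ cylinderFunctions d := fun n => cylinder_comp hF (hS n)
  set v : ℕ → Lp ℝ 2 μ := fun n => (cylinder_memLp (μ := μ) (hSF n) 2).toLp _ with hv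
  have hvF : ∀ n, (v n : Config d → ℝ) =ᵐ[μ] fun γ => S n (F γ) := fun n =>
    (cylinder_memLp (hSF n) 2).coeFn_toLp
  have hform := (isCylinderForm_generatorOperator hz hφ hμ h).2
  obtain ⟨hinc, hext⟩ := hE.extends_form
  refine PartialForm.ofEmbedding_lsc hj
    (v := fun n => ⟨v n, hinc ⟨_, hSF n, hvF n⟩⟩) ?_ (fun n => ?_) tendsto_const_nhds
  · rw [tendsto_iff_norm_sub_tendsto_zero]
    refine squeeze_zero (fun _ => norm_nonneg _) (fun n => ?_)
      (tendsto_one_div_add_atTop_nhds_zero_nat (𝕜 := ℝ))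
    refine (Lp.norm_le_of_ae_bound (C := 1 / ((n : ℝ) + 1)) (by positivity) ?_).trans_eq ?_
    · filter_upwards [Lp.coeFn_sub (v n) (hT.compLp hT0 (u : Lp ℝ 2 μ)), hvF n,
        hT.coeFn_compLp hT0 (u : Lp ℝ 2 μ), huF] with γ h1 h2 h3 h4
      rw [h1, Pi.sub_apply, h2, h3, Function.comp_apply, h4]
      exact hST n (F γ)
    · simp [measureUnivNNReal]
  · have h1 := hext ⟨v n, _, hSF n, hvF n⟩ ⟨v n, _, hSF n, hvF n⟩
    refine h1.le.trans ?_
    rw [hform ⟨v n, _, hSF n, hvF n⟩ ⟨v n, _, hSF n, hvF n⟩ _ (hSF n) _ (hSF n) (hvF n) (hvF n),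
      hform u u F hF F hF huF huF]
    exact energy_comp_le h hF (hS n) (hS1 n)

theorem isDirichletForm_closure [Nonempty (Fin d)] (hz : 0 < z) (hφ : Measurable φ)
    (hμ : IsGibbs φ z μ) (h : HasMomentBounds φ μ) {K : Type*} [NormedAddCommGroup K]
    [InnerProductSpace ℝ K] [CompleteSpace K] {j : K →L[ℝ] Lp ℝ 2 μ} (hj : Function.Injective j)
    (hE : (PartialForm.ofEmbedding j hj).IsClosureOf
      (PartialForm.ofOperator (generatorOperator hz hφ hμ h))) :
    (PartialForm.ofEmbedding j hj).IsDirichletForm where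
  dense := by
    have := hμ.1
    exact (dense_cylinderSubmodule μ).mono hE.extends_form.1
  isSymmClosed := hE.isSymmClosed
  unit_contraction u := by
    obtain ⟨hu, hle⟩ := PartialForm.contraction_of_core hj hE
      (lipschitzWith_unitClamp.continuous_compLp unitClamp_zero)
      (contraction_of_cylinder hz hφ hμ h lipschitzWith_unitClamp unitClamp_zero hj hE) u
    exact ⟨⟨_, hu⟩, lipschitzWith_unitClamp.coeFn_compLp unitClamp_zero _, hle⟩

end Glauber

end

theorem proposition3p1 (d : ℕ) (hd : 1 ≤ d) (φ : Glauber.Space d → EReal)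
    (hφ : Glauber.IsPairPotential φ) (z : ℝ) (hz : 0 < z) (μ : Measure (Glauber.Config d))
    (hμ : Glauber.IsGibbs φ z μ)
    (hcond : (Glauber.PotentialIntegrable φ ∧ Glauber.Superstable φ ∧ Glauber.LowerRegular φ ∧
        Glauber.IsTempered μ) ∨
      (Glauber.PotentialPositive φ ∧ Glauber.PotentialIntegrable φ)) :
    (∀ F ∈ Glauber.cylinderFunctions d, MemLp F 2 μ ∧
      (∀ᵐ γ ∂μ, Integrable (Glauber.birthIntegrand φ z F γ)) ∧
      MemLp (Glauber.generator φ z F) 2 μ) ∧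
    (∀ F ∈ Glauber.cylinderFunctions d, ∀ G ∈ Glauber.cylinderFunctions d,
      Integrable (Glauber.carre F G) μ ∧
      Glauber.energy μ F G = ∫ γ, Glauber.generator φ z F γ * G γ ∂μ) ∧
    ∃ (E₀ : Glauber.PartialForm (Lp ℝ 2 μ)) (H₀ : Lp ℝ 2 μ →ₗ.[ℝ] Lp ℝ 2 μ),
      Glauber.IsCylinderForm μ E₀ ∧ Glauber.IsCylinderOperator φ z μ H₀ ∧
      E₀.IsClosable ∧
      (∃ E : Glauber.PartialForm (Lp ℝ 2 μ), E.IsClosureOf E₀ ∧ E.IsDirichletForm) ∧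
      ∃ H : Lp ℝ 2 μ →ₗ.[ℝ] Lp ℝ 2 μ, Glauber.PartialForm.IsFriedrichsExtension H H₀ := by
  have := hμ.1
  have : Nonempty (Fin d) := ⟨⟨0, hd⟩⟩
  have hm := hφ.measurable
  -- The two alternatives enter only through the moment bounds; everything after this is common to
  -- both.
  have h : Glauber.HasMomentBounds φ μ := by
    rcases hcond with ⟨-, hSS, hLR, ht⟩ | ⟨hpos, -⟩
    · exact Glauber.hasMomentBounds_of_superstable hz hφ hμ hSS hLR ht
    · exact Glauber.hasMomentBounds_of_nonneg hμ hpos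
  have hH := Glauber.isNonnegSymm_generatorOperator hz hm hμ h
  have hE := Glauber.PartialForm.isClosureOf_embed hH
  refine ⟨fun F hF => ⟨Glauber.cylinder_memLp hF 2, ?_, Glauber.generator_memLp hz hm h hF⟩,
    fun F hF G hG => ⟨Glauber.integrable_carre h hF hG,
      Glauber.energy_eq_integral_generator hz hm hμ h hF hG⟩,
    _, _, Glauber.isCylinderForm_generatorOperator hz hm hμ h,
    Glauber.isCylinderOperator_generatorOperator hz hm hμ h,
    Glauber.PartialForm.isClosable_ofOperator hH,
    ⟨_, hE, Glauber.isDirichletForm_closure hz hm hμ h _ hE⟩,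
    _, Glauber.PartialForm.isFriedrichsExtension_embed hH (Glauber.dense_cylinderSubmodule μ)⟩
  obtain ⟨T, -, hT⟩ := Glauber.birthIntegrand_bound hz hm h hF
  filter_upwards [hT] with γ hγ using hγ.2.1
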